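/- **Proposition 3.4 (Bounded Length of Characteristics).** Let $G\subset\mathbb{C}$ be a Jordan domain with $C^2$ boundary, i.e. a bounded domain whose boundary is a simple closed curve with a regular $C^2$ parametrization, and let $K\ge 1$. Then there is a constant $M=M(G,K)<\infty$, depending only on $G$ and $K$, such that for every $K$-quasi-HP function $\theta$ on $G$ and every elementary characteristic $C$ of $\theta$ (of either family), $$\lambda(C)\le M,$$ where $\lambda$ denotes length (one-dimensional Hausdorff measure). Here, for a locally Lipschitz function $\theta:G\to\mathbb{R}$, the *1-* and *2-characteristics* of $\theta$ are the integral curves in $G$ of the fields $e^{i\theta(z)}$ and $ie^{i\theta(z)}$, respectively; a *full* characteristic is a complete (maximal) integral curve in $G$, and a *$k$-arc* is an arc of a $k$-characteristic. A *characteristic quadrilateral* $abcd$ of $\theta$ is a domain $Q\subset G$ whose boundary is a Jordan curve lying in $G$ and containing four distinct points $a,b,d,c$, occurring in this order when $\partial Q$ is traversed in the positive or in the negative sense, such that the boundary arcs $ab$ and $cd$ are $i$-arcs and the boundary arcs $ac$ and $bd$ are $j$-arcs, where $\{i,j\}=\{1,2\}$. The function $\theta$ is a *$K$-quasi-HP function*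 on $G$ if it is locally Lipschitz and for every characteristic quadrilateral $abcd$ in $G$ $$\frac1K\,|\theta(c)-\theta(a)|\le|\theta(d)-\theta(b)|\le K\,|\theta(c)-\theta(a)|.$$ An *elementary $k$-characteristic* is a full $k$-characteristic together with its two endpoints, which are limits of its parametrization at the two ends and are required to lie on $\partial G$, or (trivially) a single point $\{p\}$ with $p\in\partial G$. -/

import Mathlib

open Set Filter Topology MeasureTheory

noncomputable section

namespace QuasiHP

/-- The class of Jordan domains with `C²` boundary: bounded plane domains whose boundary is a simple
closed curve admitting a regular `C²` parametrization. -/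
structure IsC2JordanDomain (G : Set ℂ) : Prop where
  isOpen : IsOpen G
  isConnected : IsConnected G
  isBounded : Bornology.IsBounded G
  boundary : ∃ γ : ℝ → ℂ, ContDiff ℝ 2 γ ∧ (∀ t, deriv γ t ≠ 0) ∧ Function.Periodic γ 1 ∧
    InjOn γ (Ico 0 1) ∧ range γ = frontier G

/-- The direction fields `e^{iθ}` (index `0`) and `i e^{iθ}` (index `1`), whose integral curves are
the characteristics of the first and of the second family, respectively. -/
def charField (θ : ℂ → ℝ) (k : Fin 2) (z : ℂ) : ℂ :=
  Complex.I ^ (k : ℕ) * Complex.exp (θ z * Complex.I)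

/-- `A` is a (nondegenerate, closed) simple arc in `G`, with endpoints `a` and `b`, of a
characteristic of family `k`. The arc is not oriented: the field may run from `a` to `b` or from
`b` to `a`. -/
def IsCharArc (G : Set ℂ) (θ : ℂ → ℝ) (k : Fin 2) (A : Set ℂ) (a b : ℂ) : Prop :=
  ∃ (l : ℝ) (z : ℝ → ℂ), 0 < l ∧ IsIntegralCurveOn z (fun _ ↦ charField θ k) (Icc 0 l) ∧
    InjOn z (Icc 0 l) ∧ MapsTo z (Icc 0 l) G ∧ z '' Icc 0 l = A ∧
    ((z 0 = a ∧ z l = b) ∨ (z 0 = b ∧ z l = a))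

/-- `abcd` is a characteristic quadrilateral of `θ` in `G`, positively or negatively oriented: there
is a domain `Q ⊆ G` whose boundary is a Jordan curve lying in `G` that passes through `a, b, d, c`
in this cyclic order, such that the boundary arcs `ab`, `cd` are arcs of characteristics of one
family and the boundary arcs `ac`, `bd` are arcs of characteristics of the other family. (That the
boundary is a Jordan curve is expressed by the four simple arcs meeting in the four corners only.) -/
def IsCharQuadrilateral (G : Set ℂ) (θ : ℂ → ℝ) (a b c d : ℂ) : Prop :=
  ∃ (i j : Fin 2) (Q AB CD AC BD : Set ℂ), i ≠ j ∧
    IsOpen Q ∧ IsConnected Q ∧ Q ⊆ G ∧ frontier Q = AB ∪ BD ∪ CD ∪ AC ∧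
    IsCharArc G θ i AB a b ∧ IsCharArc G θ i CD c d ∧
    IsCharArc G θ j AC a c ∧ IsCharArc G θ j BD b d ∧
    AB ∩ AC = {a} ∧ AB ∩ BD = {b} ∧ CD ∩ AC = {c} ∧ CD ∩ BD = {d} ∧
    AB ∩ CD = ∅ ∧ AC ∩ BD = ∅

/-- `θ` is a `K`-quasi-HP function on `G`. Only the values of `θ` on `G` matter. -/
structure IsQuasiHP (G : Set ℂ) (K : ℝ) (θ : ℂ → ℝ) : Prop where
  locallyLipschitzOn : LocallyLipschitzOn G θ
  quasiHP : ∀ a b c d : ℂ, IsCharQuadrilateral G θ a b c d →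
    1 / K * |θ c - θ a| ≤ |θ d - θ b| ∧ |θ d - θ b| ≤ K * |θ c - θ a|

/-- `z`, restricted to the open interval `I`, parametrizes a full characteristic of family `k`, that
is, a complete (not further extendable) integral curve in `G` of the corresponding field. The speed
is `1`, so the parameter is arc length; `I` may be unbounded. -/
structure IsFullCharacteristic (G : Set ℂ) (θ : ℂ → ℝ) (k : Fin 2) (I : Set ℝ) (z : ℝ → ℂ) :
    Prop where
  isOpen : IsOpen I
  ordConnected : I.OrdConnected
  nonempty : I.Nonempty
  integral : IsIntegralCurveOn z (fun _ ↦ charField θ k) I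
  mapsTo : MapsTo z I G
  maximal : ∀ (J : Set ℝ) (w : ℝ → ℂ), IsOpen J → J.OrdConnected → I ⊆ J →
    IsIntegralCurveOn w (fun _ ↦ charField θ k) J → MapsTo w J G → EqOn w z I → J = I

/-- `C` is an elementary characteristic of family `k`: either a full characteristic together with
its two endpoints (the limits of the parametrization at the left and at the right end of the
parameter interval `I`), these being points of the boundary of `G`, or a trivial one, consisting
of a single boundary point. -/
def IsElementaryCharacteristic (G : Set ℂ) (θ : ℂ → ℝ) (k : Fin 2) (C : Set ℂ) : Prop :=
  (∃ (I : Set ℝ) (z : ℝ → ℂ) (p q : ℂ), IsFullCharacteristic G θ k I z ∧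
    p ∈ frontier G ∧ q ∈ frontier G ∧
    Tendsto (fun s : I ↦ z s) atBot (𝓝 p) ∧ Tendsto (fun s : I ↦ z s) atTop (𝓝 q) ∧
    C = insert p (insert q (z '' I))) ∨
  ∃ p ∈ frontier G, C = {p}

end QuasiHP

end

/-!
# Bounded length of characteristics of quasi-HP functions

The bound comes from comparing areas. Let `z` be an arc of a characteristic, parametrized by arc
length, of the family with slope angle `α`, and let `ε` be so small that `z` keeps the distance `2ε`
from the complement of `G`. At a parameter `s` at which `α ∘ z` increases at arbitrarily small steps
to the right, start the trajectory `t ↦ Ψ (s, t)` of the other family at `z s` on the side where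
neighbouring trajectories diverge; at the remaining parameters, where `α ∘ z` does not
increase to the right, use the opposite side. Four facts give the estimate.

* Both families come from a single-valued slope angle, so a closed curve made of one arc of each
  family is impossible, by an argument about the turning of the tangent as for the
  Umlaufsatz (`injective_of_hasDerivAt`, `not_bigon`). Hence `Ψ` is injective (`net_injective`).
* The two-sided quasi-HP estimate says that the turning of `α` vanishes along all or along none of
  the parallel sides of a characteristic quadrilateral, so its sign is preserved along the other
  family (`IsFlatNet.turning_nonneg`). The sides then do not get shorter, up to an error quadratic
  in their length (`IsFlatNet.sub_le_meet_fst`), and short arcs can be carried along a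
  whole trajectory (`IsNet.exists_transported_arc`).
* Therefore the Jacobian of `Ψ` is at least `1` wherever `Ψ` is differentiable, that is, almost
  everywhere by Rademacher's theorem (`IsNet.one_le_abs_det`).
* As `G` has finite area, almost every trajectory comes within `ε` of the complement, and before it
  spends at least the time `ε` at a distance between `ε` and `2ε` from it. By the area formula `ε` times the
  measure of the set of parameters is at most the area of that collar
  (`IsNet.mul_volume_le_volume_collar`), which is at most `c ε`, the boundary being a
  rectifiable curve (`IsC2JordanDomain.exists_volume_collar_le`).

With both sides together the arc has length at most `2 c`, whatever `K` is; only the qualitative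
consequence of the quasi-HP estimate, the preservation of sign, enters.
-/

open Set Filter Topology MeasureTheory

noncomputable section

namespace QuasiHP

/-! ### Global flows of bounded Lipschitz fields -/

section Flow

open NNReal

variable {E : Type*} [NormedAddCommGroup E] [NormedSpace ℝ E]

/-- `φ p` is, for every `p`, the complete integral curve of the autonomous field `v` that is at `p`
at time `0`. -/
structure IsFlow (v : E → E) (φ : E → ℝ → E) : Prop where
  zero : ∀ p, φ p 0 = p
  hasDerivAt : ∀ p t, HasDerivAt (φ p) (v (φ p t)) t

theorem exists_isFlow [CompleteSpace E] {v : E → E} {L : ℝ≥0} (hv : LipschitzWith L v)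
    (hb : ∀ x, ‖v x‖ ≤ 1) : ∃ φ, IsFlow v φ := by
  have key : ∀ (p : E) (n : ℕ), ∃ z : ℝ → E, z 0 = p ∧
      ∀ t ∈ Ioo (-(n : ℝ)) n, HasDerivAt z (v (z t)) t := by
    intro p n
    have hn : (0 : ℝ) ∈ Icc (-(n : ℝ)) n := by simp
    have h := IsPicardLindelof.of_time_independent (f := v) (tmin := -(n : ℝ)) (tmax := n)
      (t₀ := ⟨0, hn⟩) (x₀ := p) (a := n) (r := 0) (L := 1) (K := L)
      (fun x _ ↦ hb x) hv.lipschitzOnWith (by simp)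
    obtain ⟨z, hz0, hz⟩ := h.exists_eq_forall_mem_Icc_hasDerivWithinAt₀
    exact ⟨z, hz0, fun t ht ↦ (hz t (Ioo_subset_Icc_self ht)).hasDerivAt (Icc_mem_nhds ht.1 ht.2)⟩
  choose z hz0 hz using key
  have agree : ∀ p (m n : ℕ), m ≤ n → ∀ t : ℝ, |t| < m → z p m t = z p n t := by
    intro p m n hmn t ht
    have hm : (0 : ℝ) < m := (abs_nonneg t).trans_lt ht
    have hmn' : (m : ℝ) ≤ n := by exact_mod_cast hmn
    refine ODE_solution_unique_of_mem_Ioo (v := fun _ ↦ v) (s := fun _ ↦ univ) (K := L)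
      (a := -(m : ℝ)) (b := m) (t₀ := 0) (fun _ _ ↦ hv.lipschitzOnWith) ⟨by linarith, hm⟩
      (fun s hs ↦ ⟨hz p m s hs, trivial⟩)
      (fun s hs ↦ ⟨hz p n s ⟨by linarith [hs.1], by linarith [hs.2]⟩, trivial⟩)
      (by rw [hz0, hz0]) (abs_lt.1 ht)
  refine ⟨fun p t ↦ z p (⌈|t|⌉₊ + 1) t, fun p ↦ hz0 _ _, fun p t ↦ ?_⟩
  set N := ⌈|t|⌉₊ + 2 with hN
  have hNt : |t| + 2 ≤ N := by
    rw [hN]; push_cast; linarith [Nat.le_ceil |t|]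
  have heq : ∀ s : ℝ, |s| < |t| + 1 → z p (⌈|s|⌉₊ + 1) s = z p N s := by
    intro s hs
    have h1 : |s| < ((⌈|s|⌉₊ + 1 : ℕ) : ℝ) := by push_cast; linarith [Nat.le_ceil |s|]
    refine agree p _ _ ?_ s h1
    have : ⌈|s|⌉₊ ≤ ⌈|t| + 1⌉₊ := Nat.ceil_mono hs.le
    rw [Nat.ceil_add_one (abs_nonneg t)] at this
    omega
  have h := hz p N t (abs_lt.1 (by linarith))
  rw [← heq t (by linarith)] at h
  refine h.congr_of_eventuallyEq ?_
  have : ∀ᶠ s in 𝓝 t, |s| < |t| + 1 := continuous_abs.continuousAt.eventually_lt_const (by linarith)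
  filter_upwards [this] with s hs using heq s hs

namespace IsFlow

variable {v : E → E} {φ : E → ℝ → E} {L : ℝ≥0}

theorem continuous (h : IsFlow v φ) (p : E) : Continuous (φ p) :=
  continuous_iff_continuousAt.2 fun t ↦ (h.hasDerivAt p t).continuousAt

theorem neg (h : IsFlow v φ) : IsFlow (-v) (fun p t ↦ φ p (-t)) where
  zero p := by simp [h.zero]
  hasDerivAt p t := by
    simpa [Function.comp_def] using (h.hasDerivAt p (-t)).scomp t (hasDerivAt_neg t)

theorem eq_flow (h : IsFlow v φ) (hv : LipschitzWith L v) {z : ℝ → E}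
    (hz : ∀ t, HasDerivAt z (v (z t)) t) (t : ℝ) : z t = φ (z 0) t := by
  refine congrFun (ODE_solution_unique_univ (v := fun _ ↦ v) (s := fun _ ↦ univ) (K := L)
    (t₀ := 0) (fun _ ↦ hv.lipschitzOnWith) (fun s ↦ ⟨hz s, trivial⟩)
    (fun s ↦ ⟨h.hasDerivAt _ s, trivial⟩) (h.zero _).symm) t

theorem eq_flow_of_mem_Icc (h : IsFlow v φ) (hv : LipschitzWith L v) {z : ℝ → E} {T : ℝ}
    (hz : ∀ t ∈ Icc 0 T, HasDerivWithinAt z (v (z t)) (Icc 0 T) t) :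
    ∀ t ∈ Icc 0 T, z t = φ (z 0) t := by
  refine ODE_solution_unique (v := fun _ ↦ v) (K := L) (fun _ ↦ hv)
    (fun t ht ↦ (hz t ht).continuousWithinAt) (fun t ht ↦ ?_)
    (h.continuous _).continuousOn (fun t ht ↦ (h.hasDerivAt _ t).hasDerivWithinAt) (h.zero _).symm
  exact (hz t (Ico_subset_Icc_self ht)).mono_of_mem_nhdsWithin (Icc_mem_nhdsGE_of_mem ht)

theorem add (h : IsFlow v φ) (hv : LipschitzWith L v) (p : E) (s t : ℝ) :
    φ p (s + t) = φ (φ p s) t := by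
  have := h.eq_flow hv (z := fun t ↦ φ p (s + t))
    (fun t ↦ (h.hasDerivAt p (s + t)).comp_const_add s t) t
  simpa using this

theorem neg_cancel (h : IsFlow v φ) (hv : LipschitzWith L v) (p : E) (t : ℝ) :
    φ (φ p t) (-t) = p := by
  rw [← h.add hv, add_neg_cancel, h.zero]

theorem dist_le (h : IsFlow v φ) (hv : LipschitzWith L v) (p q : E) (t : ℝ) :
    dist (φ p t) (φ q t) ≤ dist p q * Real.exp (L * |t|) := by
  have pos : ∀ {v : E → E} {φ : E → ℝ → E}, IsFlow v φ → LipschitzWith L v → ∀ t, 0 ≤ t →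
      dist (φ p t) (φ q t) ≤ dist p q * Real.exp (L * t) := by
    intro v φ h hv t ht
    have := dist_le_of_trajectories_ODE (v := fun _ ↦ v) (K := L) (a := 0) (b := t)
      (δ := dist p q) (fun _ ↦ hv)
      (h.continuous p).continuousOn (fun s _ ↦ (h.hasDerivAt p s).hasDerivWithinAt)
      (h.continuous q).continuousOn (fun s _ ↦ (h.hasDerivAt q s).hasDerivWithinAt)
      (by rw [h.zero, h.zero]) t ⟨ht, le_rfl⟩
    simpa using this
  rcases le_total 0 t with ht | ht
  · rw [abs_of_nonneg ht]; exact pos h hv t ht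
  · rw [abs_of_nonpos ht]
    simpa using pos h.neg hv.neg (-t) (by linarith)

theorem dist_time_le (h : IsFlow v φ) (hb : ∀ x, ‖v x‖ ≤ 1) (p : E) (s t : ℝ) :
    dist (φ p s) (φ p t) ≤ |s - t| := by
  have := Convex.norm_image_sub_le_of_norm_hasDerivWithin_le (f := φ p) (f' := fun t ↦ v (φ p t))
    (s := univ) (C := 1) (fun t _ ↦ (h.hasDerivAt p t).hasDerivWithinAt)
    (fun t _ ↦ hb _) convex_univ (mem_univ t) (mem_univ s)
  rw [dist_eq_norm]; simpa using this

theorem continuous_uncurry (h : IsFlow v φ) (hv : LipschitzWith L v) :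
    Continuous fun x : E × ℝ ↦ φ x.1 x.2 := by
  rw [continuous_iff_continuousAt]
  rintro ⟨p, t⟩
  rw [ContinuousAt, tendsto_iff_dist_tendsto_zero]
  have h1 : Continuous fun x : E × ℝ ↦
      dist x.1 p * Real.exp (L * |x.2|) + dist (φ p x.2) (φ p t) := by
    have := h.continuous p
    fun_prop
  refine squeeze_zero (fun _ ↦ dist_nonneg) (fun x ↦ ?_) (h1.tendsto' (p, t) 0 (by simp))
  exact (dist_triangle _ (φ p x.2) _).trans (by gcongr; exact h.dist_le hv _ _ _)

end IsFlow

end Flow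

/-- The unit field of slope angle `α`, turned by the constant unit factor `κ`. -/
def dirField (κ : ℂ) (α : ℂ → ℝ) (w : ℂ) : ℂ := κ * Complex.exp (α w * Complex.I)

theorem norm_dirField {κ : ℂ} (hκ : ‖κ‖ = 1) (α : ℂ → ℝ) (w : ℂ) : ‖dirField κ α w‖ = 1 := by
  rw [dirField, norm_mul, hκ, Complex.norm_exp_ofReal_mul_I, one_mul]

theorem norm_exp_mul_I_sub_le (a b : ℝ) :
    ‖Complex.exp (a * Complex.I) - Complex.exp (b * Complex.I)‖ ≤ |a - b| := by
  have h : Complex.exp (a * Complex.I) - Complex.exp (b * Complex.I)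
      = Complex.exp (b * Complex.I) * (Complex.exp (Complex.I * (a - b : ℝ)) - 1) := by
    rw [mul_sub, ← Complex.exp_add]; push_cast; ring_nf
  rw [h, norm_mul, Complex.norm_exp_ofReal_mul_I, one_mul]
  exact Real.norm_exp_I_mul_ofReal_sub_one_le

theorem norm_dirField_sub_le {κ : ℂ} (hκ : ‖κ‖ = 1) (α β : ℂ → ℝ) (w w' : ℂ) :
    ‖dirField κ α w - dirField κ β w'‖ ≤ |α w - β w'| := by
  rw [dirField, dirField, ← mul_sub, norm_mul, hκ, one_mul]
  exact norm_exp_mul_I_sub_le _ _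

theorem lipschitzWith_dirField {κ : ℂ} (hκ : ‖κ‖ = 1) {α : ℂ → ℝ} {L : NNReal}
    (hα : LipschitzWith L α) : LipschitzWith L (dirField κ α) :=
  LipschitzWith.of_dist_le_mul fun w w' ↦ by
    rw [dist_eq_norm]
    exact (norm_dirField_sub_le hκ α α w w').trans (hα.dist_le_mul w w')

/-! ### Continuous arguments -/

section Arg

/-- A continuous nowhere vanishing function on a convex set has a continuous argument. -/
theorem exists_continuousOn_arg {X : Type*} [NormedAddCommGroup X] [NormedSpace ℝ X] {D : Set X}
    (hD : Convex ℝ D) {f : X → ℂ} (hf : ContinuousOn f D) (h0 : ∀ x ∈ D, f x ≠ 0) :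
    ∃ A : X → ℝ, ContinuousOn A D ∧ ∀ x ∈ D, f x = ‖f x‖ * Complex.exp (A x * Complex.I) := by
  classical
  rcases D.eq_empty_or_nonempty with rfl | ⟨p, hp⟩
  · exact ⟨fun _ ↦ 0, by simp, by simp⟩
  have hmem : ∀ (u : unitInterval) (x : D), p + (u : ℝ) • ((x : X) - p) ∈ D := fun u x ↦ by
    have := hD hp x.2 (a := 1 - u) (b := u) (by linarith [u.2.2]) u.2.1 (by ring)
    convert! this using 1
    module
  have hcont : Continuous fun y : unitInterval × D ↦ f (p + (y.1 : ℝ) • ((y.2 : X) - p)) :=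
    hf.comp_continuous (by fun_prop) fun y ↦ hmem y.1 y.2
  let H : C(unitInterval × D, {z : ℂ // z ≠ 0}) :=
    ⟨fun y ↦ ⟨f (p + (y.1 : ℝ) • ((y.2 : X) - p)), h0 _ (hmem y.1 y.2)⟩, hcont.subtype_mk _⟩
  have hH : ∀ a : D, H (0, a) = ⟨Complex.exp (Complex.log (f p)), Complex.exp_ne_zero _⟩ := by
    intro a
    apply Subtype.ext
    simp [H, Complex.exp_log (h0 p hp)]
  let G := Complex.isCoveringMap_exp.liftHomotopy H (ContinuousMap.const D (Complex.log (f p))) hH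
  have hG : ∀ x : D, Complex.exp (G (1, x)) = f x := fun x ↦ by
    have := congrArg Subtype.val
      (congrFun (Complex.isCoveringMap_exp.liftHomotopy_lifts H
        (ContinuousMap.const D (Complex.log (f p))) hH) (1, x))
    simpa [H] using this
  refine ⟨fun x ↦ if hx : x ∈ D then (G (1, ⟨x, hx⟩)).im else 0, ?_, fun x hx ↦ ?_⟩
  · rw [continuousOn_iff_continuous_domRestrict]
    have : D.domRestrict (fun x ↦ if hx : x ∈ D then (G (1, ⟨x, hx⟩)).im else 0)
        = fun x : D ↦ (G (1, x)).im := by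
      ext x; simp
    rw [this]
    fun_prop
  · simp only [hx, dite_true]
    have h := hG ⟨x, hx⟩
    have hn : (‖f x‖ : ℂ) = Complex.exp ((G (1, ⟨x, hx⟩)).re : ℂ) := by
      rw [← Complex.ofReal_exp, ← Complex.norm_exp, h]
    rw [hn, ← Complex.exp_add, Complex.re_add_im, h]

/-- The real number `a` is an argument of the complex number `c`. -/
def IsArg (c : ℂ) (a : ℝ) : Prop := c = ‖c‖ * Complex.exp (a * Complex.I)

theorem IsArg.neg {c : ℂ} {a : ℝ} (h : IsArg c a) : IsArg (-c) (a + Real.pi) := by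
  unfold IsArg at h ⊢
  rw [norm_neg, Complex.ofReal_add, add_mul, Complex.exp_add, Complex.exp_pi_mul_I]
  linear_combination -h

theorem IsArg.of_real_mul {c : ℂ} {a r : ℝ} (hr : 0 ≤ r) (h : IsArg c a) : IsArg (r * c) a := by
  unfold IsArg at h ⊢
  rw [norm_mul, Complex.norm_of_nonneg hr]
  push_cast
  linear_combination (r : ℂ) * h

theorem IsArg.exp_sub {c : ℂ} (hc : c ≠ 0) {a b : ℝ} (ha : IsArg c a) (hb : IsArg c b) :
    Complex.exp ((a - b : ℝ) * Complex.I) = 1 := by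
  unfold IsArg at ha hb
  have hn : (‖c‖ : ℂ) ≠ 0 := by simpa using hc
  have : Complex.exp (a * Complex.I) = Complex.exp (b * Complex.I) :=
    mul_left_cancel₀ hn (ha.symm.trans hb)
  rw [Complex.ofReal_sub, sub_mul, Complex.exp_sub, this, div_self (Complex.exp_ne_zero _)]

/-- Arguments of numbers in a common half-plane, chosen continuously on a connected set, differ
by less than `π`. -/
theorem abs_sub_lt_pi_of_halfPlane {X : Type*} [TopologicalSpace X] {S : Set X}
    (hS : IsPreconnected S) {f : X → ℂ} {A : X → ℝ} (hA : ContinuousOn A S)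
    (hfA : ∀ x ∈ S, IsArg (f x) (A x)) {v : ℂ} (hv : ∀ x ∈ S, 0 < (f x * star v).re)
    {x y : X} (hx : x ∈ S) (hy : y ∈ S) : |A x - A y| < Real.pi := by
  have hcos : ∀ x ∈ S, Real.cos (A x - v.arg) ≠ 0 := by
    intro x hx h
    have h1 := hv x hx
    have h2 : f x * star v = (‖f x‖ * ‖v‖ : ℝ) * Complex.exp ((A x - v.arg : ℝ) * Complex.I) := by
      have hvv : star v = ‖v‖ * Complex.exp (-(v.arg * Complex.I)) := by
        conv_lhs => rw [← Complex.norm_mul_exp_arg_mul_I v]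
        rw [star_mul', Complex.star_def, Complex.conj_ofReal, ← Complex.exp_conj]
        simp
      rw [hvv, show f x = ‖f x‖ * Complex.exp (A x * Complex.I) from hfA x hx]
      simp only [Complex.ofReal_sub, sub_mul, Complex.exp_sub, Complex.exp_neg, Complex.ofReal_mul,
        norm_mul, Complex.norm_real, norm_norm, Complex.norm_exp_ofReal_mul_I, mul_one, div_eq_mul_inv]
      ring
    rw [h2, Complex.re_ofReal_mul, Complex.exp_ofReal_mul_I_re, h, mul_zero] at h1
    exact lt_irrefl _ h1
  have key : ∀ x ∈ S, ∀ y ∈ S, A y - A x < Real.pi := by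
    intro x hx y hy
    by_contra! hcon
    set n := ⌈(A x - v.arg - Real.pi / 2) / Real.pi⌉ with hn
    have h1 : (A x - v.arg - Real.pi / 2) ≤ n * Real.pi := by
      rw [← div_le_iff₀ Real.pi_pos]; exact Int.le_ceil _
    have h2 : n * Real.pi < (A x - v.arg - Real.pi / 2) + Real.pi := by
      have := Int.ceil_lt_add_one ((A x - v.arg - Real.pi / 2) / Real.pi)
      rw [← hn, ← sub_lt_iff_lt_add, lt_div_iff₀ Real.pi_pos] at this
      linarith
    obtain ⟨u, hu, hu'⟩ := hS.intermediate_value hx hy hA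
      (show v.arg + Real.pi / 2 + n * Real.pi ∈ Icc (A x) (A y) from
        ⟨by linarith, by linarith⟩)
    refine hcos u hu ?_
    rw [hu', Real.cos_eq_zero_iff]
    exact ⟨n, by ring⟩
  rw [abs_sub_lt_iff]
  exact ⟨key y hy x hx, key x hx y hy⟩

/-- A continuous function on a connected set all of whose values are integer multiples of `2π` is
constant. -/
theorem exists_int_of_exp_eq_one {X : Type*} [TopologicalSpace X] {S : Set X}
    (hS : IsPreconnected S) {A : X → ℝ} (hA : ContinuousOn A S)
    (h : ∀ x ∈ S, Complex.exp (A x * Complex.I) = 1) :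
    ∃ n : ℤ, ∀ x ∈ S, A x = 2 * Real.pi * n := by
  rcases S.eq_empty_or_nonempty with rfl | ⟨p, hp⟩
  · exact ⟨0, by simp⟩
  have hint : ∀ x ∈ S, ∃ n : ℤ, A x = 2 * Real.pi * n := by
    intro x hx
    obtain ⟨n, hn⟩ := Complex.exp_eq_one_iff.1 (h x hx)
    refine ⟨n, ?_⟩
    have : (A x : ℂ) = ((2 * Real.pi * n : ℝ) : ℂ) := by
      apply mul_right_cancel₀ Complex.I_ne_zero
      rw [hn]; push_cast; ring
    exact_mod_cast this
  obtain ⟨n, hn⟩ := hint p hp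
  refine ⟨n, fun x hx ↦ ?_⟩
  obtain ⟨m, hm⟩ := hint x hx
  have := abs_sub_lt_pi_of_halfPlane hS hA (f := fun _ ↦ 1) (v := 1)
    (fun x hx ↦ by simp [IsArg, h x hx]) (by simp) hx hp
  rw [hm, hn, ← mul_sub, abs_mul, abs_of_pos Real.two_pi_pos] at this
  have h2 : |((m - n : ℤ) : ℝ)| < 1 := by
    push_cast
    nlinarith [Real.pi_pos, abs_nonneg ((m : ℝ) - n)]
  rw [← Int.cast_abs] at h2
  have : |m - n| < 1 := by exact_mod_cast h2
  rw [Int.abs_lt_one_iff, sub_eq_zero] at this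
  rw [hm, this]

end Arg

/-! ### Chords of curves with continuous tangent angle -/

section Chord

variable {γ : ℝ → ℂ} {β : ℝ → ℝ}

/-- The difference quotient of a curve with unit tangent `exp (β t * I)`, in the form of an integral
so that it is continuous up to the diagonal, where it is the tangent. -/
def chord (β : ℝ → ℝ) (x : ℝ × ℝ) : ℂ :=
  ∫ u in (0 : ℝ)..1, Complex.exp (β (x.1 + u * (x.2 - x.1)) * Complex.I)

theorem continuous_chord (hβ : Continuous β) : Continuous (chord β) := by
  unfold chord
  apply intervalIntegral.continuous_parametric_intervalIntegral_of_continuous'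
  fun_prop

theorem chord_self (t : ℝ) : chord β (t, t) = Complex.exp (β t * Complex.I) := by
  simp [chord]

theorem sub_eq_mul_chord (hβ : Continuous β)
    (hγ : ∀ t, HasDerivAt γ (Complex.exp (β t * Complex.I)) t) (x y : ℝ) :
    γ y - γ x = (y - x : ℝ) * chord β (x, y) := by
  have h1 := intervalIntegral.integral_eq_sub_of_hasDerivAt (a := x) (b := y)
    (fun t _ ↦ hγ t) (Continuous.intervalIntegrable (by fun_prop) _ _)
  rw [← h1, chord]
  have h2 := intervalIntegral.smul_integral_comp_add_mul (a := 0) (b := 1)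
    (fun t ↦ Complex.exp (β t * Complex.I)) (y - x) x
  simp only [mul_zero, add_zero, mul_one, add_sub_cancel] at h2
  rw [← h2, Complex.real_smul]
  simp only [mul_comm]

/-- The arguments of the chords of a curve, normalized to be the tangent angle on the diagonal. -/
theorem exists_secant_arg (hβ : Continuous β)
    (hγ : ∀ t, HasDerivAt γ (Complex.exp (β t * Complex.I)) t) {D : Set (ℝ × ℝ)}
    (hD : Convex ℝ D) (hle : ∀ x ∈ D, x.1 ≤ x.2) (h0 : ∀ x ∈ D, chord β x ≠ 0) :
    ∃ A : ℝ × ℝ → ℝ, ContinuousOn A D ∧ (∀ x ∈ D, IsArg (γ x.2 - γ x.1) (A x)) ∧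
      ∀ t, (t, t) ∈ D → A (t, t) = β t := by
  obtain ⟨A, hA, hAf⟩ := exists_continuousOn_arg hD (continuous_chord hβ).continuousOn h0
  have hdiag : Convex ℝ {t : ℝ | (t, t) ∈ D} := by
    intro s hs t ht a b ha hb hab
    have := hD hs ht ha hb hab
    simpa using this
  obtain ⟨n, hn⟩ := exists_int_of_exp_eq_one (A := fun t ↦ A (t, t) - β t) hdiag.isPreconnected
    ((ContinuousOn.comp (f := fun t : ℝ ↦ (t, t)) hA (by fun_prop) fun t ht ↦ ht).sub
      hβ.continuousOn) (by
      intro t ht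
      refine IsArg.exp_sub (h0 _ ht) (hAf _ ht) ?_
      simp [IsArg, chord_self, Complex.norm_exp_ofReal_mul_I])
  refine ⟨fun x ↦ A x - 2 * Real.pi * n, hA.sub continuousOn_const, fun x hx ↦ ?_,
    fun t ht ↦ by linarith [hn t ht]⟩
  have hshift : Complex.exp (((A x - 2 * Real.pi * n : ℝ) : ℂ) * Complex.I)
      = Complex.exp (A x * Complex.I) := by
    have : ((A x - 2 * Real.pi * n : ℝ) : ℂ) * Complex.I
        = A x * Complex.I - n * (2 * Real.pi * Complex.I) := by push_cast; ring
    rw [this, Complex.exp_periodic.sub_int_mul_eq]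
  rw [sub_eq_mul_chord hβ hγ]
  refine IsArg.of_real_mul (by linarith [hle x hx]) ?_
  rw [IsArg, hshift]
  exact hAf x hx

theorem norm_sub_sub_le {v : ℝ → ℂ} {e : ℂ} (hγ : ∀ t, HasDerivAt γ (v t) t) {η x y : ℝ}
    (h : ∀ t ∈ uIcc x y, ‖v t - e‖ ≤ η) : ‖γ y - γ x - (y - x : ℝ) * e‖ ≤ η * |y - x| := by
  have hd : ∀ t, HasDerivAt (fun t : ℝ ↦ γ t - t * e) (v t - e) t := fun t ↦ by
    simpa [Pi.sub_def] using (hγ t).sub ((Complex.ofRealCLM.hasDerivAt (x := t)).mul_const e)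
  have := Convex.norm_image_sub_le_of_norm_hasDerivWithin_le
    (fun t _ ↦ (hd t).hasDerivWithinAt) h (convex_uIcc x y) left_mem_uIcc right_mem_uIcc
  simp only [Real.norm_eq_abs] at this
  convert! this using 2
  push_cast; ring

end Chord

/-! ### Characteristics neither close up nor form bigons -/

section Topological

variable {θ : ℂ → ℝ} {z w : ℝ → ℂ}

theorem convex_triangle (a b c : ℝ) :
    Convex ℝ {x : ℝ × ℝ | a ≤ x.1 ∧ x.1 ≤ x.2 ∧ x.2 ≤ b ∧ x.2 - x.1 < c} := by
  rintro x ⟨h1, h2, h3, h4⟩ y ⟨k1, k2, k3, k4⟩ s t hs ht hst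
  simp only [mem_ofPred_eq, Prod.fst_add, Prod.snd_add, Prod.smul_fst, Prod.smul_snd, smul_eq_mul]
  obtain rfl : s = 1 - t := by linarith
  refine ⟨by nlinarith, by nlinarith, by nlinarith, ?_⟩
  rcases ht.eq_or_lt with rfl | ht
  · simpa using h4
  · nlinarith

theorem eventually_chord_near {β : ℝ → ℝ} (hβ : Continuous β) (t : ℝ) :
    ∀ᶠ ε in 𝓝[>] (0 : ℝ), ∀ x y, |x - t| ≤ ε → |y - t| ≤ ε →
      1 / 2 < (chord β (x, y) * Complex.exp (-(β t * Complex.I))).re := by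
  have hc : Continuous fun p : ℝ × ℝ ↦ (chord β p * Complex.exp (-(β t * Complex.I))).re := by
    have := continuous_chord hβ
    fun_prop
  have hev : ∀ᶠ p : ℝ × ℝ in 𝓝 (t, t),
      1 / 2 < (chord β p * Complex.exp (-(β t * Complex.I))).re := by
    refine hc.continuousAt.eventually_const_lt ?_
    beta_reduce
    rw [chord_self, ← Complex.exp_add, add_neg_cancel]
    norm_num
  obtain ⟨δ, hδ, h⟩ := Metric.eventually_nhds_iff.1 hev
  filter_upwards [Ioo_mem_nhdsGT hδ] with ε hε x y hx hy
  refine h (lt_of_le_of_lt ?_ hε.2)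
  rw [Prod.dist_eq, Real.dist_eq, Real.dist_eq]
  exact max_le hx hy

theorem eventually_abs_sub_lt_half {A : ℝ × ℝ → ℝ} {D : Set (ℝ × ℝ)} (hA : ContinuousOn A D)
    {p : ℝ × ℝ} (hp : p ∈ D) {a : ℝ} (ha : A p = a) {g : ℝ → ℝ × ℝ} (hg : Continuous g)
    (h0 : g 0 = p) (hD : ∀ᶠ ε in 𝓝[>] (0 : ℝ), g ε ∈ D) :
    ∀ᶠ ε in 𝓝[>] (0 : ℝ), |A (g ε) - a| < 1 / 2 := by
  have hT : Tendsto g (𝓝[>] 0) (𝓝[D] p) :=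
    tendsto_nhdsWithin_iff.2 ⟨(hg.tendsto' 0 _ h0).mono_left nhdsWithin_le_nhds, hD⟩
  refine (((hA _ hp).tendsto.comp hT).sub_const a).abs.eventually_lt_const ?_
  rw [ha]; simp

/-- A simple closed curve whose tangent angle is a single-valued continuous function of the point
cannot exist: the tangent would have to turn by `±2π` along it. -/
theorem injective_of_hasDerivAt (hθ : Continuous θ)
    (hz : ∀ t, HasDerivAt z (Complex.exp (θ (z t) * Complex.I)) t) : Function.Injective z := by
  have hzc : Continuous z := continuous_iff_continuousAt.2 fun t ↦ (hz t).continuousAt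
  set β : ℝ → ℝ := fun t ↦ θ (z t) with hβdef
  have hβ : Continuous β := hθ.comp hzc
  have hchord : ∀ x y, z y - z x = (y - x : ℝ) * chord β (x, y) := sub_eq_mul_chord hβ hz
  suffices key : ∀ a b, a < b → z a ≠ z b by
    intro a b hab
    by_contra hne
    rcases lt_or_gt_of_ne hne with h | h
    · exact key a b h hab
    · exact key b a h hab.symm
  intro a b hab hzab
  -- A coincidence with the least parameter difference bounds a simple loop.
  let P : Set (ℝ × ℝ) := (Icc a b ×ˢ Icc a b) ∩ {x | x.1 ≤ x.2 ∧ chord β x = 0}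
  have hP : IsCompact P := by
    refine (isCompact_Icc.prod isCompact_Icc).inter_right ?_
    exact (isClosed_le continuous_fst continuous_snd).inter
      (isClosed_eq (continuous_chord hβ) continuous_const)
  have hPmem : ∀ x y, a ≤ x → x ≤ y → y ≤ b → chord β (x, y) = 0 → (x, y) ∈ P :=
    fun x y h1 h2 h3 h4 ↦ ⟨⟨⟨h1, h2.trans h3⟩, ⟨h1.trans h2, h3⟩⟩, h2, h4⟩
  have hPne : P.Nonempty := by
    refine ⟨(a, b), hPmem a b le_rfl hab.le le_rfl ?_⟩
    have := hchord a b
    rw [hzab, sub_self, eq_comm, mul_eq_zero] at this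
    refine this.resolve_left ?_
    rw [Complex.ofReal_eq_zero]; linarith
  obtain ⟨⟨x₀, y₀⟩, h₀, hmin⟩ := hP.exists_isMinOn hPne
    (f := fun x : ℝ × ℝ ↦ x.2 - x.1) (by fun_prop)
  obtain ⟨⟨hx₀, hy₀⟩, hle₀, hc₀⟩ := h₀
  simp only at hx₀ hy₀ hle₀
  have hlt : x₀ < y₀ := by
    refine lt_of_le_of_ne hle₀ fun h ↦ ?_
    rw [h, chord_self] at hc₀
    exact Complex.exp_ne_zero _ hc₀
  have hz₀ : z y₀ = z x₀ := by
    rw [← sub_eq_zero, hchord, hc₀, mul_zero]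
  let D : Set (ℝ × ℝ) := {x | x₀ ≤ x.1 ∧ x.1 ≤ x.2 ∧ x.2 ≤ y₀ ∧ x.2 - x.1 < y₀ - x₀}
  have hDc : ∀ x ∈ D, chord β x ≠ 0 := by
    rintro ⟨x, y⟩ ⟨h1, h2, h3, h4⟩ h
    have := hmin (hPmem x y (hx₀.1.trans h1) h2 (h3.trans hy₀.2) h)
    simp only [mem_ofPred_eq] at this h4
    linarith
  obtain ⟨A, hA, hAf, hAd⟩ := exists_secant_arg hβ hz (convex_triangle x₀ y₀ (y₀ - x₀))
    (fun x hx ↦ hx.2.1) hDc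
  have hne : ∀ x ∈ D, x.1 < x.2 → z x.2 - z x.1 ≠ 0 := by
    intro x hx hlt h
    rw [hchord, mul_eq_zero] at h
    rcases h with h | h
    · rw [Complex.ofReal_eq_zero] at h; linarith
    · exact hDc x hx h
  have hmem1 : ∀ t ∈ Ioo x₀ y₀, (x₀, t) ∈ D := fun t ht ↦
    ⟨le_rfl, ht.1.le, ht.2.le, by simpa using ht.2⟩
  have hmem2 : ∀ t ∈ Ioo x₀ y₀, (t, y₀) ∈ D := fun t ht ↦
    ⟨ht.1.le, ht.2.le, le_rfl, by simpa using ht.1⟩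
  obtain ⟨m, hm⟩ := exists_int_of_exp_eq_one (S := Ioo x₀ y₀)
    (A := fun t ↦ A (t, y₀) - (A (x₀, t) + Real.pi)) isPreconnected_Ioo
    ((ContinuousOn.comp (f := fun t : ℝ ↦ (t, y₀)) hA (by fun_prop) hmem2).sub
      ((ContinuousOn.comp (f := fun t : ℝ ↦ (x₀, t)) hA (by fun_prop) hmem1).add
        continuousOn_const)) (by
      intro t ht
      refine IsArg.exp_sub (hne _ (hmem2 t ht) ht.2) (hAf _ (hmem2 t ht)) ?_
      have := (hAf _ (hmem1 t ht)).neg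
      simp only [neg_sub] at this
      rwa [hz₀])
  -- Near the vertex `(x₀, y₀)` all chords point backwards.
  set v : ℂ := -Complex.exp (β x₀ * Complex.I) with hv
  have hβ₀ : β y₀ = β x₀ := by simp only [hβdef, hz₀]
  have hev1 : ∀ᶠ ε in 𝓝[>] (0 : ℝ), |A (x₀, x₀ + ε) - β x₀| < 1 / 2 := by
    have hmem : (x₀, x₀) ∈ D := ⟨le_rfl, le_rfl, hlt.le, by simpa using hlt⟩
    refine eventually_abs_sub_lt_half hA hmem (hAd _ hmem) (by fun_prop) (by simp) ?_
    filter_upwards [Ioo_mem_nhdsGT (show (0 : ℝ) < y₀ - x₀ by linarith)] with t ht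
    exact hmem1 _ ⟨by linarith [ht.1], by linarith [ht.2]⟩
  have hev2 : ∀ᶠ ε in 𝓝[>] (0 : ℝ), |A (y₀ - ε, y₀) - β x₀| < 1 / 2 := by
    have hmem : (y₀, y₀) ∈ D := ⟨hlt.le, le_rfl, le_rfl, by simpa using hlt⟩
    refine eventually_abs_sub_lt_half hA hmem ((hAd _ hmem).trans hβ₀) (by fun_prop) (by simp) ?_
    filter_upwards [Ioo_mem_nhdsGT (show (0 : ℝ) < y₀ - x₀ by linarith)] with t ht
    exact hmem2 _ ⟨by linarith [ht.2], by linarith [ht.1]⟩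
  have hsmall : ∀ᶠ ε in 𝓝[>] (0 : ℝ), ε < (y₀ - x₀) / 2 :=
    nhdsWithin_le_nhds (Iio_mem_nhds (by linarith))
  obtain ⟨ε, hc1, hc2, m3, m4, hε2, hε0⟩ := ((eventually_chord_near hβ x₀).and
    ((eventually_chord_near hβ y₀).and (hev1.and (hev2.and
      (hsmall.and self_mem_nhdsWithin))))).exists
  have hε0 : 0 < ε := hε0
  have hv' : star (-v) = Complex.exp (-(β x₀ * Complex.I)) := by
    rw [hv, neg_neg, Complex.star_def, ← Complex.exp_conj]; simp
  rw [hβ₀] at hc2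
  rw [← hv'] at hc1 hc2
  let S : Set (ℝ × ℝ) := D ∩ (Icc x₀ (x₀ + ε) ×ˢ Icc (y₀ - ε) y₀)
  have hS : IsPreconnected S :=
    ((convex_triangle x₀ y₀ (y₀ - x₀)).inter
      ((convex_Icc _ _).prod (convex_Icc _ _))).isPreconnected
  have hSv : ∀ x ∈ S, 0 < ((z x.2 - z x.1) * star v).re := by
    rintro ⟨x, y⟩ ⟨⟨h1, h2, h3, h4⟩, ⟨h5, h6⟩, ⟨h7, h8⟩⟩
    simp only at h1 h2 h3 h4 h5 h6 h7 h8 ⊢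
    have e1 := hc1 x₀ x (by simp [hε0.le]) (by rw [abs_le]; constructor <;> linarith)
    have e2 := hc2 y y₀ (by rw [abs_le]; constructor <;> linarith) (by simp [hε0.le])
    have e3 : (z y - z x) * star v = (x - x₀ : ℝ) * (chord β (x₀, x) * star (-v))
        + (y₀ - y : ℝ) * (chord β (y, y₀) * star (-v)) := by
      have k1 := hchord x₀ x
      have k2 := hchord y y₀
      rw [show star (-v) = -star v from star_neg v]
      linear_combination (-star v) * k1 - star v * k2 + star v * hz₀
    rw [e3, Complex.add_re, Complex.re_ofReal_mul, Complex.re_ofReal_mul]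
    have : 0 < (x - x₀) + (y₀ - y) := by linarith
    nlinarith
  have hx1 : (x₀ + ε, y₀) ∈ S := ⟨hmem2 _ ⟨by linarith, by linarith⟩, ⟨by simp [hε0.le], by simp⟩,
    ⟨by simp [hε0.le], le_rfl⟩⟩
  have hx2 : (x₀, y₀ - ε) ∈ S := ⟨hmem1 _ ⟨by linarith, by linarith⟩, ⟨by simp, by simp [hε0.le]⟩,
    ⟨by simp, by simp [hε0.le]⟩⟩
  have hosc := abs_sub_lt_pi_of_halfPlane hS (hA.mono inter_subset_left)
    (fun x hx ↦ hAf x hx.1) hSv hx1 hx2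
  have m1 := hm (x₀ + ε) ⟨by linarith, by linarith⟩
  have m2 := hm (y₀ - ε) ⟨by linarith, by linarith⟩
  rw [abs_lt] at hosc m3 m4
  have hpi := Real.pi_gt_three
  rcases le_or_gt 0 m with hm0 | hm0
  · have : (0 : ℝ) ≤ m := by exact_mod_cast hm0
    nlinarith
  · have : (m : ℝ) ≤ -1 := by exact_mod_cast (show m ≤ -1 by omega)
    nlinarith

theorem exists_secant_arg_of_injective {γ : ℝ → ℂ} {β : ℝ → ℝ} (hβ : Continuous β)
    (hγ : ∀ t, HasDerivAt γ (Complex.exp (β t * Complex.I)) t) (hinj : Function.Injective γ) :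
    ∃ A : ℝ × ℝ → ℝ, ContinuousOn A {x | x.1 ≤ x.2} ∧
      (∀ x y, x ≤ y → IsArg (γ y - γ x) (A (x, y))) ∧ ∀ t, A (t, t) = β t := by
  have hD : Convex ℝ {x : ℝ × ℝ | x.1 ≤ x.2} := by
    rintro x hx y hy s t hs ht hst
    simp only [mem_ofPred_eq, Prod.fst_add, Prod.snd_add, Prod.smul_fst, Prod.smul_snd,
      smul_eq_mul] at hx hy ⊢
    gcongr
  obtain ⟨A, hA, hAf, hAd⟩ := exists_secant_arg hβ hγ hD (fun x hx ↦ hx) (by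
    rintro ⟨x, y⟩ - h
    have h1 := sub_eq_mul_chord hβ hγ x y
    rw [h, mul_zero, sub_eq_zero] at h1
    obtain rfl := hinj h1
    rw [chord_self] at h
    exact Complex.exp_ne_zero _ h)
  exact ⟨A, hA, fun x y hxy ↦ hAf (x, y) hxy, fun t ↦ hAd t (le_refl t)⟩

theorem convex_rectangle_diff_corners (a b c d : ℝ) :
    Convex ℝ {x : ℝ × ℝ | (x.1 ∈ Icc a b ∧ x.2 ∈ Icc c d) ∧ 0 < (x.1 - a) + (x.2 - c) ∧
      0 < (b - x.1) + (d - x.2)} := by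
  rintro x ⟨⟨⟨h1, h2⟩, h3, h4⟩, h5, h6⟩ y ⟨⟨⟨k1, k2⟩, k3, k4⟩, k5, k6⟩ s t hs ht hst
  simp only [mem_ofPred_eq, mem_Icc, Prod.fst_add, Prod.snd_add, Prod.smul_fst, Prod.smul_snd,
    smul_eq_mul]
  obtain rfl : s = 1 - t := by linarith
  refine ⟨⟨⟨by nlinarith, by nlinarith⟩, by nlinarith, by nlinarith⟩, ?_, ?_⟩
  all_goals
    rcases ht.eq_or_lt with rfl | ht
    · simpa
    · nlinarith

/-- An integer relation between two continuous choices of argument along an interval. -/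
theorem exists_int_of_isArg {S : Set ℝ} (hS : IsPreconnected S) {f : ℝ → ℂ} {A B : ℝ → ℝ}
    (hA : ContinuousOn A S) (hB : ContinuousOn B S) (hf : ∀ t ∈ S, f t ≠ 0)
    (hfA : ∀ t ∈ S, IsArg (f t) (A t)) (hfB : ∀ t ∈ S, IsArg (f t) (B t)) :
    ∃ n : ℤ, ∀ t ∈ S, A t = B t + 2 * Real.pi * n := by
  obtain ⟨n, hn⟩ := exists_int_of_exp_eq_one (A := fun t ↦ A t - B t) hS (hA.sub hB)
    fun t ht ↦ IsArg.exp_sub (hf t ht) (hfA t ht) (hfB t ht)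
  exact ⟨n, fun t ht ↦ by linarith [hn t ht]⟩

/-- Two orthogonal characteristics cannot bound a bigon. The arguments of the chords of either
side, and those of the chords from one side to the other, are tied together along the edges of a
rectangle; the two right-angled corners force incompatible parities. -/
theorem not_bigon (hθ : Continuous θ) {ς : ℝ} (hς : ς = Real.pi / 2 ∨ ς = -(Real.pi / 2))
    (hz : ∀ t, HasDerivAt z (Complex.exp (θ (z t) * Complex.I)) t)
    (hw : ∀ t, HasDerivAt w (Complex.exp ((θ (w t) + ς : ℝ) * Complex.I)) t)
    {a b c d : ℝ} (hab : a < b) (hcd : c < d) (hac : w c = z a) (hbd : w d = z b)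
    (hne : ∀ s ∈ Icc a b, ∀ t ∈ Icc c d, w t = z s → (s = a ∧ t = c) ∨ (s = b ∧ t = d)) :
    False := by
  have hzc : Continuous z := continuous_iff_continuousAt.2 fun t ↦ (hz t).continuousAt
  have hwc : Continuous w := continuous_iff_continuousAt.2 fun t ↦ (hw t).continuousAt
  have hzi := injective_of_hasDerivAt hθ hz
  have hwi := injective_of_hasDerivAt (θ := fun p ↦ θ p + ς) (by fun_prop) hw
  set β : ℝ → ℝ := fun t ↦ θ (z t) with hβdef
  set β' : ℝ → ℝ := fun t ↦ θ (w t) + ς with hβ'def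
  have hβ : Continuous β := hθ.comp hzc
  have hβ' : Continuous β' := (hθ.comp hwc).add continuous_const
  obtain ⟨A, hA, hAf, hAd⟩ := exists_secant_arg_of_injective hβ hz hzi
  obtain ⟨A', hA', hAf', hAd'⟩ := exists_secant_arg_of_injective hβ' hw hwi
  let R : Set (ℝ × ℝ) := {x : ℝ × ℝ | (x.1 ∈ Icc a b ∧ x.2 ∈ Icc c d) ∧
    0 < (x.1 - a) + (x.2 - c) ∧ 0 < (b - x.1) + (d - x.2)}
  have hR0 : ∀ x ∈ R, w x.2 - z x.1 ≠ 0 := by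
    rintro ⟨s, t⟩ ⟨⟨hs, ht⟩, h1, h2⟩ h
    simp only at hs ht h1 h2 h
    rcases hne s hs t ht (sub_eq_zero.1 h) with ⟨rfl, rfl⟩ | ⟨rfl, rfl⟩
    · simp at h1
    · simp at h2
  obtain ⟨B, hB, hBf⟩ := exists_continuousOn_arg (convex_rectangle_diff_corners a b c d)
    (f := fun x : ℝ × ℝ ↦ w x.2 - z x.1) (by fun_prop) hR0
  change ContinuousOn B R at hB
  change ∀ x ∈ R, IsArg (w x.2 - z x.1) (B x) at hBf
  have r1 : ∀ t ∈ Ioc c d, (a, t) ∈ R := fun t ht ↦ ⟨⟨⟨le_rfl, hab.le⟩, ht.1.le, ht.2⟩,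
    by simp only; linarith [ht.1], by simp only; linarith [ht.2]⟩
  have r2 : ∀ s ∈ Ioc a b, (s, c) ∈ R := fun t ht ↦ ⟨⟨⟨ht.1.le, ht.2⟩, le_rfl, hcd.le⟩,
    by simp only; linarith [ht.1], by simp only; linarith [ht.2]⟩
  have r3 : ∀ t ∈ Ico c d, (b, t) ∈ R := fun t ht ↦ ⟨⟨⟨hab.le, le_rfl⟩, ht.1, ht.2.le⟩,
    by simp only; linarith [ht.1], by simp only; linarith [ht.2]⟩
  have r4 : ∀ s ∈ Ico a b, (s, d) ∈ R := fun t ht ↦ ⟨⟨⟨ht.1, ht.2.le⟩, hcd.le, le_rfl⟩,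
    by simp only; linarith [ht.1], by simp only; linarith [ht.2]⟩
  obtain ⟨i₁, h₁⟩ := exists_int_of_isArg (S := Ioc c d) isPreconnected_Ioc
    (f := fun t ↦ w t - z a) (A := fun t ↦ B (a, t)) (B := fun t ↦ A' (c, t))
    (ContinuousOn.comp hB (by fun_prop) r1) (ContinuousOn.comp hA' (by fun_prop) fun t ht ↦ ht.1.le)
    (fun t ht ↦ hR0 _ (r1 t ht)) (fun t ht ↦ hBf _ (r1 t ht))
    (fun t ht ↦ by rw [← hac]; exact hAf' c t ht.1.le)
  obtain ⟨i₂, h₂⟩ := exists_int_of_isArg (S := Ioc a b) isPreconnected_Ioc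
    (f := fun s ↦ w c - z s) (A := fun s ↦ B (s, c)) (B := fun s ↦ A (a, s) + Real.pi)
    (ContinuousOn.comp hB (by fun_prop) r2)
    ((ContinuousOn.comp (f := fun s : ℝ ↦ (a, s)) hA (by fun_prop) fun t ht ↦ ht.1.le).add
      continuousOn_const)
    (fun t ht ↦ hR0 _ (r2 t ht)) (fun t ht ↦ hBf _ (r2 t ht))
    (fun t ht ↦ by rw [hac, ← neg_sub]; exact (hAf a t ht.1.le).neg)
  obtain ⟨i₃, h₃⟩ := exists_int_of_isArg (S := Ico c d) isPreconnected_Ico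
    (f := fun t ↦ w t - z b) (A := fun t ↦ B (b, t)) (B := fun t ↦ A' (t, d) + Real.pi)
    (ContinuousOn.comp hB (by fun_prop) r3)
    ((ContinuousOn.comp (f := fun s : ℝ ↦ (s, d)) hA' (by fun_prop) fun t ht ↦ ht.2.le).add
      continuousOn_const)
    (fun t ht ↦ hR0 _ (r3 t ht)) (fun t ht ↦ hBf _ (r3 t ht))
    (fun t ht ↦ by rw [← hbd, ← neg_sub]; exact (hAf' t d ht.2.le).neg)
  obtain ⟨i₄, h₄⟩ := exists_int_of_isArg (S := Ico a b) isPreconnected_Ico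
    (f := fun s ↦ w d - z s) (A := fun s ↦ B (s, d)) (B := fun s ↦ A (s, b))
    (ContinuousOn.comp hB (by fun_prop) r4) (ContinuousOn.comp hA (by fun_prop) fun t ht ↦ ht.2.le)
    (fun t ht ↦ hR0 _ (r4 t ht)) (fun t ht ↦ hBf _ (r4 t ht))
    (fun t ht ↦ by rw [hbd]; exact hAf t b ht.2.le)
  -- The edges of the rectangle meet in the corners `(b, c)` and `(a, d)`.
  have e1 := h₂ b ⟨hab, le_rfl⟩
  rw [h₃ c ⟨le_rfl, hcd⟩] at e1
  have e2 := h₄ a ⟨le_rfl, hab⟩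
  rw [h₁ d ⟨hcd, le_rfl⟩] at e2
  have hi : i₃ + i₄ = i₁ + i₂ := by
    have : (2 * Real.pi) * ((i₃ + i₄ : ℤ) : ℝ) = (2 * Real.pi) * ((i₁ + i₂ : ℤ) : ℝ) := by
      push_cast; linarith
    exact_mod_cast mul_left_cancel₀ Real.two_pi_pos.ne' this
  have hu : (Complex.exp (ς * Complex.I)).re = 0 := by
    rw [Complex.exp_ofReal_mul_I_re]
    rcases hς with rfl | rfl <;> simp
  -- Near either of the two removed corners the chords stay in a half-plane.
  have corner : ∀ p q, w q = z p → ∀ᶠ ε in 𝓝[>] (0 : ℝ),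
      ∀ s₁ s₂ t₁ t₂, |s₁ - p| ≤ ε → |s₂ - p| ≤ ε → |t₁ - q| ≤ ε → |t₂ - q| ≤ ε →
      1 / 2 < (chord β' (t₁, t₂) * star (Complex.exp (β p * Complex.I) *
        (Complex.exp (ς * Complex.I) - 1))).re ∧
      (chord β (s₁, s₂) * star (Complex.exp (β p * Complex.I) *
        (Complex.exp (ς * Complex.I) - 1))).re < -(1 / 2) := by
    intro p q hpq
    set v := Complex.exp (β p * Complex.I) * (Complex.exp (ς * Complex.I) - 1) with hv
    have hee : Complex.exp (β p * Complex.I) * star (Complex.exp (β p * Complex.I)) = 1 := by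
      rw [Complex.star_def, ← Complex.exp_conj, ← Complex.exp_add]; simp
    have huu : Complex.exp (ς * Complex.I) * star (Complex.exp (ς * Complex.I)) = 1 := by
      rw [Complex.star_def, ← Complex.exp_conj, ← Complex.exp_add]; simp
    have hre : (star (Complex.exp (ς * Complex.I))).re = 0 := by
      rw [Complex.star_def, Complex.conj_re, hu]
    have hβq : β' q = β p + ς := by simp only [hβ'def, hβdef, hpq]
    have k1 : ∀ᶠ x in 𝓝 (q, q), 1 / 2 < (chord β' x * star v).re := by
      have hc : Continuous fun x ↦ (chord β' x * star v).re := by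
        have := continuous_chord hβ'; fun_prop
      refine hc.continuousAt.eventually_const_lt ?_
      have : chord β' (q, q) * star v = 1 - Complex.exp (ς * Complex.I) := by
        rw [chord_self, hβq, hv, star_mul', star_sub, star_one, Complex.ofReal_add, add_mul,
          Complex.exp_add]
        linear_combination (Complex.exp (ς * Complex.I) *
          (star (Complex.exp (ς * Complex.I)) - 1)) * hee + huu
      beta_reduce
      rw [this, Complex.sub_re, hu, Complex.one_re]; norm_num
    have k2 : ∀ᶠ x in 𝓝 (p, p), (chord β x * star v).re < -(1 / 2) := by
      have hc : Continuous fun x ↦ (chord β x * star v).re := by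
        have := continuous_chord hβ; fun_prop
      refine hc.continuousAt.eventually_lt_const ?_
      have : chord β (p, p) * star v = star (Complex.exp (ς * Complex.I)) - 1 := by
        rw [chord_self, hv, star_mul', star_sub, star_one]
        linear_combination (star (Complex.exp (ς * Complex.I)) - 1) * hee
      beta_reduce
      rw [this, Complex.sub_re, hre, Complex.one_re]; norm_num
    obtain ⟨δ, hδ, d1⟩ := Metric.eventually_nhds_iff.1 k1
    obtain ⟨δ', hδ', d2⟩ := Metric.eventually_nhds_iff.1 k2
    filter_upwards [Ioo_mem_nhdsGT hδ, Ioo_mem_nhdsGT hδ'] with ε hε hε' s₁ s₂ t₁ t₂ hs₁ hs₂ ht₁ ht₂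
    constructor
    · refine d1 (lt_of_le_of_lt ?_ hε.2)
      rw [Prod.dist_eq, Real.dist_eq, Real.dist_eq]; exact max_le ht₁ ht₂
    · refine d2 (lt_of_le_of_lt ?_ hε'.2)
      rw [Prod.dist_eq, Real.dist_eq, Real.dist_eq]; exact max_le hs₁ hs₂
  have hchz := sub_eq_mul_chord hβ hz
  have hchw := sub_eq_mul_chord hβ' hw
  have hsm : ∀ᶠ ε in 𝓝[>] (0 : ℝ), 0 < ε ∧ ε < b - a ∧ ε < d - c := by
    filter_upwards [Ioo_mem_nhdsGT (show (0 : ℝ) < b - a by linarith),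
      Ioo_mem_nhdsGT (show (0 : ℝ) < d - c by linarith)] with ε h1 h2
    exact ⟨h1.1, h1.2, h2.2⟩
  have near : ∀ {g : ℝ → ℝ × ℝ}, Continuous g → (∀ ε, 0 < ε → (g ε).1 ≤ (g ε).2) →
      ∀ {t : ℝ}, g 0 = (t, t) → ∀ᶠ ε in 𝓝[>] (0 : ℝ),
        |A (g ε) - β t| < 1 / 2 ∧ |A' (g ε) - β' t| < 1 / 2 := by
    intro g hg hle t h0
    have hle' : ∀ᶠ ε in 𝓝[>] (0 : ℝ), g ε ∈ {x : ℝ × ℝ | x.1 ≤ x.2} := by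
      filter_upwards [self_mem_nhdsWithin] with ε hε using hle ε hε
    exact (eventually_abs_sub_lt_half hA (le_refl t) (hAd t) hg h0 hle').and
      (eventually_abs_sub_lt_half hA' (le_refl t) (hAd' t) hg h0 hle')
  have first : |ς - Real.pi + 2 * Real.pi * (i₁ - i₂)| < Real.pi + 1 := by
    obtain ⟨ε, ⟨hε0, hε1, hε2⟩, hc, ⟨n1, -⟩, -, n2⟩ := (hsm.and ((corner a c hac).and
      ((near (g := fun ε ↦ (a, a + ε)) (by fun_prop) (by intro ε hε; simp only; linarith)
        (t := a) (by simp)).and (near (g := fun ε ↦ (c, c + ε)) (by fun_prop)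
        (by intro ε hε; simp only; linarith) (t := c) (by simp))))).exists
    have hS : IsPreconnected (R ∩ (Icc a (a + ε) ×ˢ Icc c (c + ε))) :=
      ((convex_rectangle_diff_corners a b c d).inter
        ((convex_Icc _ _).prod (convex_Icc _ _))).isPreconnected
    have hosc := abs_sub_lt_pi_of_halfPlane (x := (a, c + ε)) (y := (a + ε, c)) hS
      (hB.mono inter_subset_left) (fun x hx ↦ hBf x hx.1)
      (v := Complex.exp (β a * Complex.I) * (Complex.exp (ς * Complex.I) - 1)) (by
        rintro ⟨s, t⟩ ⟨⟨-, h1, -⟩, ⟨h3, h4⟩, h5, h6⟩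
        simp only at h1 h3 h4 h5 h6 ⊢
        obtain ⟨k1, k2⟩ := hc a s c t (by simp [hε0.le]) (by rw [abs_le]; constructor <;> linarith)
          (by simp [hε0.le]) (by rw [abs_le]; constructor <;> linarith)
        set V := star (Complex.exp (β a * Complex.I) * (Complex.exp (ς * Complex.I) - 1))
        have e3 : (w t - z s) * V = (t - c : ℝ) * (chord β' (c, t) * V)
            - (s - a : ℝ) * (chord β (a, s) * V) := by
          linear_combination V * hchw c t - V * hchz a s + V * hac
        rw [e3, Complex.sub_re, Complex.re_ofReal_mul, Complex.re_ofReal_mul]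
        nlinarith)
      ⟨r1 _ ⟨by linarith, by linarith⟩, ⟨le_rfl, by simp [hε0.le]⟩, by simp [hε0.le], le_rfl⟩
      ⟨r2 _ ⟨by linarith, by linarith⟩, ⟨by simp [hε0.le], le_rfl⟩, le_rfl, by simp [hε0.le]⟩
    have m1 := h₁ (c + ε) ⟨by linarith, by linarith⟩
    have m2 := h₂ (a + ε) ⟨by linarith, by linarith⟩
    have hβc : β' c = β a + ς := by simp only [hβ'def, hβdef, hac]
    rw [hβc] at n2
    rw [m1, m2] at hosc
    rw [abs_lt] at hosc n1 n2 ⊢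
    constructor <;> linarith
  have second : |ς + Real.pi + 2 * Real.pi * (i₃ - i₄)| < Real.pi + 1 := by
    obtain ⟨ε, ⟨hε0, hε1, hε2⟩, hc, ⟨n1, -⟩, -, n2⟩ := (hsm.and ((corner b d hbd).and
      ((near (g := fun ε ↦ (b - ε, b)) (by fun_prop) (by intro ε hε; simp only; linarith)
        (t := b) (by simp)).and (near (g := fun ε ↦ (d - ε, d)) (by fun_prop)
        (by intro ε hε; simp only; linarith) (t := d) (by simp))))).exists
    have hS : IsPreconnected (R ∩ (Icc (b - ε) b ×ˢ Icc (d - ε) d)) :=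
      ((convex_rectangle_diff_corners a b c d).inter
        ((convex_Icc _ _).prod (convex_Icc _ _))).isPreconnected
    have hosc := abs_sub_lt_pi_of_halfPlane (x := (b, d - ε)) (y := (b - ε, d)) hS
      (hB.mono inter_subset_left) (fun x hx ↦ hBf x hx.1)
      (v := -(Complex.exp (β b * Complex.I) * (Complex.exp (ς * Complex.I) - 1))) (by
        rintro ⟨s, t⟩ ⟨⟨-, -, h1⟩, ⟨h3, h4⟩, h5, h6⟩
        simp only at h1 h3 h4 h5 h6 ⊢
        obtain ⟨k1, k2⟩ := hc s b t d (by rw [abs_le]; constructor <;> linarith) (by simp [hε0.le])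
          (by rw [abs_le]; constructor <;> linarith) (by simp [hε0.le])
        rw [star_neg]
        set V := star (Complex.exp (β b * Complex.I) * (Complex.exp (ς * Complex.I) - 1))
        have e3 : (w t - z s) * -V = (d - t : ℝ) * (chord β' (t, d) * V)
            - (b - s : ℝ) * (chord β (s, b) * V) := by
          linear_combination V * hchw t d - V * hchz s b - V * hbd
        rw [e3, Complex.sub_re, Complex.re_ofReal_mul, Complex.re_ofReal_mul]
        nlinarith)
      ⟨r3 _ ⟨by linarith, by linarith⟩, ⟨by simp [hε0.le], le_rfl⟩, le_rfl, by simp [hε0.le]⟩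
      ⟨r4 _ ⟨by linarith, by linarith⟩, ⟨le_rfl, by simp [hε0.le]⟩, by simp [hε0.le], le_rfl⟩
    have m1 := h₃ (d - ε) ⟨by linarith, by linarith⟩
    have m2 := h₄ (b - ε) ⟨by linarith, by linarith⟩
    have hβc : β' d = β b + ς := by simp only [hβ'def, hβdef, hbd]
    rw [hβc] at n2
    rw [m1, m2] at hosc
    rw [abs_lt] at hosc n1 n2 ⊢
    constructor <;> linarith
  rw [abs_lt] at first second
  have hpi := Real.pi_gt_three
  have excl : ∀ {y : ℝ} {n k : ℤ}, -(Real.pi + 1) < y * Real.pi + 2 * Real.pi * n →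
      y * Real.pi + 2 * Real.pi * n < Real.pi + 1 → |y + 2 * k| ≤ 1 / 2 → n = k := by
    intro y n k h1 h2 h3
    rw [abs_le] at h3
    by_contra hnk
    rcases lt_or_gt_of_ne hnk with h | h
    · have : (n : ℝ) ≤ k - 1 := by exact_mod_cast (show n ≤ k - 1 by omega)
      nlinarith
    · have : (k : ℝ) + 1 ≤ n := by exact_mod_cast (show k + 1 ≤ n by omega)
      nlinarith
  rcases hς with rfl | rfl
  · have f1 : i₁ - i₂ = 0 := excl (y := -(1 / 2)) (by push_cast; linarith) (by push_cast; linarith)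
      (by norm_num)
    have f2 : i₃ - i₄ = -1 := excl (y := 3 / 2) (by push_cast; linarith) (by push_cast; linarith)
      (by norm_num)
    omega
  · have f1 : i₁ - i₂ = 1 := excl (y := -(3 / 2)) (by push_cast; linarith) (by push_cast; linarith)
      (by norm_num)
    have f2 : i₃ - i₄ = 0 := excl (y := 1 / 2) (by push_cast; linarith) (by push_cast; linarith)
      (by norm_num)
    omega

end Topological

section Net

variable {θ : ℂ → ℝ} {z w : ℝ → ℂ} {κ : ℂ}

theorem norm_of_eq_I_or {κ : ℂ} (hκ : κ = Complex.I ∨ κ = -Complex.I) : ‖κ‖ = 1 := by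
  rcases hκ with rfl | rfl <;> simp

/-- In the real basis `1, κ` of the plane, both coordinates are bounded by the modulus. -/
theorem abs_le_norm_sub_mul (hκ : κ = Complex.I ∨ κ = -Complex.I) (a b : ℝ) :
    |a| ≤ ‖(a : ℂ) - b * κ‖ ∧ |b| ≤ ‖(a : ℂ) - b * κ‖ := by
  have h1 := Complex.abs_re_le_norm ((a : ℂ) - b * κ)
  have h2 := Complex.abs_im_le_norm ((a : ℂ) - b * κ)
  rcases hκ with rfl | rfl <;> simpa using And.intro h1 h2

theorem continuous_dirField (hθ : Continuous θ) : Continuous (dirField κ θ) := by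
  unfold dirField; fun_prop

/-- A characteristic of one family leaves a compact arc of the other one right after crossing it. -/
theorem exists_forall_notMem_image (hθ : Continuous θ) (hκ : κ = Complex.I ∨ κ = -Complex.I)
    (hz : ∀ t, HasDerivAt z (dirField 1 θ (z t)) t) (hw : ∀ t, HasDerivAt w (dirField κ θ (w t)) t)
    (hzi : Function.Injective z) {t₁ s₁ : ℝ} (h₁ : w t₁ = z s₁) {J : Set ℝ} (hJ : IsCompact J) :
    ∃ δ > 0, ∀ t ∈ Ioo t₁ (t₁ + δ), w t ∉ z '' J := by
  have hzc : Continuous z := continuous_iff_continuousAt.2 fun t ↦ (hz t).continuousAt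
  have hwc : Continuous w := continuous_iff_continuousAt.2 fun t ↦ (hw t).continuousAt
  set e := Complex.exp (θ (z s₁) * Complex.I) with he
  have hen : ‖e‖ = 1 := Complex.norm_exp_ofReal_mul_I _
  have cz : ∀ᶠ s in 𝓝 s₁, ‖dirField 1 θ (z s) - e‖ < 1 / 4 := by
    have : Continuous fun s ↦ ‖dirField 1 θ (z s) - e‖ :=
      (((continuous_dirField hθ).comp hzc).sub continuous_const).norm
    refine this.continuousAt.eventually_lt_const ?_
    simp [dirField, he]
  have cw : ∀ᶠ t in 𝓝 t₁, ‖dirField κ θ (w t) - κ * e‖ < 1 / 4 := by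
    have : Continuous fun s ↦ ‖dirField κ θ (w s) - κ * e‖ :=
      (((continuous_dirField hθ).comp hwc).sub continuous_const).norm
    refine this.continuousAt.eventually_lt_const ?_
    simp [dirField, he, h₁]
  obtain ⟨ρ, hρ, cz⟩ := Metric.eventually_nhds_iff.1 cz
  obtain ⟨ρ', hρ', cw⟩ := Metric.eventually_nhds_iff.1 cw
  have hfar : ∀ᶠ t in 𝓝 t₁, w t ∉ z '' (J \ Metric.ball s₁ ρ) := by
    have hcl : IsClosed (z '' (J \ Metric.ball s₁ ρ)) :=
      ((hJ.diff Metric.isOpen_ball).image hzc).isClosed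
    refine hwc.continuousAt.eventually_mem (hcl.isOpen_compl.mem_nhds ?_)
    rintro ⟨s, ⟨-, hs⟩, hs'⟩
    rw [h₁] at hs'
    rw [hzi hs'] at hs
    exact hs (Metric.mem_ball_self hρ)
  obtain ⟨ρ₂, hρ₂, hfar⟩ := Metric.eventually_nhds_iff.1 hfar
  refine ⟨min ρ' ρ₂, lt_min hρ' hρ₂, fun t ht ↦ ?_⟩
  rintro ⟨s, hs, hst⟩
  have htd : dist t t₁ < min ρ' ρ₂ := by
    rw [Real.dist_eq, abs_of_pos (by linarith [ht.1])]; linarith [ht.2]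
  rw [lt_min_iff] at htd
  by_cases hsb : s ∈ Metric.ball s₁ ρ
  swap
  · exact hfar htd.2 ⟨s, ⟨hs, hsb⟩, hst⟩
  have e1 := norm_sub_sub_le hw (x := t₁) (y := t) (e := κ * e) (η := 1 / 4) (by
    intro u hu
    refine (cw ?_).le
    rw [Real.dist_eq] at htd ⊢
    exact (abs_sub_left_of_mem_uIcc hu).trans_lt htd.1)
  have e2 := norm_sub_sub_le hz (x := s₁) (y := s) (e := e) (η := 1 / 4) (by
    intro u hu
    refine (cz ?_).le
    rw [Real.dist_eq]
    rw [Metric.mem_ball, Real.dist_eq] at hsb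
    exact (abs_sub_left_of_mem_uIcc hu).trans_lt hsb)
  have e3 : ‖((s - s₁ : ℝ) : ℂ) - (t - t₁ : ℝ) * κ‖ ≤ 1 / 4 * |t - t₁| + 1 / 4 * |s - s₁| := by
    have : (((s - s₁ : ℝ) : ℂ) - (t - t₁ : ℝ) * κ) * e
        = (w t - w t₁ - (t - t₁ : ℝ) * (κ * e)) - (z s - z s₁ - (s - s₁ : ℝ) * e) := by
      rw [hst, h₁]; ring
    calc _ = ‖(((s - s₁ : ℝ) : ℂ) - (t - t₁ : ℝ) * κ) * e‖ := by rw [norm_mul, hen, mul_one]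
      _ ≤ _ := by rw [this]; exact (norm_sub_le _ _).trans (add_le_add e1 e2)
  obtain ⟨f1, f2⟩ := abs_le_norm_sub_mul hκ (s - s₁) (t - t₁)
  have : 0 < |t - t₁| := abs_pos.2 (by linarith [ht.1])
  linarith

/-- A characteristic of one family meets a characteristic of the other family at most once. -/
theorem eq_of_meet (hθ : Continuous θ) (hκ : κ = Complex.I ∨ κ = -Complex.I)
    (hz : ∀ t, HasDerivAt z (dirField 1 θ (z t)) t) (hw : ∀ t, HasDerivAt w (dirField κ θ (w t)) t)
    {s₁ s₂ t₁ t₂ : ℝ} (h₁ : w t₁ = z s₁) (h₂ : w t₂ = z s₂) : t₁ = t₂ := by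
  suffices key : ∀ {s₁ s₂ t₁ t₂ : ℝ}, w t₁ = z s₁ → w t₂ = z s₂ → ¬ t₁ < t₂ from
    le_antisymm (not_lt.1 (key h₂ h₁)) (not_lt.1 (key h₁ h₂))
  clear h₁ h₂ s₁ s₂ t₁ t₂
  intro s₁ s₂ t₁ t₂ h₁ h₂ hlt
  have hzc : Continuous z := continuous_iff_continuousAt.2 fun t ↦ (hz t).continuousAt
  have hwc : Continuous w := continuous_iff_continuousAt.2 fun t ↦ (hw t).continuousAt
  have hz' : ∀ t, HasDerivAt z (Complex.exp (θ (z t) * Complex.I)) t := fun t ↦ by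
    simpa [dirField] using hz t
  obtain ⟨ς, hς, hw'⟩ : ∃ ς : ℝ, (ς = Real.pi / 2 ∨ ς = -(Real.pi / 2)) ∧
      ∀ t, HasDerivAt w (Complex.exp ((θ (w t) + ς : ℝ) * Complex.I)) t := by
    have hI : Complex.exp ((Real.pi / 2 : ℝ) * Complex.I) = Complex.I := by
      simp [Complex.exp_mul_I]
    have hI' : Complex.exp ((-(Real.pi / 2) : ℝ) * Complex.I) = -Complex.I := by
      rw [Complex.ofReal_neg, neg_mul, Complex.exp_neg, hI, Complex.inv_I]
    rcases hκ with rfl | rfl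
    · refine ⟨_, Or.inl rfl, fun t ↦ ?_⟩
      rw [Complex.ofReal_add, add_mul, Complex.exp_add, hI, mul_comm]
      exact hw t
    · refine ⟨_, Or.inr rfl, fun t ↦ ?_⟩
      rw [Complex.ofReal_add, add_mul, Complex.exp_add, hI', mul_comm]
      exact hw t
  have hzi := injective_of_hasDerivAt hθ hz'
  have hwi := injective_of_hasDerivAt (θ := fun p ↦ θ p + ς) (by fun_prop) hw'
  -- The first return to the arc between `s₁` and `s₂` closes a bigon.
  obtain ⟨δ, hδ, hiso⟩ := exists_forall_notMem_image hθ hκ hz hw hzi h₁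
    (isCompact_uIcc (a := s₁) (b := s₂))
  have ht₂ : t₁ + δ ≤ t₂ := by
    by_contra! h
    exact hiso t₂ ⟨hlt, h⟩ ⟨s₂, right_mem_uIcc, h₂.symm⟩
  have hT : IsCompact (Icc (t₁ + δ) t₂ ∩ w ⁻¹' (z '' uIcc s₁ s₂)) :=
    isCompact_Icc.inter_right ((isCompact_uIcc.image hzc).isClosed.preimage hwc)
  obtain ⟨t, ⟨htm, s, hs, hst⟩, hleast⟩ :=
    hT.exists_isLeast ⟨t₂, ⟨ht₂, le_rfl⟩, s₂, right_mem_uIcc, h₂.symm⟩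
  have hlt' : t₁ < t := by linarith [htm.1]
  have hno : ∀ u ∈ Icc t₁ t, ∀ r ∈ uIcc s₁ s, w u = z r → (u = t₁ ∧ r = s₁) ∨ (u = t ∧ r = s) := by
    intro u hu r hr hur
    have hrJ : r ∈ uIcc s₁ s₂ := uIcc_subset_uIcc left_mem_uIcc hs hr
    rcases hu.1.eq_or_lt with rfl | h1
    · exact Or.inl ⟨rfl, hzi (hur.symm.trans h₁)⟩
    have h2 : t₁ + δ ≤ u := by
      by_contra! h
      exact hiso u ⟨h1, h⟩ ⟨r, hrJ, hur.symm⟩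
    have h3 : t ≤ u := hleast ⟨⟨h2, hu.2.trans htm.2⟩, r, hrJ, hur.symm⟩
    obtain rfl := le_antisymm hu.2 h3
    exact Or.inr ⟨rfl, hzi (hur.symm.trans hst.symm)⟩
  have hss : s₁ ≠ s := by
    rintro rfl
    exact hlt'.ne (hwi (h₁.trans hst))
  rcases lt_or_gt_of_ne hss with hlt'' | hlt''
  · refine not_bigon hθ hς hz' hw' hlt'' hlt' h₁ hst.symm fun r hr u hu hur ↦ ?_
    rcases hno u hu r (by rwa [uIcc_of_le hlt''.le]) hur with h | h
    · exact Or.inl h.symm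
    · exact Or.inr h.symm
  · -- Reversing `z` turns its angle by `π`, that is, by `2 * ς` up to a full turn.
    refine not_bigon (θ := fun p ↦ θ p + 2 * ς) (ς := -ς) (z := fun s ↦ z (-s)) (w := w)
      (a := -s₁) (b := -s) (c := t₁) (d := t) (by fun_prop) ?_ ?_ ?_
      (by linarith) hlt' (by simpa using h₁) (by simpa using hst.symm) ?_
    · rcases hς with rfl | rfl
      · exact Or.inr rfl
      · exact Or.inl (neg_neg _)
    · intro t
      have h2 : Complex.exp ((2 * ς : ℝ) * Complex.I) = -1 := by
        rcases hς with rfl | rfl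
        · rw [← Complex.exp_pi_mul_I]; push_cast; ring_nf
        · rw [← inv_inj, ← Complex.exp_neg, inv_neg, inv_one, ← Complex.exp_pi_mul_I]
          push_cast; ring_nf
      rw [Complex.ofReal_add, add_mul, Complex.exp_add, h2]
      simpa [Function.comp_def] using (hz' (-t)).scomp t (hasDerivAt_neg t)
    · intro t
      convert! hw' t using 4
      ring
    · intro r hr u hu hur
      rw [mem_Icc] at hr
      rcases hno u hu (-r) (by rw [uIcc_of_ge hlt''.le]; constructor <;> linarith) hur with h | h
      · exact Or.inl ⟨by linarith [h.2], h.1⟩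
      · exact Or.inr ⟨by linarith [h.2], h.1⟩

/-- The characteristics of one family issuing from a characteristic of the other family sweep out
a part of the plane without overlap. -/
theorem net_injective {L : NNReal} (hθ : LipschitzWith L θ) (hκ : κ = Complex.I ∨ κ = -Complex.I)
    {φ : ℂ → ℝ → ℂ} (hφ : IsFlow (dirField κ θ) φ)
    (hz : ∀ t, HasDerivAt z (dirField 1 θ (z t)) t) {s t s' t' : ℝ}
    (h : φ (z s) t = φ (z s') t') : s = s' ∧ t = t' := by
  have hv := lipschitzWith_dirField (norm_of_eq_I_or hκ) hθ
  have h1 : φ (z s) (t - t') = z s' := by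
    rw [sub_eq_add_neg, hφ.add hv, h, hφ.neg_cancel hv]
  have h2 := eq_of_meet hθ.continuous hκ hz (hφ.hasDerivAt (z s)) (hφ.zero (z s)) h1
  refine ⟨?_, by linarith⟩
  rw [← h2, hφ.zero] at h1
  exact injective_of_hasDerivAt hθ.continuous (fun t ↦ by simpa [dirField] using hz t) h1

end Net

/-! ### Global coordinates for a net of small oscillation -/

/-- The two orthogonal families of integral curves of a Lipschitz slope angle `α` on the plane that
deviates from a constant by at most `1 / 8`. The second family runs in the direction of
`κ * exp (α * I)`, where `κ` is `I` or `-I`. -/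
structure IsFlatNet (κ : ℂ) (α : ℂ → ℝ) (L : NNReal) (φ₁ φ₂ : ℂ → ℝ → ℂ) (a₀ : ℝ) : Prop where
  kappa : κ = Complex.I ∨ κ = -Complex.I
  lipschitz : LipschitzWith L α
  flow₁ : IsFlow (dirField 1 α) φ₁
  flow₂ : IsFlow (dirField κ α) φ₂
  flat : ∀ w, |α w - a₀| ≤ 1 / 8

theorem strictMono_of_injective_of_pos {f : ℝ → ℝ} (hf : Continuous f) (hi : Function.Injective f)
    (h0 : f 0 = 0) {x : ℝ} (hx : 0 < x) (hfx : 0 < f x) : StrictMono f := by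
  rcases hf.strictMono_of_inj hi with h | h
  · exact h
  · have := h hx
    linarith

namespace IsFlatNet

variable {κ : ℂ} {α : ℂ → ℝ} {L : NNReal} {φ₁ φ₂ : ℂ → ℝ → ℂ} {a₀ : ℝ}

theorem lip₁ (h : IsFlatNet κ α L φ₁ φ₂ a₀) : LipschitzWith L (dirField 1 α) :=
  lipschitzWith_dirField norm_one h.lipschitz

theorem lip₂ (h : IsFlatNet κ α L φ₁ φ₂ a₀) : LipschitzWith L (dirField κ α) :=
  lipschitzWith_dirField (norm_of_eq_I_or h.kappa) h.lipschitz

theorem norm_flow₁_sub_le (h : IsFlatNet κ α L φ₁ φ₂ a₀) (p : ℂ) (s t : ℝ) :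
    ‖φ₁ p t - φ₁ p s - (t - s : ℝ) * Complex.exp (a₀ * Complex.I)‖ ≤ 1 / 8 * |t - s| := by
  refine norm_sub_sub_le (h.flow₁.hasDerivAt p) fun u _ ↦ ?_
  rw [dirField, one_mul]
  exact (norm_exp_mul_I_sub_le _ _).trans (h.flat _)

theorem norm_flow₂_sub_le (h : IsFlatNet κ α L φ₁ φ₂ a₀) (p : ℂ) (s t : ℝ) :
    ‖φ₂ p t - φ₂ p s - (t - s : ℝ) * (κ * Complex.exp (a₀ * Complex.I))‖ ≤ 1 / 8 * |t - s| := by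
  refine norm_sub_sub_le (h.flow₂.hasDerivAt p) fun u _ ↦ ?_
  rw [dirField, ← mul_sub, norm_mul, norm_of_eq_I_or h.kappa, one_mul]
  exact (norm_exp_mul_I_sub_le _ _).trans (h.flat _)

/-- The displacement between the curves of the two families through `p` and `q` is, up to a
quarter, an isometry of the pair of parameters. -/
theorem norm_sub_displacement_le (h : IsFlatNet κ α L φ₁ φ₂ a₀) (p q : ℂ) (x y : ℝ × ℝ) :
    ‖(φ₁ p x.1 - φ₂ q x.2) - (φ₁ p y.1 - φ₂ q y.2) -
      Complex.exp (a₀ * Complex.I) * ((x.1 - y.1 : ℝ) - (x.2 - y.2 : ℝ) * κ)‖ ≤ 1 / 4 * ‖x - y‖ := by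
  have h1 := h.norm_flow₁_sub_le p y.1 x.1
  have h2 := h.norm_flow₂_sub_le q y.2 x.2
  have n1 : |x.1 - y.1| ≤ ‖x - y‖ := norm_fst_le (x - y)
  have n2 : |x.2 - y.2| ≤ ‖x - y‖ := norm_snd_le (x - y)
  calc _ = ‖(φ₁ p x.1 - φ₁ p y.1 - (x.1 - y.1 : ℝ) * Complex.exp (a₀ * Complex.I)) -
        (φ₂ q x.2 - φ₂ q y.2 - (x.2 - y.2 : ℝ) * (κ * Complex.exp (a₀ * Complex.I)))‖ := by
        congr 1; ring
    _ ≤ _ := (norm_sub_le _ _).trans (by linarith)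

theorem norm_le_linear {κ : ℂ} (hκ : κ = Complex.I ∨ κ = -Complex.I) (a₀ : ℝ) (x : ℝ × ℝ) :
    ‖x‖ ≤ ‖Complex.exp (a₀ * Complex.I) * ((x.1 : ℂ) - x.2 * κ)‖ := by
  rw [norm_mul, Complex.norm_exp_ofReal_mul_I, one_mul]
  exact max_le (abs_le_norm_sub_mul hκ _ _).1 (abs_le_norm_sub_mul hκ _ _).2

theorem norm_sub_le_displacement (h : IsFlatNet κ α L φ₁ φ₂ a₀) (p q : ℂ) (x y : ℝ × ℝ) :
    ‖x - y‖ ≤ 4 / 3 * ‖(φ₁ p x.1 - φ₂ q x.2) - (φ₁ p y.1 - φ₂ q y.2)‖ := by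
  have h1 := h.norm_sub_displacement_le p q x y
  have h2 := norm_le_linear h.kappa a₀ (x - y)
  simp only [Prod.fst_sub, Prod.snd_sub] at h2
  have h3 := norm_sub_norm_le (Complex.exp (a₀ * Complex.I) *
    (((x.1 - y.1 : ℝ) : ℂ) - (x.2 - y.2 : ℝ) * κ)) ((φ₁ p x.1 - φ₂ q x.2) - (φ₁ p y.1 - φ₂ q y.2))
  rw [norm_sub_rev] at h1
  linarith

/-- Every curve of the first family meets every curve of the second one. -/
theorem exists_meet (h : IsFlatNet κ α L φ₁ φ₂ a₀) (p q : ℂ) :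
    ∃ x : ℝ × ℝ, φ₁ p x.1 = φ₂ q x.2 := by
  let f : ℝ × ℝ →ₗ[ℝ] ℂ :=
    { toFun := fun x ↦ Complex.exp (a₀ * Complex.I) * ((x.1 : ℂ) - x.2 * κ)
      map_add' := fun x y ↦ by
        simp only [Prod.fst_add, Prod.snd_add, Complex.ofReal_add]; ring
      map_smul' := fun c x ↦ by
        simp only [Prod.smul_fst, Prod.smul_snd, smul_eq_mul, Complex.ofReal_mul, RingHom.id_apply,
          Complex.real_smul]
        ring }
  have hf : Function.Injective f := by
    rw [injective_iff_map_eq_zero]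
    intro x hx
    have := norm_le_linear h.kappa a₀ x
    change f x = 0 at hx
    rw [show Complex.exp (a₀ * Complex.I) * ((x.1 : ℂ) - x.2 * κ) = f x from rfl, hx, norm_zero]
      at this
    exact norm_le_zero_iff.1 this
  let F : (ℝ × ℝ) ≃L[ℝ] ℂ := (LinearEquiv.ofInjectiveOfFinrankEq f hf (by simp)).toContinuousLinearEquiv
  have hF : ∀ x, F x = Complex.exp (a₀ * Complex.I) * ((x.1 : ℂ) - x.2 * κ) := fun x ↦ rfl
  have hA : ApproximatesLinearOn (fun x : ℝ × ℝ ↦ φ₁ p x.1 - φ₂ q x.2) (F : ℝ × ℝ →L[ℝ] ℂ) univ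
      (1 / 4) := by
    intro x _ y _
    have := h.norm_sub_displacement_le p q x y
    simpa [hF] using this
  have hN : ‖(F.symm : ℂ →L[ℝ] ℝ × ℝ)‖₊ ≤ 1 := by
    refine ContinuousLinearMap.opNorm_le_bound _ zero_le_one fun y ↦ ?_
    have := norm_le_linear h.kappa a₀ (F.symm y)
    rw [← hF] at this
    simpa using this
  obtain ⟨x, hx⟩ := hA.surjective (F.subsingleton_or_nnnorm_symm_pos.imp_right fun h0 ↦ by
    refine lt_of_lt_of_le ?_ ((one_le_inv₀ h0).2 hN)
    rw [← NNReal.coe_lt_coe]; norm_num) 0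
  exact ⟨x, sub_eq_zero.1 hx⟩

/-- The pair of parameters at which the curve of the first family through `p` meets the curve of
the second family through `q`. -/
def meet (h : IsFlatNet κ α L φ₁ φ₂ a₀) (p q : ℂ) : ℝ × ℝ := (h.exists_meet p q).choose

theorem meet_spec (h : IsFlatNet κ α L φ₁ φ₂ a₀) (p q : ℂ) :
    φ₁ p (h.meet p q).1 = φ₂ q (h.meet p q).2 := (h.exists_meet p q).choose_spec

theorem norm_meet_sub_le (h : IsFlatNet κ α L φ₁ φ₂ a₀) (p q : ℂ) (x : ℝ × ℝ) :
    ‖h.meet p q - x‖ ≤ 4 / 3 * ‖φ₁ p x.1 - φ₂ q x.2‖ := by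
  have := h.norm_sub_le_displacement p q (h.meet p q) x
  rwa [h.meet_spec, sub_self, zero_sub, norm_neg] at this

theorem meet_eq (h : IsFlatNet κ α L φ₁ φ₂ a₀) {p q : ℂ} {s t : ℝ} (hst : φ₁ p s = φ₂ q t) :
    h.meet p q = (s, t) := by
  have := h.norm_meet_sub_le p q (s, t)
  rw [hst, sub_self, norm_zero, mul_zero] at this
  exact sub_eq_zero.1 (norm_le_zero_iff.1 this)

theorem continuous_meet (h : IsFlatNet κ α L φ₁ φ₂ a₀) :
    Continuous fun x : ℂ × ℂ ↦ h.meet x.1 x.2 := by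
  rw [continuous_iff_continuousAt]
  rintro ⟨p, q⟩
  rw [ContinuousAt, tendsto_iff_norm_sub_tendsto_zero]
  have hc : Continuous fun x : ℂ × ℂ ↦
      4 / 3 * ‖φ₁ x.1 (h.meet p q).1 - φ₂ x.2 (h.meet p q).2‖ := by
    have c1 := h.flow₁.continuous_uncurry h.lip₁
    have c2 := h.flow₂.continuous_uncurry h.lip₂
    have d1 : Continuous fun x : ℂ × ℂ ↦ φ₁ x.1 (h.meet p q).1 :=
      c1.comp (continuous_fst.prodMk continuous_const)
    have d2 : Continuous fun x : ℂ × ℂ ↦ φ₂ x.2 (h.meet p q).2 :=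
      c2.comp (continuous_snd.prodMk continuous_const)
    fun_prop
  refine squeeze_zero (fun _ ↦ norm_nonneg _) (fun x ↦ h.norm_meet_sub_le x.1 x.2 _)
    (hc.tendsto' _ _ ?_)
  simp [h.meet_spec]

/-- The net coordinates centred at `o`: the homeomorphism of the plane that takes a point to the
parameters of its projections, along the net, to the two curves of the net through `o`. -/
def coord (h : IsFlatNet κ α L φ₁ φ₂ a₀) (o : ℂ) : ℂ ≃ₜ ℝ × ℝ where
  toFun w := ((h.meet o w).1, (h.meet w o).2)
  invFun x := φ₁ (φ₂ o x.2) (h.meet (φ₂ o x.2) (φ₁ o x.1)).1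
  left_inv w := by
    have h1 := h.meet_spec o w
    have h2 := h.meet_spec w o
    have e1 : φ₁ (φ₂ o (h.meet w o).2) (-(h.meet w o).1) = w := by
      rw [← h2, h.flow₁.neg_cancel h.lip₁]
    have e2 : φ₂ (φ₁ o (h.meet o w).1) (-(h.meet o w).2) = w := by
      rw [h1, h.flow₂.neg_cancel h.lip₂]
    have e3 := h.meet_eq (e1.trans e2.symm)
    simp only
    rw [e3, e1]
  right_inv x := by
    have h1 := h.meet_spec (φ₂ o x.2) (φ₁ o x.1)
    set w := φ₁ (φ₂ o x.2) (h.meet (φ₂ o x.2) (φ₁ o x.1)).1 with hw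
    have e1 : h.meet o w = (x.1, -(h.meet (φ₂ o x.2) (φ₁ o x.1)).2) :=
      h.meet_eq (by rw [h1, h.flow₂.neg_cancel h.lip₂])
    have e2 : h.meet w o = (-(h.meet (φ₂ o x.2) (φ₁ o x.1)).1, x.2) :=
      h.meet_eq (by rw [hw, h.flow₁.neg_cancel h.lip₁])
    change ((h.meet o w).1, (h.meet w o).2) = x
    rw [e1, e2]
  continuous_toFun :=
    (continuous_fst.comp (h.continuous_meet.comp (continuous_const.prodMk continuous_id))).prodMk
      (continuous_snd.comp (h.continuous_meet.comp (continuous_id.prodMk continuous_const)))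
  continuous_invFun := by
    have c2 : Continuous fun x : ℝ × ℝ ↦ φ₂ o x.2 := (h.flow₂.continuous o).comp continuous_snd
    have c1 : Continuous fun x : ℝ × ℝ ↦ φ₁ o x.1 := (h.flow₁.continuous o).comp continuous_fst
    exact (h.flow₁.continuous_uncurry h.lip₁).comp
      (c2.prodMk (continuous_fst.comp (h.continuous_meet.comp (c2.prodMk c1))))

theorem coord_symm_fst (h : IsFlatNet κ α L φ₁ φ₂ a₀) (o : ℂ) (s t : ℝ) :
    (h.coord o).symm (s, t) = φ₁ (φ₂ o t) (h.meet (φ₂ o t) (φ₁ o s)).1 := rfl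

theorem coord_symm_snd (h : IsFlatNet κ α L φ₁ φ₂ a₀) (o : ℂ) (s t : ℝ) :
    (h.coord o).symm (s, t) = φ₂ (φ₁ o s) (h.meet (φ₂ o t) (φ₁ o s)).2 := h.meet_spec _ _

theorem meet_flow_zero (h : IsFlatNet κ α L φ₁ φ₂ a₀) (o : ℂ) (s : ℝ) :
    h.meet o (φ₁ o s) = (s, 0) := h.meet_eq (by rw [h.flow₂.zero])

theorem meet_zero_flow (h : IsFlatNet κ α L φ₁ φ₂ a₀) (o : ℂ) (t : ℝ) :
    h.meet (φ₂ o t) o = (0, t) := h.meet_eq (by rw [h.flow₁.zero])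

/-- Opposite sides of a cell of the net have comparable lengths. -/
theorem abs_meet_sub_le (h : IsFlatNet κ α L φ₁ φ₂ a₀) (o : ℂ) (s t : ℝ) :
    |(h.meet (φ₂ o t) (φ₁ o s)).2 - t| ≤ 4 / 3 * |s| + 1 / 3 * |t| ∧
    |(h.meet (φ₂ o t) (φ₁ o s)).1 - s| ≤ 4 / 3 * |t| + 1 / 3 * |s| := by
  constructor
  · have h1 := h.norm_meet_sub_le (φ₂ o t) (φ₁ o s) (0, t)
    have h2 := h.norm_flow₂_sub_le o 0 t
    have h3 := h.norm_flow₂_sub_le (φ₁ o s) 0 t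
    have h4 := h.flow₁.dist_time_le (fun w ↦ (norm_dirField norm_one α w).le) o s 0
    rw [h.flow₁.zero, dist_eq_norm, sub_zero] at h4
    simp only [h.flow₁.zero, h.flow₂.zero, sub_zero] at h1 h2 h3
    have h5 : ‖φ₂ o t - φ₂ (φ₁ o s) t‖ ≤ 1 / 8 * |t| + 1 / 8 * |t| + |s| := by
      calc _ = ‖(φ₂ o t - o - (t : ℝ) * (κ * Complex.exp (a₀ * Complex.I))) -
            (φ₂ (φ₁ o s) t - φ₁ o s - (t : ℝ) * (κ * Complex.exp (a₀ * Complex.I))) -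
            (φ₁ o s - o)‖ := by congr 1; ring
        _ ≤ _ := (norm_sub_le _ _).trans (add_le_add ((norm_sub_le _ _).trans
            (add_le_add h2 h3)) h4)
    have h6 := (norm_snd_le (h.meet (φ₂ o t) (φ₁ o s) - (0, t))).trans h1
    rw [Prod.snd_sub, Real.norm_eq_abs] at h6
    linarith
  · have h1 := h.norm_meet_sub_le (φ₂ o t) (φ₁ o s) (s, 0)
    have h2 := h.norm_flow₁_sub_le o 0 s
    have h3 := h.norm_flow₁_sub_le (φ₂ o t) 0 s
    have h4 := h.flow₂.dist_time_le
      (fun w ↦ (norm_dirField (norm_of_eq_I_or h.kappa) α w).le) o t 0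
    rw [h.flow₂.zero, dist_eq_norm, sub_zero] at h4
    simp only [h.flow₁.zero, h.flow₂.zero, sub_zero] at h1 h2 h3
    have h5 : ‖φ₁ (φ₂ o t) s - φ₁ o s‖ ≤ 1 / 8 * |s| + 1 / 8 * |s| + |t| := by
      calc _ = ‖(φ₁ (φ₂ o t) s - φ₂ o t - (s : ℝ) * Complex.exp (a₀ * Complex.I)) -
            (φ₁ o s - o - (s : ℝ) * Complex.exp (a₀ * Complex.I)) +
            (φ₂ o t - o)‖ := by congr 1; ring
        _ ≤ _ := (norm_add_le _ _).trans (add_le_add ((norm_sub_le _ _).trans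
            (add_le_add h3 h2)) h4)
    have h6 := (norm_fst_le (h.meet (φ₂ o t) (φ₁ o s) - (s, 0))).trans h1
    rw [Prod.fst_sub, Real.norm_eq_abs] at h6
    linarith

theorem strictMono_meet_snd (h : IsFlatNet κ α L φ₁ φ₂ a₀) (o : ℂ) (s : ℝ) :
    StrictMono fun t ↦ (h.meet (φ₂ o t) (φ₁ o s)).2 := by
  refine strictMono_of_injective_of_pos ?_ ?_ (by simp [h.flow₂.zero, h.meet_flow_zero])
    (x := 4 * |s| + 1) (by positivity) ?_
  · exact continuous_snd.comp (h.continuous_meet.comp ((h.flow₂.continuous o).prodMk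
      continuous_const))
  · intro t t' htt
    simp only at htt
    have h1 := h.coord_symm_snd o s t
    rw [htt, ← h.coord_symm_snd] at h1
    exact (Prod.mk.inj ((h.coord o).symm.injective h1)).2
  · have := (h.abs_meet_sub_le o s (4 * |s| + 1)).1
    rw [abs_of_nonneg (show 0 ≤ 4 * |s| + 1 by positivity)] at this
    have := (abs_le.1 this).1
    have := abs_nonneg s
    linarith

theorem strictMono_meet_fst (h : IsFlatNet κ α L φ₁ φ₂ a₀) (o : ℂ) (t : ℝ) :
    StrictMono fun s ↦ (h.meet (φ₂ o t) (φ₁ o s)).1 := by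
  refine strictMono_of_injective_of_pos ?_ ?_ (by simp [h.flow₁.zero, h.meet_zero_flow])
    (x := 4 * |t| + 1) (by positivity) ?_
  · exact continuous_fst.comp (h.continuous_meet.comp (continuous_const.prodMk
      (h.flow₁.continuous o)))
  · intro s s' hss
    simp only at hss
    have h1 := h.coord_symm_fst o s t
    rw [hss, ← h.coord_symm_fst] at h1
    exact (Prod.mk.inj ((h.coord o).symm.injective h1)).1
  · have := (h.abs_meet_sub_le o (4 * |t| + 1) t).2
    rw [abs_of_nonneg (show 0 ≤ 4 * |t| + 1 by positivity)] at this
    have := (abs_le.1 this).1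
    have := abs_nonneg t
    linarith

theorem image_Icc_of_strictMono {f : ℝ → ℝ} (hf : Continuous f) (hm : StrictMono f) {a b : ℝ}
    (hab : a ≤ b) : f '' Icc a b = Icc (f a) (f b) :=
  Subset.antisymm (by
    rintro _ ⟨x, hx, rfl⟩
    exact ⟨hm.monotone hx.1, hm.monotone hx.2⟩) (intermediate_value_Icc hab hf.continuousOn)

/-- The four sides of the cell `[0, s] × [0, t]` of the net coordinates are arcs of the net. -/
theorem image_sides (h : IsFlatNet κ α L φ₁ φ₂ a₀) (o : ℂ) {s t : ℝ} (hs : 0 < s) (ht : 0 < t) :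
    φ₂ o '' Icc 0 t = h.coord o ⁻¹' ({0} ×ˢ Icc 0 t) ∧
    φ₂ (φ₁ o s) '' Icc 0 (h.meet (φ₂ o t) (φ₁ o s)).2 = h.coord o ⁻¹' ({s} ×ˢ Icc 0 t) ∧
    φ₁ o '' Icc 0 s = h.coord o ⁻¹' (Icc 0 s ×ˢ {0}) ∧
    φ₁ (φ₂ o t) '' Icc 0 (h.meet (φ₂ o t) (φ₁ o s)).1 = h.coord o ⁻¹' (Icc 0 s ×ˢ {t}) := by
  have key2 : ∀ s, φ₂ (φ₁ o s) '' Icc 0 (h.meet (φ₂ o t) (φ₁ o s)).2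
      = h.coord o ⁻¹' ({s} ×ˢ Icc 0 t) := by
    intro s
    have hc : Continuous fun t ↦ (h.meet (φ₂ o t) (φ₁ o s)).2 :=
      continuous_snd.comp (h.continuous_meet.comp ((h.flow₂.continuous o).prodMk continuous_const))
    have := image_Icc_of_strictMono hc (h.strictMono_meet_snd o s) ht.le
    simp only [h.flow₂.zero, h.meet_flow_zero] at this
    rw [← this, image_image, ← Homeomorph.image_symm, singleton_prod, image_image]
    refine image_congr fun t _ ↦ ?_
    exact (h.coord_symm_snd o s t).symm
  have key1 : ∀ t, φ₁ (φ₂ o t) '' Icc 0 (h.meet (φ₂ o t) (φ₁ o s)).1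
      = h.coord o ⁻¹' (Icc 0 s ×ˢ {t}) := by
    intro t
    have hc : Continuous fun s ↦ (h.meet (φ₂ o t) (φ₁ o s)).1 :=
      continuous_fst.comp (h.continuous_meet.comp (continuous_const.prodMk (h.flow₁.continuous o)))
    have := image_Icc_of_strictMono hc (h.strictMono_meet_fst o t) hs.le
    simp only [h.flow₁.zero, h.meet_zero_flow] at this
    rw [← this, image_image, ← Homeomorph.image_symm, prod_singleton, image_image]
    refine image_congr fun s _ ↦ ?_
    exact (h.coord_symm_fst o s t).symm
  refine ⟨?_, key2 s, ?_, key1 t⟩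
  · simpa [h.flow₁.zero, h.meet_zero_flow] using key2 0
  · simpa [h.flow₂.zero, h.meet_flow_zero] using key1 0

theorem meet_pos (h : IsFlatNet κ α L φ₁ φ₂ a₀) (o : ℂ) {s t : ℝ} (hs : 0 < s) (ht : 0 < t) :
    0 < (h.meet (φ₂ o t) (φ₁ o s)).1 ∧ 0 < (h.meet (φ₂ o t) (φ₁ o s)).2 := by
  have h1 := h.strictMono_meet_fst o t hs
  have h2 := h.strictMono_meet_snd o s ht
  simp only [h.flow₁.zero, h.flow₂.zero, h.meet_zero_flow, h.meet_flow_zero] at h1 h2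
  exact ⟨h1, h2⟩

/-- Cells of the net are small. -/
theorem coord_preimage_subset (h : IsFlatNet κ α L φ₁ φ₂ a₀) (o : ℂ) {s t : ℝ} :
    h.coord o ⁻¹' (Icc 0 s ×ˢ Icc 0 t) ⊆ Metric.closedBall o (3 * s + 2 * t) := by
  intro w hw
  obtain ⟨⟨a, b⟩, rfl⟩ := (h.coord o).symm.surjective w
  rw [mem_preimage, Homeomorph.apply_symm_apply] at hw
  obtain ⟨⟨ha, ha'⟩, hb, hb'⟩ := hw
  simp only at ha ha' hb hb'
  have h1 := (h.abs_meet_sub_le o a b).1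
  rw [abs_of_nonneg ha, abs_of_nonneg hb] at h1
  have d1 := h.flow₁.dist_time_le (fun w ↦ (norm_dirField norm_one α w).le) o a 0
  have d2 := h.flow₂.dist_time_le
    (fun w ↦ (norm_dirField (norm_of_eq_I_or h.kappa) α w).le) (φ₁ o a)
    (h.meet (φ₂ o b) (φ₁ o a)).2 0
  rw [h.flow₁.zero, sub_zero, abs_of_nonneg ha] at d1
  rw [h.flow₂.zero, sub_zero] at d2
  rw [Metric.mem_closedBall, coord_symm_snd]
  have h2 : |(h.meet (φ₂ o b) (φ₁ o a)).2| ≤ 2 * a + 2 * b := by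
    rw [abs_le] at h1 ⊢; constructor <;> linarith
  linarith [dist_triangle (φ₂ (φ₁ o a) (h.meet (φ₂ o b) (φ₁ o a)).2) (φ₁ o a) o]

end IsFlatNet

/-! ### Cells of a net as characteristic quadrilaterals -/

/-- On `U`, the fields of slope angle `α` and of slope angle `α` turned by the right angle `κ` are
the two characteristic direction fields of `θ`, of family `k` and `i`; the second one possibly with
the opposite orientation. -/
structure IsAdapted (θ : ℂ → ℝ) (k i : Fin 2) (κ : ℂ) (α : ℂ → ℝ) (U : Set ℂ) : Prop where
  ne : i ≠ k
  fst : ∀ w ∈ U, charField θ k w = dirField 1 α w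
  snd : (∀ w ∈ U, charField θ i w = dirField κ α w) ∨
    (∀ w ∈ U, charField θ i w = -dirField κ α w)
  sub : ∀ w ∈ U, ∀ w' ∈ U, α w - α w' = θ w - θ w'

theorem isCharArc_of_hasDerivAt {G : Set ℂ} {θ : ℂ → ℝ} {k : Fin 2} {z : ℝ → ℂ} {v : ℂ → ℂ} {l : ℝ}
    (hl : 0 < l) (hz : ∀ t, HasDerivAt z (v (z t)) t) (hi : InjOn z (Icc 0 l))
    (hG : MapsTo z (Icc 0 l) G)
    (hv : (∀ t ∈ Icc 0 l, charField θ k (z t) = v (z t)) ∨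
      (∀ t ∈ Icc 0 l, charField θ k (z t) = -v (z t))) :
    IsCharArc G θ k (z '' Icc 0 l) (z 0) (z l) := by
  rcases hv with hv | hv
  · refine ⟨l, z, hl, fun t ht ↦ ?_, hi, hG, rfl, Or.inl ⟨rfl, rfl⟩⟩
    simp only [hv t ht]
    exact (hz t).hasDerivWithinAt
  · have hr : ∀ t ∈ Icc 0 l, l - t ∈ Icc 0 l := fun t ht ↦ ⟨by linarith [ht.2], by linarith [ht.1]⟩
    refine ⟨l, fun t ↦ z (l - t), hl, fun t ht ↦ ?_, ?_, fun t ht ↦ hG (hr t ht), ?_,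
      Or.inr ⟨by simp, by simp⟩⟩
    · simp only [hv _ (hr t ht)]
      have := (hz (l - t)).scomp t ((hasDerivAt_id t).const_sub l)
      simpa [Function.comp_def] using this.hasDerivWithinAt
    · intro s hs t ht hst
      have := hi (hr s hs) (hr t ht) hst
      linarith
    · ext w
      constructor
      · rintro ⟨t, ht, rfl⟩
        exact ⟨_, hr t ht, rfl⟩
      · rintro ⟨t, ht, rfl⟩
        exact ⟨l - t, hr t ht, by simp⟩

namespace IsFlatNet

variable {κ : ℂ} {α : ℂ → ℝ} {L : NNReal} {φ₁ φ₂ : ℂ → ℝ → ℂ} {a₀ : ℝ}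

theorem isCharQuadrilateral (h : IsFlatNet κ α L φ₁ φ₂ a₀) {G : Set ℂ} {θ : ℂ → ℝ} {k i : Fin 2}
    (o : ℂ) {s t : ℝ} (hs : 0 < s) (ht : 0 < t)
    (hG : Metric.closedBall o (3 * s + 2 * t) ⊆ G)
    (hθ : IsAdapted θ k i κ α (Metric.closedBall o (3 * s + 2 * t))) :
    IsCharQuadrilateral G θ o (φ₂ o t) (φ₁ o s) (φ₁ (φ₂ o t) (h.meet (φ₂ o t) (φ₁ o s)).1) := by
  obtain ⟨e1, e2, e3, e4⟩ := h.image_sides o hs ht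
  obtain ⟨hl1, hl2⟩ := h.meet_pos o hs ht
  set m := h.meet (φ₂ o t) (φ₁ o s) with hm
  set b := Metric.closedBall o (3 * s + 2 * t) with hb
  have hmeet : φ₁ (φ₂ o t) m.1 = φ₂ (φ₁ o s) m.2 := h.meet_spec _ _
  set E := h.coord o with hE
  have hcell : E ⁻¹' (Icc 0 s ×ˢ Icc 0 t) ⊆ b := h.coord_preimage_subset o
  have s0 : (0 : ℝ) ∈ Icc 0 s := ⟨le_rfl, hs.le⟩
  have s1 : s ∈ Icc 0 s := ⟨hs.le, le_rfl⟩
  have t0 : (0 : ℝ) ∈ Icc 0 t := ⟨le_rfl, ht.le⟩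
  have t1 : t ∈ Icc 0 t := ⟨ht.le, le_rfl⟩
  have c1 : E ⁻¹' ({0} ×ˢ Icc 0 t) ⊆ b :=
    (preimage_mono (prod_mono_left (singleton_subset_iff.2 s0))).trans hcell
  have c2 : E ⁻¹' ({s} ×ˢ Icc 0 t) ⊆ b :=
    (preimage_mono (prod_mono_left (singleton_subset_iff.2 s1))).trans hcell
  have c3 : E ⁻¹' (Icc 0 s ×ˢ {0}) ⊆ b :=
    (preimage_mono (prod_mono_right (singleton_subset_iff.2 t0))).trans hcell
  have c4 : E ⁻¹' (Icc 0 s ×ˢ {t}) ⊆ b :=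
    (preimage_mono (prod_mono_right (singleton_subset_iff.2 t1))).trans hcell
  have inj1 : ∀ p, Function.Injective (φ₁ p) := fun p x y hxy ↦ by
    have := (h.meet_eq (s := x) (t := 0) (h.flow₂.zero _).symm).symm.trans
      (h.meet_eq (p := p) (q := φ₁ p x) (s := y) (t := 0) (hxy.symm.trans (h.flow₂.zero _).symm))
    exact (Prod.mk.inj this).1
  have inj2 : ∀ p, Function.Injective (φ₂ p) := fun p x y hxy ↦ by
    have := (h.meet_eq (s := 0) (t := x) (h.flow₁.zero _)).symm.trans
      (h.meet_eq (p := φ₂ p x) (q := p) (s := 0) (t := y) ((h.flow₁.zero _).trans hxy))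
    exact (Prod.mk.inj this).2
  have arc1 : ∀ p l, 0 < l → φ₁ p '' Icc 0 l ⊆ b → IsCharArc G θ k (φ₁ p '' Icc 0 l) p (φ₁ p l) := by
    intro p l hl hsub
    have := isCharArc_of_hasDerivAt (G := G) (θ := θ) (k := k) hl (h.flow₁.hasDerivAt p) (inj1 p).injOn
      (fun x hx ↦ hG (hsub (mem_image_of_mem _ hx)))
      (Or.inl fun x hx ↦ hθ.fst _ (hsub (mem_image_of_mem _ hx)))
    rwa [h.flow₁.zero] at this
  have arc2 : ∀ p l, 0 < l → φ₂ p '' Icc 0 l ⊆ b → IsCharArc G θ i (φ₂ p '' Icc 0 l) p (φ₂ p l) := by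
    intro p l hl hsub
    have := isCharArc_of_hasDerivAt (G := G) (θ := θ) (k := i) hl (h.flow₂.hasDerivAt p) (inj2 p).injOn
      (fun x hx ↦ hG (hsub (mem_image_of_mem _ hx)))
      (hθ.snd.imp (fun hs x hx ↦ hs _ (hsub (mem_image_of_mem _ hx)))
        (fun hs x hx ↦ hs _ (hsub (mem_image_of_mem _ hx))))
    rwa [h.flow₂.zero] at this
  have hpt : ∀ w x y, E w = (x, y) → E ⁻¹' ({x} ×ˢ {y}) = {w} := by
    intro w x y hw
    rw [singleton_prod_singleton, ← hw]
    ext w'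
    simp
  have E0 : E o = (0, 0) := by
    change ((h.meet o o).1, (h.meet o o).2) = _
    have := h.meet_zero_flow o 0
    rw [h.flow₂.zero] at this
    rw [this]
  have Et : E (φ₂ o t) = (0, t) := by
    rw [← (h.coord o).apply_symm_apply (0, t), h.coord_symm_snd, h.flow₁.zero, h.meet_zero_flow]
  have Es : E (φ₁ o s) = (s, 0) := by
    rw [← (h.coord o).apply_symm_apply (s, 0), h.coord_symm_fst, h.flow₂.zero, h.meet_flow_zero]
  have Est : E (φ₁ (φ₂ o t) m.1) = (s, t) := by
    rw [hm, ← h.coord_symm_fst, hE, Homeomorph.apply_symm_apply]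
  refine ⟨i, k, E ⁻¹' (Ioo 0 s ×ˢ Ioo 0 t), _, φ₂ (φ₁ o s) '' Icc 0 m.2, _, _, hθ.ne,
    (isOpen_Ioo.prod isOpen_Ioo).preimage E.continuous, ?_, ?_, ?_,
    arc2 o t ht (e1.trans_subset c1), ?_, arc1 o s hs (e3.trans_subset c3),
    arc1 (φ₂ o t) m.1 hl1 (e4.trans_subset c4), ?_⟩
  · rw [E.isConnected_preimage]
    exact (isConnected_Ioo hs).prod (isConnected_Ioo ht)
  · exact ((preimage_mono (Set.prod_mono Ioo_subset_Icc_self Ioo_subset_Icc_self)).trans hcell).trans hG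
  · rw [← E.preimage_frontier, frontier_prod_eq, closure_Ioo hs.ne, closure_Ioo ht.ne,
      frontier_Ioo hs, frontier_Ioo ht, e1, e2, e3, e4, ← preimage_union, ← preimage_union,
      ← preimage_union]
    congr 1
    rw [insert_eq, insert_eq, prod_union, union_prod]
    ac_rfl
  · rw [hmeet]
    exact arc2 (φ₁ o s) m.2 hl2 (e2.trans_subset c2)
  · rw [e1, e2, e3, e4]
    simp only [← preimage_inter, prod_inter_prod]
    have i1 : ({0} : Set ℝ) ∩ Icc 0 s = {0} := inter_eq_left.2 (singleton_subset_iff.2 s0)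
    have i2 : ({s} : Set ℝ) ∩ Icc 0 s = {s} := inter_eq_left.2 (singleton_subset_iff.2 s1)
    have i3 : Icc 0 t ∩ {0} = {(0 : ℝ)} := inter_eq_right.2 (singleton_subset_iff.2 t0)
    have i4 : Icc 0 t ∩ {t} = {t} := inter_eq_right.2 (singleton_subset_iff.2 t1)
    have i5 : ({0} : Set ℝ) ∩ {s} = ∅ := by simp [hs.ne]
    have i6 : ({0} : Set ℝ) ∩ {t} = ∅ := by simp [ht.ne]
    rw [i1, i2, i3, i4, i5, i6]
    refine ⟨hpt _ _ _ E0, hpt _ _ _ Et, hpt _ _ _ Es, hpt _ _ _ Est, by simp, by simp⟩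

/-- The turning of the first family keeps its sign along the second family: by the two-sided
estimate it vanishes on all or on none of the parallel sides of a cell. -/
theorem turning_nonneg (h : IsFlatNet κ α L φ₁ φ₂ a₀) {G : Set ℂ} {θ : ℂ → ℝ} {k i : Fin 2} {K : ℝ}
    (hK : 1 ≤ K) (hHP : IsQuasiHP G K θ) (o : ℂ) {s t : ℝ} (hs : 0 < s) (ht : 0 < t)
    (hG : Metric.closedBall o (3 * s + 2 * t) ⊆ G)
    (hθ : IsAdapted θ k i κ α (Metric.closedBall o (3 * s + 2 * t))) {σ : ℝ}
    (hσ : 0 ≤ σ * (α (φ₁ o s) - α o)) :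
    ∀ u ∈ Icc 0 t, 0 ≤ σ * (α (φ₁ (φ₂ o u) (h.meet (φ₂ o u) (φ₁ o s)).1) - α (φ₂ o u)) := by
  have hpos : 0 < K := by linarith
  set g : ℝ → ℝ := fun u ↦ α (φ₁ (φ₂ o u) (h.meet (φ₂ o u) (φ₁ o s)).1) - α (φ₂ o u) with hg
  have g0 : g 0 = α (φ₁ o s) - α o := by
    simp only [hg, h.flow₂.zero, h.meet_flow_zero]
  have hzero : ∀ u ∈ Icc 0 t, g u = 0 ↔ g 0 = 0 := by
    intro u hu
    rcases hu.1.eq_or_lt with rfl | hu0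
    · rfl
    have hsub : Metric.closedBall o (3 * s + 2 * u) ⊆ Metric.closedBall o (3 * s + 2 * t) :=
      Metric.closedBall_subset_closedBall (by linarith [hu.2])
    have hθ' : IsAdapted θ k i κ α (Metric.closedBall o (3 * s + 2 * u)) :=
      ⟨hθ.ne, fun w hw ↦ hθ.fst w (hsub hw), hθ.snd.imp (fun hs w hw ↦ hs w (hsub hw))
        (fun hs w hw ↦ hs w (hsub hw)), fun w hw w' hw' ↦ hθ.sub w (hsub hw) w' (hsub hw')⟩
    obtain ⟨q1, q2⟩ := hHP.quasiHP _ _ _ _ (h.isCharQuadrilateral o hs hu0 (hsub.trans hG) hθ')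
    have hcell : (h.coord o) ⁻¹' (Icc 0 s ×ˢ Icc 0 t) ⊆ Metric.closedBall o (3 * s + 2 * t) :=
      h.coord_preimage_subset o
    have m1 : o ∈ Metric.closedBall o (3 * s + 2 * t) := Metric.mem_closedBall_self (by positivity)
    have m2 : φ₁ o s ∈ Metric.closedBall o (3 * s + 2 * t) := by
      refine hcell ?_
      rw [← show (h.coord o).symm (s, 0) = φ₁ o s by
        rw [h.coord_symm_fst, h.flow₂.zero, h.meet_flow_zero], mem_preimage,
        Homeomorph.apply_symm_apply]
      exact ⟨⟨hs.le, le_rfl⟩, le_rfl, ht.le⟩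
    have m3 : φ₂ o u ∈ Metric.closedBall o (3 * s + 2 * t) := by
      refine hcell ?_
      rw [← show (h.coord o).symm (0, u) = φ₂ o u by
        rw [h.coord_symm_snd, h.flow₁.zero, h.meet_zero_flow], mem_preimage,
        Homeomorph.apply_symm_apply]
      exact ⟨⟨le_rfl, hs.le⟩, hu⟩
    have m4 : φ₁ (φ₂ o u) (h.meet (φ₂ o u) (φ₁ o s)).1 ∈ Metric.closedBall o (3 * s + 2 * t) := by
      refine hcell ?_
      rw [← h.coord_symm_fst, mem_preimage, Homeomorph.apply_symm_apply]
      exact ⟨⟨hs.le, le_rfl⟩, hu⟩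
    rw [← hθ.sub _ m2 _ m1, ← hθ.sub _ m4 _ m3] at q1 q2
    rw [g0]
    change 1 / K * _ ≤ |g u| at q1
    change |g u| ≤ _ at q2
    constructor
    · intro h0
      rw [h0, abs_zero] at q1
      have : |α (φ₁ o s) - α o| ≤ 0 := by
        by_contra! hc
        have := mul_pos (one_div_pos.2 hpos) hc
        linarith
      exact abs_nonpos_iff.1 this
    · intro h0
      rw [h0, abs_zero, mul_zero] at q2
      exact abs_nonpos_iff.1 q2
  have hgc : Continuous g := by
    have c2 := h.flow₂.continuous o
    have c3 : Continuous fun u ↦ (h.meet (φ₂ o u) (φ₁ o s)).1 :=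
      continuous_fst.comp (h.continuous_meet.comp (c2.prodMk continuous_const))
    exact (h.lipschitz.continuous.comp ((h.flow₁.continuous_uncurry h.lip₁).comp
      (c2.prodMk c3))).sub (h.lipschitz.continuous.comp c2)
  intro u hu
  change 0 ≤ σ * g u
  rw [← g0] at hσ
  by_contra! hneg
  have hmem : (0 : ℝ) ∈ (fun v ↦ σ * g v) '' Icc 0 u := by
    refine intermediate_value_Icc' hu.1 (by fun_prop) ⟨hneg.le, hσ⟩
  obtain ⟨v, hv, hv0⟩ := hmem
  rcases mul_eq_zero.1 hv0 with h0 | h0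
  · simp [h0] at hneg
  · have := (hzero u hu).2 ((hzero v ⟨hv.1, hv.2.trans hu.2⟩).1 h0)
    simp [this] at hneg

end IsFlatNet

/-! ### Length of transversal arcs along the second family -/

/-- A lower bound for increments with an error quadratic in the step integrates to one without it. -/
theorem sub_mul_le_of_forall_sub_sq_le {f : ℝ → ℝ} {A B t : ℝ} (ht : 0 ≤ t)
    (h : ∀ u v, 0 ≤ u → u ≤ v → v ≤ t → f u - A * (v - u) - B * (v - u) ^ 2 ≤ f v) :
    f 0 - A * t ≤ f t := by
  have key : ∀ N : ℕ, 0 < N → f 0 - A * t - B * t ^ 2 / N ≤ f t := by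
    intro N hN
    have hN' : (0 : ℝ) < N := by exact_mod_cast hN
    have ind : ∀ k : ℕ, k ≤ N → f 0 - k * (A * (t / N) + B * (t / N) ^ 2) ≤ f (k * (t / N)) := by
      intro k
      induction k with
      | zero => intro _; simp
      | succ k ih =>
        intro hk
        have hk' : ((k + 1 : ℕ) : ℝ) ≤ N := by exact_mod_cast hk
        have h1 := ih (by omega)
        have h2 := h (k * (t / N)) ((k + 1 : ℕ) * (t / N)) (by positivity)
          (by push_cast; nlinarith [div_nonneg ht hN'.le])
          (by
            calc ((k + 1 : ℕ) : ℝ) * (t / N) ≤ N * (t / N) :=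
                mul_le_mul_of_nonneg_right hk' (div_nonneg ht hN'.le)
              _ = t := by field_simp)
        push_cast at h2 ⊢
        have e : ((k : ℝ) + 1) * (t / N) - k * (t / N) = t / N := by ring
        rw [e] at h2
        linarith
    have h1 := ind N le_rfl
    have e1 : (N : ℝ) * (t / N) = t := by field_simp
    have e2 : (N : ℝ) * (A * (t / N) + B * (t / N) ^ 2) = A * t + B * t ^ 2 / N := by
      field_simp
    rw [e1, e2] at h1
    linarith
  have hlim : Tendsto (fun N : ℕ ↦ f 0 - A * t - B * t ^ 2 / N) atTop (𝓝 (f 0 - A * t - 0)) :=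
    tendsto_const_nhds.sub (tendsto_const_div_atTop_nhds_zero_nat _)
  rw [sub_zero] at hlim
  exact le_of_tendsto hlim (eventually_atTop.2 ⟨1, fun N hN ↦ key N hN⟩)

theorem exp_le_of_le_half {x : ℝ} (hx : x ≤ 1 / 2) : Real.exp x ≤ 9 / 4 := by
  have h1 : Real.exp x * Real.exp x ≤ Real.exp 1 := by
    rw [← Real.exp_add]
    exact Real.exp_le_exp.2 (by linarith)
  nlinarith [Real.exp_one_lt_d9, Real.exp_pos x]

theorem norm_flow_sub_le {κ : ℂ} (hκ : ‖κ‖ = 1) {α : ℂ → ℝ} {L : NNReal} (hα : LipschitzWith L α)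
    {φ : ℂ → ℝ → ℂ} (hφ : IsFlow (dirField κ α) φ) (p : ℂ) (s t : ℝ) :
    ‖φ p t - φ p s - (t - s : ℝ) * dirField κ α (φ p s)‖ ≤ L * (t - s) ^ 2 := by
  have := norm_sub_sub_le (hφ.hasDerivAt p) (x := s) (y := t) (e := dirField κ α (φ p s))
    (η := L * |t - s|) (by
      intro u hu
      refine (norm_dirField_sub_le hκ α α _ _).trans ?_
      refine (hα.dist_le_mul _ _).trans ?_
      gcongr
      refine (hφ.dist_time_le (fun w ↦ (norm_dirField hκ α w).le) p u s).trans ?_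
      exact abs_sub_left_of_mem_uIcc hu)
  rwa [mul_assoc, abs_mul_abs_self, ← sq] at this

theorem dirField_mul_star (κ : ℂ) (α : ℂ → ℝ) (w w' : ℂ) :
    dirField κ α w * star (dirField 1 α w') = κ * Complex.exp ((α w - α w' : ℝ) * Complex.I) := by
  rw [dirField, dirField, one_mul, Complex.star_def, ← Complex.exp_conj, mul_assoc, ← Complex.exp_add]
  congr 2
  simp
  ring

namespace IsFlatNet

variable {κ : ℂ} {α : ℂ → ℝ} {L : NNReal} {φ₁ φ₂ : ℂ → ℝ → ℂ} {a₀ : ℝ}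

theorem norm_meet_sub_le_of_small (h : IsFlatNet κ α L φ₁ φ₂ a₀) (o : ℂ) {s u : ℝ} (hs : 0 ≤ s)
    (hu : 0 ≤ u) (hLu : L * u ≤ 1 / 2) :
    ‖h.meet (φ₂ o u) (φ₁ o s) - (0, u)‖ ≤ 3 * s := by
  have h1 := h.norm_meet_sub_le (φ₂ o u) (φ₁ o s) (0, u)
  have h2 := h.flow₂.dist_le h.lip₂ o (φ₁ o s) u
  have h3 := h.flow₁.dist_time_le (fun w ↦ (norm_dirField norm_one α w).le) o 0 s
  rw [h.flow₁.zero, zero_sub, abs_neg, abs_of_nonneg hs] at h3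
  simp only [h.flow₁.zero] at h1
  rw [dist_eq_norm, abs_of_nonneg hu] at h2
  have h4 := exp_le_of_le_half hLu
  calc _ ≤ 4 / 3 * (dist o (φ₁ o s) * Real.exp (L * u)) := by linarith
    _ ≤ 4 / 3 * (s * (9 / 4)) := by gcongr
    _ = 3 * s := by ring

theorem norm_meet_sub_meet_le (h : IsFlatNet κ α L φ₁ φ₂ a₀) (o q : ℂ) {u v : ℝ}
    (hL : L * |(h.meet (φ₂ o u) q).1| ≤ 1 / 2) :
    ‖h.meet (φ₂ o v) q - h.meet (φ₂ o u) q‖ ≤ 3 * |v - u| := by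
  have h1 := h.norm_meet_sub_le (φ₂ o v) q (h.meet (φ₂ o u) q)
  rw [← h.meet_spec (φ₂ o u) q] at h1
  have h2 := h.flow₁.dist_le h.lip₁ (φ₂ o v) (φ₂ o u) (h.meet (φ₂ o u) q).1
  rw [dist_eq_norm] at h2
  have h3 := h.flow₂.dist_time_le (fun w ↦ (norm_dirField (norm_of_eq_I_or h.kappa) α w).le) o v u
  have h4 := exp_le_of_le_half hL
  calc _ ≤ 4 / 3 * (dist (φ₂ o v) (φ₂ o u) * Real.exp (L * |(h.meet (φ₂ o u) q).1|)) := by linarith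
    _ ≤ 4 / 3 * (|v - u| * (9 / 4)) := by gcongr
    _ = _ := by ring

/-- If the first family turns away from the direction in which the second family runs, arcs of the
first family do not get shorter along the second one, up to an error quadratic in the length. -/
theorem sub_le_meet_fst (h : IsFlatNet κ α L φ₁ φ₂ a₀) (o : ℂ) {s t σ : ℝ} (hs : 0 < s) (ht : 0 < t)
    (hLs : L * (3 * s) ≤ 1 / 2) (hLt : L * t ≤ 1 / 2) (hσ : σ = 1 ∨ σ = -1)
    (hκ : κ = -(σ : ℂ) * Complex.I)
    (hturn : ∀ u ∈ Icc 0 t,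
      0 ≤ σ * (α (φ₁ (φ₂ o u) (h.meet (φ₂ o u) (φ₁ o s)).1) - α (φ₂ o u))) :
    s - 6 * L * s ^ 2 ≤ (h.meet (φ₂ o t) (φ₁ o s)).1 := by
  have nκ := norm_of_eq_I_or h.kappa
  have hL0 : (0 : ℝ) ≤ L := L.2
  set X : ℝ → ℂ := φ₂ o with hX
  set l : ℝ → ℝ := fun u ↦ (h.meet (X u) (φ₁ o s)).1 with hl
  set g : ℝ → ℝ := fun u ↦ (h.meet (X u) (φ₁ o s)).2 with hg
  set Y : ℝ → ℂ := fun u ↦ φ₁ (X u) (l u) with hY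
  have hY' : ∀ u, Y u = φ₂ (φ₁ o s) (g u) := fun u ↦ h.meet_spec _ _
  set e : ℝ → ℂ := fun u ↦ dirField 1 α (X u) with he
  have ne : ∀ u, ‖star (e u)‖ = 1 := fun u ↦ by rw [norm_star]; exact norm_dirField norm_one _ _
  -- The length of the moving side is bounded below through its projection `m` to the tangent at its
  -- initial point: the endpoint terms in the increment of `m` are nonnegative because of `hturn`.
  set m : ℝ → ℝ := fun u ↦ ((Y u - X u) * star (e u)).re with hm
  have re_le : ∀ z w : ℂ, ‖w‖ = 1 → |(z * w).re| ≤ ‖z‖ := fun z w hw ↦ by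
    simpa [hw] using Complex.abs_re_le_norm (z * w)
  have hlnn : ∀ u, 0 ≤ l u := fun u ↦ by
    have := (h.strictMono_meet_fst o u).monotone hs.le
    simpa [h.flow₁.zero, h.meet_zero_flow] using this
  have hl3 : ∀ u ∈ Icc 0 t, l u ≤ 3 * s := fun u hu ↦ by
    have h1 := (norm_fst_le _).trans (h.norm_meet_sub_le_of_small o hs.le hu.1
      ((mul_le_mul_of_nonneg_left hu.2 hL0).trans hLt))
    rw [Prod.fst_sub, sub_zero] at h1
    exact (le_abs_self _).trans h1
  have step : ∀ u v, 0 ≤ u → u ≤ v → v ≤ t →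
      m u - 9 * L ^ 2 * s ^ 2 * (v - u) - 10 * L * (v - u) ^ 2 ≤ m v := by
    intro u v hu huv hv
    have hut : u ∈ Icc 0 t := ⟨hu, huv.trans hv⟩
    have hvt : v ∈ Icc 0 t := ⟨hu.trans huv, hv⟩
    set d := v - u with hd
    have hd0 : 0 ≤ d := by linarith
    have hgd : 0 ≤ g v - g u ∧ g v - g u ≤ 3 * d := by
      constructor
      · linarith [(h.strictMono_meet_snd o s).monotone huv]
      · have h1 := (norm_snd_le _).trans (h.norm_meet_sub_meet_le o (φ₁ o s) (u := u) (v := v) (by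
          have : |l u| ≤ 3 * s := by rw [abs_of_nonneg (hlnn u)]; exact hl3 u hut
          exact (mul_le_mul_of_nonneg_left this hL0).trans hLs))
        rw [Prod.snd_sub, abs_of_nonneg hd0] at h1
        exact (le_abs_self _).trans h1
    have r1 := norm_flow_sub_le nκ h.lipschitz h.flow₂ o u v
    have r2 := norm_flow_sub_le nκ h.lipschitz h.flow₂ (φ₁ o s) (g u) (g v)
    have r3 := norm_flow_sub_le norm_one h.lipschitz h.flow₁ (X v) 0 (l v)
    rw [← hY' u, ← hY' v] at r2
    rw [h.flow₁.zero, sub_zero] at r3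
    change ‖Y v - X v - (l v : ℝ) * e v‖ ≤ _ at r3
    change ‖X v - X u - (d : ℝ) * dirField κ α (X u)‖ ≤ _ at r1
    set R1 := X v - X u - (d : ℝ) * dirField κ α (X u) with hR1
    set R2 := Y v - Y u - (g v - g u : ℝ) * dirField κ α (Y u) with hR2
    set R3 := Y v - X v - (l v : ℝ) * e v with hR3
    have decomp : (Y v - X v) * star (e v) - (Y u - X u) * star (e u) =
        (g v - g u : ℝ) * (dirField κ α (Y u) * star (e u)) - (d : ℝ) * (dirField κ α (X u) * star (e u))
        + R2 * star (e u) - R1 * star (e u)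
        + (l v : ℝ) * (e v * star (e v) - e v * star (e u)) + R3 * (star (e v) - star (e u)) := by
      rw [hR1, hR2, hR3]; ring
    have hdm : m v - m u = ((Y v - X v) * star (e v) - (Y u - X u) * star (e u)).re := by
      rw [Complex.sub_re]
    have t1 : 0 ≤ (dirField κ α (Y u) * star (e u)).re := by
      rw [he, dirField_mul_star, hκ]
      have hb : |α (Y u) - α (X u)| ≤ 1 / 4 := by
        have := h.flat (Y u)
        have := h.flat (X u)
        rw [abs_le] at *
        constructor <;> linarith
      have hsin : ∀ x : ℝ, 0 ≤ x → x ≤ 1 / 4 → 0 ≤ Real.sin x := fun x hx hx' ↦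
        Real.sin_nonneg_of_nonneg_of_le_pi hx (by linarith [Real.pi_gt_three])
      have hre : (-(σ : ℂ) * Complex.I * Complex.exp ((α (Y u) - α (X u) : ℝ) * Complex.I)).re
          = σ * Real.sin (α (Y u) - α (X u)) := by
        rw [mul_assoc, ← Complex.ofReal_neg, Complex.re_ofReal_mul, Complex.I_mul_re,
          Complex.exp_ofReal_mul_I_im]
        ring
      rw [hre]
      have := hturn u hut
      change 0 ≤ σ * (α (Y u) - α (X u)) at this
      rw [abs_le] at hb
      rcases hσ with rfl | rfl
      · rw [one_mul] at *
        exact hsin _ this (by linarith)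
      · have := hsin (-(α (Y u) - α (X u))) (by linarith) (by linarith)
        rw [Real.sin_neg] at this
        linarith
    have t2 : (dirField κ α (X u) * star (e u)).re = 0 := by
      rw [he, dirField_mul_star]
      rcases h.kappa with rfl | rfl <;> simp
    have t3 : 0 ≤ (e v * star (e v) - e v * star (e u)).re := by
      rw [he, dirField_mul_star, dirField_mul_star, one_mul, one_mul, Complex.sub_re,
        Complex.exp_ofReal_mul_I_re, Complex.exp_ofReal_mul_I_re, sub_self, Real.cos_zero]
      linarith [Real.cos_le_one (α (X v) - α (X u))]
    have t4 : ‖star (e v) - star (e u)‖ ≤ L * d := by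
      rw [← star_sub, norm_star]
      refine (norm_dirField_sub_le norm_one α α _ _).trans ((h.lipschitz.dist_le_mul _ _).trans ?_)
      gcongr
      refine (h.flow₂.dist_time_le (fun w ↦ (norm_dirField nκ α w).le) o v u).trans ?_
      rw [abs_of_nonneg hd0]
    have s1 := re_le R1 _ (ne u)
    have s2 := re_le R2 _ (ne u)
    have s3 : |(R3 * (star (e v) - star (e u))).re| ≤ L * (3 * s) ^ 2 * (L * d) := by
      refine (Complex.abs_re_le_norm _).trans ?_
      rw [norm_mul]
      have : (l v) ^ 2 ≤ (3 * s) ^ 2 := by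
        have := hl3 v hvt
        have := hlnn v
        gcongr
      calc _ ≤ (L * (l v) ^ 2) * (L * d) := mul_le_mul r3 t4 (norm_nonneg _) (by positivity)
        _ ≤ _ := by gcongr
    have s4 : (L : ℝ) * (g v - g u) ^ 2 ≤ L * (3 * d) ^ 2 := by
      have := hgd.1
      have := hgd.2
      gcongr
    rw [decomp] at hdm
    simp only [Complex.add_re, Complex.sub_re, Complex.re_ofReal_mul, t2, mul_zero] at hdm
    rw [Complex.sub_re] at t3
    have u1 := mul_nonneg hgd.1 t1
    have u2 := mul_nonneg (hlnn v) t3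
    have := (abs_le.1 s1).2
    have := (abs_le.1 s2).1
    have := (abs_le.1 s3).1
    nlinarith
  have hfin := sub_mul_le_of_forall_sub_sq_le ht.le step
  have m0 : s - L * s ^ 2 ≤ m 0 := by
    have r := norm_flow_sub_le norm_one h.lipschitz h.flow₁ o 0 s
    rw [h.flow₁.zero, sub_zero] at r
    have hX0 : X 0 = o := h.flow₂.zero o
    have hl0 : l 0 = s := by
      simp only [hl, hX0, h.meet_flow_zero]
    have hY0 : Y 0 = φ₁ o s := by simp only [hY, hX0, hl0]
    have he0 : e 0 = dirField 1 α o := by simp only [he, hX0]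
    have e1 : (Y 0 - X 0) * star (e 0)
        = (s : ℝ) * (dirField 1 α o * star (dirField 1 α o))
          + (φ₁ o s - o - (s : ℝ) * dirField 1 α o) * star (e 0) := by
      rw [hX0, hY0, he0]; ring
    have := (abs_le.1 ((re_le (φ₁ o s - o - (s : ℝ) * dirField 1 α o) _ (ne 0)).trans r)).1
    simp only [hm]
    rw [e1, Complex.add_re, Complex.re_ofReal_mul, dirField_mul_star]
    simp only [sub_self, Complex.ofReal_zero, zero_mul, Complex.exp_zero, mul_one, Complex.one_re]
    linarith
  have mt : m t ≤ l t := by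
    have := (re_le (Y t - X t) _ (ne t))
    have h2 := h.flow₁.dist_time_le (fun w ↦ (norm_dirField norm_one α w).le) (X t) (l t) 0
    rw [h.flow₁.zero, sub_zero, abs_of_nonneg (hlnn t), dist_eq_norm] at h2
    exact (le_abs_self _).trans (this.trans h2)
  have : 9 * (L : ℝ) ^ 2 * s ^ 2 * t ≤ 5 * L * s ^ 2 := by
    have : 0 ≤ (L : ℝ) * s ^ 2 := by positivity
    nlinarith
  change _ ≤ l t
  linarith

end IsFlatNet

/-! ### Following a transversal arc along a trajectory of the second family -/

/-- The two orthogonal families of curves belonging to a Lipschitz slope angle `α`, each given by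
its global flow. -/
structure IsNet (κ : ℂ) (α : ℂ → ℝ) (L : NNReal) (φ₁ φ₂ : ℂ → ℝ → ℂ) : Prop where
  kappa : κ = Complex.I ∨ κ = -Complex.I
  lipschitz : LipschitzWith L α
  flow₁ : IsFlow (dirField 1 α) φ₁
  flow₂ : IsFlow (dirField κ α) φ₂

theorem IsAdapted.mono {θ : ℂ → ℝ} {k i : Fin 2} {κ : ℂ} {α : ℂ → ℝ} {U V : Set ℂ}
    (h : IsAdapted θ k i κ α U) (hVU : V ⊆ U) : IsAdapted θ k i κ α V :=
  ⟨h.ne, fun w hw ↦ h.fst w (hVU hw), h.snd.imp (fun hs w hw ↦ hs w (hVU hw))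
    (fun hs w hw ↦ hs w (hVU hw)), fun w hw w' hw' ↦ h.sub w (hVU hw) w' (hVU hw')⟩

theorem IsAdapted.congr {θ : ℂ → ℝ} {k i : Fin 2} {κ : ℂ} {α β : ℂ → ℝ} {U : Set ℂ}
    (h : IsAdapted θ k i κ α U) (hαβ : EqOn β α U) : IsAdapted θ k i κ β U := by
  have e : ∀ κ : ℂ, ∀ w ∈ U, dirField κ β w = dirField κ α w := fun κ w hw ↦ by
    rw [dirField, dirField, hαβ hw]
  exact ⟨h.ne, fun w hw ↦ (h.fst w hw).trans (e 1 w hw).symm,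
    h.snd.imp (fun hs w hw ↦ by rw [hs w hw, e κ w hw]) (fun hs w hw ↦ by rw [hs w hw, e κ w hw]),
    fun w hw w' hw' ↦ by rw [hαβ hw, hαβ hw', h.sub w hw w' hw']⟩

theorem IsFlow.eq_of_eqOn {κ : ℂ} (hκ : ‖κ‖ = 1) {α β : ℂ → ℝ} {L : NNReal} (hα : LipschitzWith L α)
    {φ ψ : ℂ → ℝ → ℂ} (hφ : IsFlow (dirField κ α) φ) (hψ : IsFlow (dirField κ β) ψ) {U : Set ℂ}
    (hαβ : EqOn β α U) {p : ℂ} {l : ℝ} (hl : 0 ≤ l) (hU : ψ p '' Icc 0 l ⊆ U) : ψ p l = φ p l := by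
  have := hφ.eq_flow_of_mem_Icc (lipschitzWith_dirField hκ hα) (z := ψ p) (T := l) (fun t ht ↦ by
    have h1 := (hψ.hasDerivAt p t).hasDerivWithinAt (s := Icc 0 l)
    rwa [dirField, hαβ (hU (mem_image_of_mem _ ht))] at h1) l ⟨hl, le_rfl⟩
  rwa [hψ.zero] at this

namespace IsNet

variable {κ : ℂ} {α : ℂ → ℝ} {L : NNReal} {φ₁ φ₂ : ℂ → ℝ → ℂ}

theorem lip₁ (h : IsNet κ α L φ₁ φ₂) : LipschitzWith L (dirField 1 α) :=
  lipschitzWith_dirField norm_one h.lipschitz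

theorem lip₂ (h : IsNet κ α L φ₁ φ₂) : LipschitzWith L (dirField κ α) :=
  lipschitzWith_dirField (norm_of_eq_I_or h.kappa) h.lipschitz

/-- One step of the transport of a transversal arc: the cell of the net with the sides `s` and `t`
at `o` closes, its side opposite to `s` turns in the same sense and is not shorter to first order. -/
theorem exists_cell (h : IsNet κ α L φ₁ φ₂) {G : Set ℂ} {θ : ℂ → ℝ} {k i : Fin 2} {K : ℝ}
    (hK : 1 ≤ K) (hHP : IsQuasiHP G K θ) {σ : ℝ} (hσ : σ = 1 ∨ σ = -1)
    (hκ : κ = -(σ : ℂ) * Complex.I) {o : ℂ} {R s t : ℝ} (hs : 0 < s) (ht : 0 < t)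
    (hst : 3 * s + 2 * t ≤ R) (hLR : L * R ≤ 1 / 8) (hG : Metric.closedBall o R ⊆ G)
    (hθ : IsAdapted θ k i κ α (Metric.closedBall o R)) (hturn : 0 ≤ σ * (α (φ₁ o s) - α o)) :
    ∃ l g, φ₁ (φ₂ o t) l = φ₂ (φ₁ o s) g ∧ 0 < l ∧ l ≤ 3 * s ∧ |g - t| ≤ 3 * s ∧
      s - 6 * L * s ^ 2 ≤ l ∧ 0 ≤ σ * (α (φ₁ (φ₂ o t) l) - α (φ₂ o t)) := by
  have hL0 : (0 : ℝ) ≤ L := L.2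
  have nκ := norm_of_eq_I_or h.kappa
  -- Clamping the angle to an interval of length `1 / 4` changes nothing near `o`.
  set β : ℂ → ℝ := fun w ↦ max (α o - 1 / 8) (min (α o + 1 / 8) (α w)) with hβ
  have hβL : LipschitzWith L β := (h.lipschitz.const_min _).const_max _
  have hβα : EqOn β α (Metric.closedBall o R) := by
    intro w hw
    have h1 : |α w - α o| ≤ 1 / 8 :=
      (h.lipschitz.dist_le_mul w o).trans ((mul_le_mul_of_nonneg_left hw hL0).trans hLR)
    rw [abs_le] at h1
    simp only [hβ]
    rw [min_eq_right (by linarith), max_eq_right (by linarith)]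
  obtain ⟨ψ₁, hψ₁⟩ := exists_isFlow (lipschitzWith_dirField norm_one hβL)
    (fun w ↦ (norm_dirField norm_one β w).le)
  obtain ⟨ψ₂, hψ₂⟩ := exists_isFlow (lipschitzWith_dirField nκ hβL)
    (fun w ↦ (norm_dirField nκ β w).le)
  have hf : IsFlatNet κ β L ψ₁ ψ₂ (α o) := ⟨h.kappa, hβL, hψ₁, hψ₂, fun w ↦ by
    rw [abs_le]
    have h1 : α o - 1 / 8 ≤ β w := le_max_left _ _
    have h2 : β w ≤ α o + 1 / 8 := max_le (by linarith) (min_le_left _ _)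
    constructor <;> linarith⟩
  have hball : Metric.closedBall o (3 * s + 2 * t) ⊆ Metric.closedBall o R :=
    Metric.closedBall_subset_closedBall hst
  obtain ⟨e1, e2, e3, e4⟩ := hf.image_sides o hs ht
  obtain ⟨hl1, hl2⟩ := hf.meet_pos o hs ht
  have hcell := (hf.coord_preimage_subset o (s := s) (t := t)).trans hball
  have s0 : ({0} : Set ℝ) ⊆ Icc 0 s := singleton_subset_iff.2 ⟨le_rfl, hs.le⟩
  have s1 : ({s} : Set ℝ) ⊆ Icc 0 s := singleton_subset_iff.2 ⟨hs.le, le_rfl⟩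
  have t0 : ({0} : Set ℝ) ⊆ Icc 0 t := singleton_subset_iff.2 ⟨le_rfl, ht.le⟩
  have t1 : ({t} : Set ℝ) ⊆ Icc 0 t := singleton_subset_iff.2 ⟨ht.le, le_rfl⟩
  replace e1 := e1.trans_subset ((preimage_mono (prod_mono_left s0)).trans hcell)
  replace e2 := e2.trans_subset ((preimage_mono (prod_mono_left s1)).trans hcell)
  replace e3 := e3.trans_subset ((preimage_mono (prod_mono_right t0)).trans hcell)
  replace e4 := e4.trans_subset ((preimage_mono (prod_mono_right t1)).trans hcell)
  have f1 : ψ₂ o t = φ₂ o t := h.flow₂.eq_of_eqOn nκ h.lipschitz hψ₂ hβα ht.le e1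
  have f2 := h.flow₂.eq_of_eqOn nκ h.lipschitz hψ₂ hβα hl2.le e2
  have f3 : ψ₁ o s = φ₁ o s := h.flow₁.eq_of_eqOn norm_one h.lipschitz hψ₁ hβα hs.le e3
  have f4 := h.flow₁.eq_of_eqOn norm_one h.lipschitz hψ₁ hβα hl1.le e4
  have hθ' := (hθ.congr hβα).mono hball
  have b0 : β o = α o := hβα (Metric.mem_closedBall_self (by linarith))
  have b1 : β (ψ₂ o t) = α (φ₂ o t) := by
    rw [← f1]; exact hβα (e1 (mem_image_of_mem _ ⟨ht.le, le_rfl⟩))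
  have b2 : β (ψ₁ o s) = α (φ₁ o s) := by
    rw [← f3]; exact hβα (e3 (mem_image_of_mem _ ⟨hs.le, le_rfl⟩))
  have b3 := hβα (e4 (mem_image_of_mem _ ⟨hl1.le, le_rfl⟩))
  have hLs : L * (3 * s) ≤ 1 / 2 := by nlinarith
  have hLt : L * t ≤ 1 / 2 := by nlinarith
  have hturn' := hf.turning_nonneg hK hHP o hs ht (hball.trans hG) hθ' (σ := σ) (by rwa [b0, b2])
  have h1 := hf.sub_le_meet_fst o hs ht hLs hLt hσ hκ hturn'
  have h2 := hf.norm_meet_sub_le_of_small o hs.le ht.le hLt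
  have h3 := hf.meet_spec (ψ₂ o t) (ψ₁ o s)
  have h4 := hturn' t ⟨ht.le, le_rfl⟩
  refine ⟨(hf.meet (ψ₂ o t) (ψ₁ o s)).1, (hf.meet (ψ₂ o t) (ψ₁ o s)).2, ?_, hl1, ?_, ?_, h1, ?_⟩
  · rw [← f1, ← f3, ← f4, ← f2]
    exact h3
  · have := (norm_fst_le _).trans h2
    rw [Prod.fst_sub, sub_zero] at this
    exact (le_abs_self _).trans this
  · exact (norm_snd_le _).trans h2
  · rw [b1, b3, f4, f1] at h4
    rwa [f1]

/-- A short transversal arc at `p`, turning in the direction opposite to that of the second family,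
can be pushed along the trajectory of `p` for any length of time, and does not get
shorter to first order. -/
theorem exists_transported_arc (h : IsNet κ α L φ₁ φ₂) {G : Set ℂ} {θ : ℂ → ℝ} {k i : Fin 2} {K : ℝ}
    (hK : 1 ≤ K) (hHP : IsQuasiHP G K θ) {σ : ℝ} (hσ : σ = 1 ∨ σ = -1)
    (hκ : κ = -(σ : ℂ) * Complex.I) {p : ℂ} {R T : ℝ} (hR : 0 < R) (hT : 0 < T)
    (hLR : L * R ≤ 1 / 8)
    (hG : ∀ t ∈ Icc 0 T, Metric.closedBall (φ₂ p t) R ⊆ G)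
    (hθ : ∀ t ∈ Icc 0 T, IsAdapted θ k i κ α (Metric.closedBall (φ₂ p t) R)) :
    ∃ r C, 0 < r ∧ 0 < C ∧ ∀ s ∈ Ioo 0 r, 0 ≤ σ * (α (φ₁ p s) - α p) →
      ∃ l g, φ₁ (φ₂ p T) l = φ₂ (φ₁ p s) g ∧ 0 < l ∧ l ≤ C * s ∧ |g - T| ≤ C * s ∧
        s - C * s ^ 2 ≤ l := by
  have hL0 : (0 : ℝ) ≤ L := L.2
  -- The arc is carried along in `N` steps so short that each cell fits into a ball of radius `R`;
  -- the number of steps, and so the constants, do not depend on the length `s` of the arc.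
  obtain ⟨N, hN⟩ := exists_nat_gt (4 * T / R)
  have hN0 : (0 : ℝ) < N := lt_of_le_of_lt (by positivity) hN
  set d := T / N with hd
  have hd0 : 0 < d := by positivity
  have hdR : 2 * d ≤ R / 2 := by
    rw [div_lt_iff₀ hR] at hN
    have : d * N = T := by rw [hd]; field_simp
    by_contra! hc
    nlinarith
  have hdN : ∀ n : ℕ, n ≤ N → n * d ∈ Icc 0 T := fun n hn ↦ ⟨by positivity, by
    have : (n : ℝ) ≤ N := by exact_mod_cast hn
    calc (n : ℝ) * d ≤ N * d := by gcongr
      _ = T := by rw [hd]; field_simp⟩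
  have key : ∀ n : ℕ, n ≤ N → ∃ r C, 0 < r ∧ 0 < C ∧ ∀ s ∈ Ioo 0 r, 0 ≤ σ * (α (φ₁ p s) - α p) →
      ∃ l g, φ₁ (φ₂ p (n * d)) l = φ₂ (φ₁ p s) g ∧ 0 < l ∧ l ≤ C * s ∧ |g - n * d| ≤ C * s ∧
        s - C * s ^ 2 ≤ l ∧ 0 ≤ σ * (α (φ₁ (φ₂ p (n * d)) l) - α (φ₂ p (n * d))) := by
    intro n
    induction n with
    | zero =>
      intro _
      refine ⟨1, 1, one_pos, one_pos, fun s hs hturn ↦ ⟨s, 0, ?_, hs.1, by simp, ?_, ?_, ?_⟩⟩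
      · simp [h.flow₂.zero]
      · simpa using hs.1.le
      · nlinarith [hs.1]
      · simpa [h.flow₂.zero] using hturn
    | succ n ih =>
      intro hn
      obtain ⟨r, C, hr, hC, hrC⟩ := ih (by omega)
      refine ⟨min r (R / (6 * C)), 4 * C + 6 * L * C ^ 2, by positivity, by positivity,
        fun s hs hturn ↦ ?_⟩
      obtain ⟨l, g, h1, h2, h3, h4, h5, h6⟩ := hrC s ⟨hs.1, hs.2.trans_le (min_le_left _ _)⟩ hturn
      have hs2 : s * (6 * C) < R := by
        rw [← lt_div_iff₀ (by positivity)]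
        exact hs.2.trans_le (min_le_right _ _)
      obtain ⟨l', g', k1, k2, k3, k4, k5, k6⟩ := h.exists_cell hK hHP hσ hκ (o := φ₂ p (n * d))
        (R := R) (s := l) (t := d) h2 hd0 (by nlinarith) hLR (hG _ (hdN n (by omega)))
        (hθ _ (hdN n (by omega))) h6
      have e : φ₂ (φ₂ p (n * d)) d = φ₂ p ((n + 1 : ℕ) * d) := by
        rw [← h.flow₂.add h.lip₂]
        congr 1
        push_cast
        ring
      rw [e] at k1 k6
      have hs0 := hs.1
      have hLC : 0 ≤ L * C ^ 2 * s := by positivity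
      have hll : L * l ^ 2 ≤ L * (C * s) ^ 2 := by gcongr
      refine ⟨l', g + g', ?_, k2, ?_, ?_, ?_, k6⟩
      · rw [k1, h1, ← h.flow₂.add h.lip₂]
      · nlinarith
      · have e2 : g + g' - (n + 1 : ℕ) * d = (g - n * d) + (g' - d) := by push_cast; ring
        rw [e2]
        refine (abs_add_le _ _).trans ?_
        nlinarith
      · have : 0 ≤ C * s ^ 2 := by positivity
        nlinarith
  obtain ⟨r, C, hr, hC, hrC⟩ := key N le_rfl
  have e : N * d = T := by rw [hd]; field_simp
  rw [e] at hrC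
  refine ⟨r, C, hr, hC, fun s hs hturn ↦ ?_⟩
  obtain ⟨l, g, h1, h2, h3, h4, h5, -⟩ := hrC s hs hturn
  exact ⟨l, g, h1, h2, h3, h4, h5⟩

end IsNet

/-! ### The Jacobian of the net coordinates -/

theorem det_eq_re_mul_im_sub (D : ℂ →L[ℝ] ℂ) :
    D.det = (D 1).re * (D Complex.I).im - (D Complex.I).re * (D 1).im := by
  rw [ContinuousLinearMap.det, ← LinearMap.det_toMatrix Complex.basisOneI, Matrix.det_fin_two]
  simp [LinearMap.toMatrix_apply]

/-- The coordinates in which the trajectory of `p` in the first family is the real axis and the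
trajectories of the second family starting on it are the vertical lines. -/
def netMap (φ₁ φ₂ : ℂ → ℝ → ℂ) (p x : ℂ) : ℂ := φ₂ (φ₁ p x.re) x.im

namespace IsNet

variable {κ : ℂ} {α : ℂ → ℝ} {L : NNReal} {φ₁ φ₂ : ℂ → ℝ → ℂ}

/-- Along a trajectory of the second family starting at a point where the first family turns away,
the net coordinates do not contract area. -/
theorem one_le_abs_det (h : IsNet κ α L φ₁ φ₂) {G : Set ℂ} {θ : ℂ → ℝ} {k i : Fin 2} {K : ℝ}
    (hK : 1 ≤ K) (hHP : IsQuasiHP G K θ) {σ : ℝ} (hσ : σ = 1 ∨ σ = -1)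
    (hκ : κ = -(σ : ℂ) * Complex.I) {p x : ℂ} {R : ℝ} (hR : 0 < R) (hx : 0 < x.im)
    (hLR : L * R ≤ 1 / 8)
    (hG : ∀ t ∈ Icc 0 x.im, Metric.closedBall (φ₂ (φ₁ p x.re) t) R ⊆ G)
    (hθ : ∀ t ∈ Icc 0 x.im, IsAdapted θ k i κ α (Metric.closedBall (φ₂ (φ₁ p x.re) t) R))
    (hturn : ∃ᶠ s in 𝓝[>] (0 : ℝ), 0 ≤ σ * (α (φ₁ p (x.re + s)) - α (φ₁ p x.re)))
    {D : ℂ →L[ℝ] ℂ} (hD : HasFDerivAt (netMap φ₁ φ₂ p) D x) : 1 ≤ |D.det| := by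
  have hL0 : (0 : ℝ) ≤ L := L.2
  set q := φ₁ p x.re with hq
  set o := φ₂ q x.im with ho
  set e := dirField 1 α o with he
  have ne : ‖star e‖ = 1 := by rw [norm_star]; exact norm_dirField norm_one _ _
  obtain ⟨r, C, hr, hC, hrC⟩ := h.exists_transported_arc hK hHP hσ hκ hR hx hLR hG hθ
  have hDI : D Complex.I = dirField κ α o := by
    have h1 : HasDerivAt (fun t : ℝ ↦ x + t * Complex.I) Complex.I 0 := by
      simpa using (Complex.ofRealCLM.hasDerivAt.mul_const Complex.I).const_add x
    have h2 : HasFDerivAt (netMap φ₁ φ₂ p) D (x + ((0 : ℝ) : ℂ) * Complex.I) := by simpa using hD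
    have h3 := HasFDerivAt.comp_hasDerivAt (f := fun t : ℝ ↦ x + t * Complex.I) 0 h2 h1
    have h4 : HasDerivAt (fun t : ℝ ↦ φ₂ q (x.im + t)) (dirField κ α o) 0 := by
      have := (h.flow₂.hasDerivAt q (x.im + 0)).comp_const_add x.im 0
      simpa using this
    have h5 : (netMap φ₁ φ₂ p ∘ fun t : ℝ ↦ x + t * Complex.I) = fun t ↦ φ₂ q (x.im + t) := by
      funext t
      simp [netMap, hq]
    rw [h5] at h3
    exact h3.unique h4
  have hperp : (dirField κ α o * star e).re = 0 := by
    rw [he, dirField_mul_star]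
    rcases h.kappa with rfl | rfl <;> simp
  -- The arc carried from `q` to `o` is, to first order, the image under `D` of a horizontal vector
  -- plus a vertical one, and the latter is orthogonal to `e`.
  have key : 1 ≤ (D 1 * star e).re := by
    by_contra! hc
    set η := 1 - (D 1 * star e).re with hη
    have hη0 : 0 < η := by linarith
    have hc0 : 0 < η / (4 * (1 + C)) := by positivity
    have hlo := hD.isLittleO.def hc0
    obtain ⟨ρ, hρ, hball⟩ := Metric.eventually_nhds_iff.1 hlo
    have hsmall : ∀ᶠ s in 𝓝[>] (0 : ℝ), s ∈ Ioo 0 (min r (min (ρ / (1 + C))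
        (η / (4 * (C + L * C ^ 2 + 1))))) := Ioo_mem_nhdsGT (by positivity)
    obtain ⟨s, hs1, hs0, hs2⟩ := (hturn.and_eventually hsmall).exists
    rw [lt_min_iff, lt_min_iff, lt_div_iff₀ (by positivity), lt_div_iff₀ (by positivity)] at hs2
    rw [h.flow₁.add h.lip₁] at hs1
    obtain ⟨l, g, k1, k2, k3, k4, k5⟩ := hrC s ⟨hs0, hs2.1⟩ hs1
    set y : ℂ := ⟨x.re + s, g⟩ with hy
    have hyx : y - x = (s : ℝ) • (1 : ℂ) + (g - x.im) • Complex.I := by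
      apply Complex.ext <;> simp [hy]
    have hnorm : ‖y - x‖ ≤ s * (1 + C) := by
      rw [hyx]
      refine (norm_add_le _ _).trans ?_
      rw [norm_smul, norm_smul, norm_one, Complex.norm_I, Real.norm_eq_abs, Real.norm_eq_abs,
        abs_of_pos hs0]
      linarith
    have b1 := hball (y := y) (by rw [dist_eq_norm]; linarith [hs2.2.1])
    have hΦy : netMap φ₁ φ₂ p y = φ₁ o l := by
      rw [ho, k1, hq, ← h.flow₁.add h.lip₁, netMap]
    have hΦx : netMap φ₁ φ₂ p x = o := rfl
    rw [hΦy, hΦx, hyx, map_add, map_smul, map_smul, hDI, ← hyx] at b1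
    have b2 := norm_flow_sub_le norm_one h.lipschitz h.flow₁ o 0 l
    rw [h.flow₁.zero, sub_zero] at b2
    have re_le : ∀ z : ℂ, |(z * star e).re| ≤ ‖z‖ := fun z ↦ by
      simpa only [norm_mul, ne, mul_one] using Complex.abs_re_le_norm (z * star e)
    have c1 := (abs_le.1 ((re_le _).trans b1)).2
    have c2 := (abs_le.1 ((re_le _).trans b2)).1
    have hee : (e * star e).re = 1 := by
      rw [he, dirField_mul_star]; simp
    have d1 : ((φ₁ o l - o - (s • D 1 + (g - x.im) • dirField κ α o)) * star e).re
        = ((φ₁ o l - o) * star e).re - s * (D 1 * star e).re := by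
      simp only [Complex.real_smul, sub_mul, add_mul, mul_assoc, Complex.sub_re, Complex.add_re,
        Complex.re_ofReal_mul, hperp]
      ring
    have d2 : ((φ₁ o l - o - (l : ℝ) * dirField 1 α o) * star e).re
        = ((φ₁ o l - o) * star e).re - l := by
      rw [sub_mul _ ((l : ℂ) * _), mul_assoc, Complex.sub_re, Complex.re_ofReal_mul, hee, mul_one]
    rw [d1] at c1
    rw [d2] at c2
    have b3 : η / (4 * (1 + C)) * ‖y - x‖ ≤ η / 4 * s := by
      calc _ ≤ η / (4 * (1 + C)) * (s * (1 + C)) := by gcongr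
        _ = η / 4 * s := by field_simp
    have b4 : L * l ^ 2 ≤ L * (C * s) ^ 2 := by gcongr
    have e1 : (D 1 * star e).re = 1 - η := by rw [hη]; ring
    rw [e1] at c1
    have f1 := hs2.2.2
    nlinarith
  have hdet : |D.det| = |(D 1 * star e).re| := by
    rw [det_eq_re_mul_im_sub, hDI, he, dirField, dirField, one_mul, Complex.star_def]
    rcases h.kappa with rfl | rfl
    · congr 1
      simp [mul_comm]
    · rw [← abs_neg]
      congr 1
      simp [Complex.exp_ofReal_mul_I_re, Complex.exp_ofReal_mul_I_im]
      ring
  rw [hdet]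
  exact key.trans (le_abs_self _)

end IsNet

/-! ### Comparing the length of a characteristic with the area of a collar -/

theorem volume_le_volume_image {Φ : ℂ → ℂ} (hΦ : ∀ᵐ x, DifferentiableAt ℝ Φ x)
    (hi : Function.Injective Φ) {A : Set ℂ} (hA : MeasurableSet A)
    (hdet : ∀ x ∈ A, ∀ D : ℂ →L[ℝ] ℂ, HasFDerivAt Φ D x → 1 ≤ |D.det|) :
    volume A ≤ volume (Φ '' A) := by
  set A' := A ∩ {x | DifferentiableAt ℝ Φ x} with hA'
  have hmeas : MeasurableSet A' := hA.inter (measurableSet_of_differentiableAt ℝ Φ)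
  have h1 : volume A = volume A' :=
    measure_congr (inter_ae_eq_left_of_ae_eq_univ (eventuallyEq_univ.2 hΦ)).symm
  have h2 := lintegral_abs_det_fderiv_eq_addHaar_image volume hmeas
    (fun x hx ↦ (DifferentiableAt.hasFDerivAt hx.2).hasFDerivWithinAt) hi.injOn
  calc volume A = ∫⁻ _ in A', 1 := by rw [h1, setLIntegral_one]
    _ ≤ ∫⁻ x in A', ENNReal.ofReal |(fderiv ℝ Φ x).det| := by
      refine setLIntegral_mono' hmeas fun x hx ↦ ?_
      rw [← ENNReal.ofReal_one]
      exact ENNReal.ofReal_le_ofReal (hdet x hx.1 _ (DifferentiableAt.hasFDerivAt hx.2))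
    _ = volume (Φ '' A') := h2
    _ ≤ volume (Φ '' A) := measure_mono (image_mono inter_subset_left)

/-- Fubini's theorem for a set whose vertical slices are long, unless the corresponding slices of
some set of finite area are infinite. -/
theorem mul_volume_le_of_slices {c : ENNReal} {S : Set ℝ} (hS : MeasurableSet S) {W B : Set ℂ}
    (hW : MeasurableSet W) (hB : MeasurableSet B) (hfin : volume (W ∩ Complex.re ⁻¹' S) ≠ ⊤)
    (hslice : ∀ s ∈ S, volume {t : ℝ | (⟨s, t⟩ : ℂ) ∈ W} ≠ ⊤ →
      c ≤ volume {t : ℝ | (⟨s, t⟩ : ℂ) ∈ B}) :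
    c * volume S ≤ volume (B ∩ Complex.re ⁻¹' S) := by
  have mp := Complex.volume_preserving_equiv_real_prod.symm
  have hre : MeasurableSet (Complex.re ⁻¹' S) := Complex.measurable_re hS
  rw [← mp.measure_preimage (hW.inter hre).nullMeasurableSet] at hfin
  rw [← mp.measure_preimage (hB.inter hre).nullMeasurableSet]
  have mW := mp.measurable (hW.inter hre)
  have mB := mp.measurable (hB.inter hre)
  have hae := Measure.ae_measure_lt_top mW hfin
  rw [Measure.volume_eq_prod, Measure.prod_apply mB, ← lintegral_indicator_const hS]
  refine lintegral_mono_ae ?_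
  filter_upwards [hae] with s hs
  by_cases hsS : s ∈ S
  · rw [indicator_of_mem hsS]
    have e : ∀ V : Set ℂ, Prod.mk s ⁻¹' (Complex.measurableEquivRealProd.symm ⁻¹'
        (V ∩ Complex.re ⁻¹' S)) = {t : ℝ | (⟨s, t⟩ : ℂ) ∈ V} := by
      intro V
      ext t
      simp [hsS]
    rw [e] at hs ⊢
    exact hslice s hsS hs.ne
  · rw [indicator_of_notMem hsS]
    exact zero_le

namespace IsNet

variable {κ : ℂ} {α : ℂ → ℝ} {L : NNReal} {φ₁ φ₂ : ℂ → ℝ → ℂ}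

theorem continuous_netMap (h : IsNet κ α L φ₁ φ₂) (p : ℂ) : Continuous (netMap φ₁ φ₂ p) :=
  (h.flow₂.continuous_uncurry h.lip₂).comp
    (((h.flow₁.continuous p).comp Complex.continuous_re).prodMk Complex.continuous_im)

theorem injective_netMap (h : IsNet κ α L φ₁ φ₂) (p : ℂ) :
    Function.Injective (netMap φ₁ φ₂ p) := fun x y hxy ↦ by
  obtain ⟨h1, h2⟩ := net_injective h.lipschitz h.kappa h.flow₂ (h.flow₁.hasDerivAt p) hxy
  exact Complex.ext h1 h2

theorem ae_differentiableAt_netMap (h : IsNet κ α L φ₁ φ₂) (p : ℂ) :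
    ∀ᵐ x, DifferentiableAt ℝ (netMap φ₁ φ₂ p) x := by
  have key : ∀ n : ℕ, ∀ᵐ x : ℂ, |x.im| < n → DifferentiableAt ℝ (netMap φ₁ φ₂ p) x := by
    intro n
    set s : Set ℂ := {x | |x.im| < n} with hs
    have hso : IsOpen s := isOpen_lt (by fun_prop) continuous_const
    have hlip : LipschitzOnWith (Real.exp (L * n) + 1).toNNReal (netMap φ₁ φ₂ p) s := by
      refine LipschitzOnWith.of_dist_le_mul fun x hx y hy ↦ ?_
      rw [Real.coe_toNNReal _ (by positivity)]
      have h1 := h.flow₂.dist_le h.lip₂ (φ₁ p x.re) (φ₁ p y.re) x.im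
      have h2 := h.flow₁.dist_time_le (fun w ↦ (norm_dirField norm_one α w).le) p x.re y.re
      have h3 := h.flow₂.dist_time_le
        (fun w ↦ (norm_dirField (norm_of_eq_I_or h.kappa) α w).le) (φ₁ p y.re) x.im y.im
      have h4 : |x.re - y.re| ≤ dist x y := by
        rw [dist_eq_norm]; exact Complex.abs_re_le_norm (x - y)
      have h5 : |x.im - y.im| ≤ dist x y := by
        rw [dist_eq_norm]; exact Complex.abs_im_le_norm (x - y)
      have h6 : Real.exp (L * |x.im|) ≤ Real.exp (L * n) := by
        have : |x.im| ≤ n := le_of_lt hx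
        gcongr
      calc _ ≤ dist (φ₂ (φ₁ p x.re) x.im) (φ₂ (φ₁ p y.re) x.im)
            + dist (φ₂ (φ₁ p y.re) x.im) (φ₂ (φ₁ p y.re) y.im) := dist_triangle _ _ _
        _ ≤ dist x y * Real.exp (L * n) + dist x y := by
          refine add_le_add (h1.trans ?_) (h3.trans h5)
          exact mul_le_mul (h2.trans h4) h6 (Real.exp_pos _).le dist_nonneg
        _ = _ := by ring
    filter_upwards [hlip.ae_differentiableWithinAt_of_mem (μ := volume)] with x hx hxs
    exact (hx hxs).differentiableAt (hso.mem_nhds hxs)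
  filter_upwards [ae_all_iff.2 key] with x hx
  obtain ⟨n, hn⟩ := exists_nat_gt |x.im|
  exact hx n hn

theorem isOpen_setOf_forall_netMap (h : IsNet κ α L φ₁ φ₂) (p : ℂ) {U : Set ℂ} (hU : IsOpen U) :
    IsOpen {x : ℂ | 0 < x.im ∧ ∀ u ∈ Icc (0 : ℝ) 1, netMap φ₁ φ₂ p ⟨x.re, u * x.im⟩ ∈ U} := by
  refine (isOpen_lt continuous_const Complex.continuous_im).inter (isOpen_iff_mem_nhds.2 ?_)
  intro x hx
  have hc : Continuous fun y : ℂ × ℝ ↦ netMap φ₁ φ₂ p ⟨y.1.re, y.2 * y.1.im⟩ := by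
    refine (h.flow₂.continuous_uncurry h.lip₂).comp (((h.flow₁.continuous p).comp ?_).prodMk ?_) <;>
    fun_prop
  refine isCompact_Icc.eventually_forall_of_forall_eventually (x₀ := x)
    (P := fun x u ↦ netMap φ₁ φ₂ p ⟨x.re, u * x.im⟩ ∈ U) fun u hu ↦ ?_
  exact hc.continuousAt.preimage_mem_nhds (hU.mem_nhds (hx u hu))

/-- Trajectories of the second family that start deep inside `G`, on the part of a curve of the
first family that turns away from them, sweep out the collar of `G` without contracting area. -/
theorem mul_volume_le_volume_collar (h : IsNet κ α L φ₁ φ₂) {G : Set ℂ} {θ : ℂ → ℝ} {k i : Fin 2}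
    {K : ℝ} (hK : 1 ≤ K) (hHP : IsQuasiHP G K θ) {σ : ℝ} (hσ : σ = 1 ∨ σ = -1)
    (hκ : κ = -(σ : ℂ) * Complex.I) {R ε : ℝ} (hR : 0 < R) (hLR : L * R ≤ 1 / 8)
    (hGfin : volume G ≠ ⊤)
    (hU : ∀ w, ε < Metric.infDist w Gᶜ → Metric.closedBall w R ⊆ G ∧
      IsAdapted θ k i κ α (Metric.closedBall w R)) (p : ℂ) {S : Set ℝ} (hS : MeasurableSet S)
    (hturn : ∀ s ∈ S, ∃ᶠ δ in 𝓝[>] (0 : ℝ), 0 ≤ σ * (α (φ₁ p (s + δ)) - α (φ₁ p s)))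
    (hdeep : ∀ s ∈ S, 2 * ε ≤ Metric.infDist (φ₁ p s) Gᶜ) :
    ENNReal.ofReal ε * volume S ≤
      volume {w | ε < Metric.infDist w Gᶜ ∧ Metric.infDist w Gᶜ < 2 * ε} := by
  set d : ℂ → ℝ := fun w ↦ Metric.infDist w Gᶜ with hd
  have hdc : Continuous d := Metric.continuous_infDist_pt _
  set U : Set ℂ := {w | ε < d w} with hUdef
  have hUo : IsOpen U := isOpen_lt continuous_const hdc
  have hUG : U ⊆ G := fun w hw ↦ (hU w hw).1 (Metric.mem_closedBall_self hR.le)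
  set Φ := netMap φ₁ φ₂ p with hΦ
  set W := {x : ℂ | 0 < x.im ∧ ∀ u ∈ Icc (0 : ℝ) 1, Φ ⟨x.re, u * x.im⟩ ∈ U} with hW
  have hWo : IsOpen W := h.isOpen_setOf_forall_netMap p hUo
  set B := W ∩ Φ ⁻¹' {w | d w < 2 * ε} with hB
  have hBo : IsOpen B := hWo.inter ((isOpen_lt hdc continuous_const).preimage (h.continuous_netMap p))
  have hWU : ∀ x ∈ W, Φ x ∈ U := fun x hx ↦ by simpa using hx.2 1 ⟨zero_le_one, le_rfl⟩
  have harea : ∀ A : Set ℂ, MeasurableSet A → A ⊆ W → A ⊆ Complex.re ⁻¹' S →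
      volume A ≤ volume (Φ '' A) := by
    intro A hA hAW hAS
    refine volume_le_volume_image (h.ae_differentiableAt_netMap p) (h.injective_netMap p) hA ?_
    intro x hx D hD
    have hmem : ∀ t ∈ Icc 0 x.im, ε < d (φ₂ (φ₁ p x.re) t) := by
      intro t ht
      have hx0 := (hAW hx).1
      have := (hAW hx).2 (t / x.im) ⟨div_nonneg ht.1 hx0.le, (div_le_one hx0).2 ht.2⟩
      rwa [div_mul_cancel₀ _ hx0.ne'] at this
    exact h.one_le_abs_det hK hHP hσ hκ hR (hAW hx).1 hLR (fun t ht ↦ (hU _ (hmem t ht)).1)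
      (fun t ht ↦ (hU _ (hmem t ht)).2) (hturn _ (hAS hx)) hD
  have hre : MeasurableSet (Complex.re ⁻¹' S) := Complex.measurable_re hS
  have hfin : volume (W ∩ Complex.re ⁻¹' S) ≠ ⊤ := by
    refine ne_top_of_le_ne_top hGfin ((harea _ (hWo.measurableSet.inter hre) inter_subset_left
      inter_subset_right).trans (measure_mono ?_))
    rintro _ ⟨x, hx, rfl⟩
    exact hUG (hWU x hx.1)
  refine (mul_volume_le_of_slices hS hWo.measurableSet hBo.measurableSet hfin ?_).trans
    ((harea _ (hBo.measurableSet.inter hre) (inter_subset_left.trans inter_subset_left)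
      inter_subset_right).trans (measure_mono ?_))
  · intro s hs hslice
    set q := φ₁ p s with hq
    have hWs : ∀ t : ℝ, 0 < t → (∀ t' ∈ Icc 0 t, ε < d (φ₂ q t')) → (⟨s, t⟩ : ℂ) ∈ W := by
      intro t ht hall
      exact ⟨ht, fun u hu ↦ hall _ ⟨mul_nonneg hu.1 ht.le, mul_le_of_le_one_left ht.le hu.2⟩⟩
    have hlip : ∀ t t', d (φ₂ q t) ≤ d (φ₂ q t') + |t - t'| := fun t t' ↦
      (Metric.infDist_le_infDist_add_dist).trans (add_le_add le_rfl
        (h.flow₂.dist_time_le (fun w ↦ (norm_dirField (norm_of_eq_I_or h.kappa) α w).le) q t t'))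
    by_cases hex : ∃ t, 0 ≤ t ∧ d (φ₂ q t) ≤ ε
    · obtain ⟨t₀, ht₀, hdt₀⟩ := hex
      have hcomp : IsCompact (Icc 0 t₀ ∩ {t | d (φ₂ q t) ≤ ε}) :=
        isCompact_Icc.inter_right (isClosed_le (hdc.comp (h.flow₂.continuous q)) continuous_const)
      obtain ⟨T, ⟨⟨hT0, hTt₀⟩, hT⟩, hleast⟩ := hcomp.exists_isLeast ⟨t₀, ⟨ht₀, le_rfl⟩, hdt₀⟩
      have hbefore : ∀ t, 0 ≤ t → t < T → ε < d (φ₂ q t) := by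
        intro t ht htT
        by_contra! hc
        exact htT.not_ge (hleast ⟨⟨ht, (htT.trans_le hTt₀).le⟩, hc⟩)
      have hTε : ε ≤ T := by
        have h1 := hlip 0 T
        rw [h.flow₂.zero, zero_sub, abs_neg, abs_of_nonneg hT0] at h1
        have h2 : 2 * ε ≤ d q := hdeep s hs
        have h3 : d (φ₂ q T) ≤ ε := hT
        linarith
      have hsub : Ioo (T - ε) T ⊆ {t : ℝ | (⟨s, t⟩ : ℂ) ∈ B} := by
        intro t ht
        have ht0 : 0 < t := by linarith [ht.1]
        refine ⟨hWs t ht0 fun t' ht' ↦ hbefore t' ht'.1 (ht'.2.trans_lt ht.2), ?_⟩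
        have h1 := hlip t T
        rw [abs_sub_comm, abs_of_nonneg (by linarith [ht.2])] at h1
        have h3 : d (φ₂ q T) ≤ ε := hT
        change d (φ₂ q t) < 2 * ε
        linarith [ht.1]
      calc ENNReal.ofReal ε = volume (Ioo (T - ε) T) := by rw [Real.volume_Ioo]; congr 1; ring
        _ ≤ _ := measure_mono hsub
    · -- A trajectory that never leaves `U` would give a slice of infinite length.
      push Not at hex
      refine absurd ?_ hslice
      refine eq_top_mono (measure_mono (s := Ioi (0 : ℝ)) fun t ht ↦ ?_) Real.volume_Ioi
      exact hWs t ht fun t' ht' ↦ hex t' ht'.1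
  · rintro _ ⟨x, hx, rfl⟩
    exact ⟨hWU x hx.1.1, hx.1.2⟩

end IsNet

/-! ### The area of the collar of a Jordan domain -/

/-- The collar of a domain bounded by a rectifiable curve has area at most proportional to its
width. -/
theorem IsC2JordanDomain.exists_volume_collar_le {G : Set ℂ} (hG : IsC2JordanDomain G) :
    ∃ c : ℝ, 0 ≤ c ∧ ∀ ε ∈ Ioc (0 : ℝ) 1,
      volume {w | ε < Metric.infDist w Gᶜ ∧ Metric.infDist w Gᶜ < 2 * ε} ≤
        ENNReal.ofReal (c * ε) := by
  obtain ⟨γ, hγ, -, hper, -, hrange⟩ := hG.boundary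
  have hγ1 : ContDiff ℝ 1 γ := hγ.of_le (by norm_num)
  obtain ⟨C, hC⟩ := (hγ1.locallyLipschitz.locallyLipschitzOn
    (s := Icc 0 1)).exists_lipschitzOnWith_of_compact isCompact_Icc
  have hfront : frontier G = γ '' Icc 0 1 := by
    rw [← hrange, ← hper.image_Icc one_pos 0, zero_add]
  have hne : G ≠ univ := fun h ↦ NormedSpace.unbounded_univ ℝ ℂ (h ▸ hG.isBounded)
  refine ⟨3 * Real.pi * (C + 2) ^ 2, by positivity, fun ε ⟨hε, hε1⟩ ↦ ?_⟩
  set n := ⌈1 / ε⌉₊ with hn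
  have hn1 : 1 / ε ≤ n := Nat.le_ceil _
  have hn0 : (0 : ℝ) < n := (by positivity : (0 : ℝ) < 1 / ε).trans_le hn1
  have hn2 : (n : ℝ) < 1 / ε + 1 := Nat.ceil_lt_add_one (by positivity)
  have hεn : 1 / n ≤ ε := by
    rw [div_le_iff₀ hε] at hn1
    rw [div_le_iff₀ hn0]
    linarith
  have hcover : {w | ε < Metric.infDist w Gᶜ ∧ Metric.infDist w Gᶜ < 2 * ε} ⊆
      ⋃ j ∈ Finset.range (n + 1), Metric.closedBall (γ (j / n)) ((C + 2) * ε) := by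
    rintro w ⟨hw1, hw2⟩
    have hwG : w ∈ G := by
      by_contra hc
      rw [Metric.infDist_zero_of_mem (show w ∈ Gᶜ from hc)] at hw1
      linarith
    obtain ⟨y, hy, hyd⟩ := exists_mem_frontier_infDist_compl_eq_dist hwG hne
    rw [hfront] at hy
    obtain ⟨t, ht, rfl⟩ := hy
    have htn : 0 ≤ t * n := mul_nonneg ht.1 hn0.le
    have hj1 := Nat.floor_le htn
    have hj2 := Nat.lt_floor_add_one (t * n)
    set j := ⌊t * n⌋₊ with hj
    have hjn : j ≤ n := by
      have : (j : ℝ) ≤ n := hj1.trans (mul_le_of_le_one_left hn0.le ht.2)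
      exact_mod_cast this
    have hjmem : (j : ℝ) / n ∈ Icc (0 : ℝ) 1 :=
      ⟨by positivity, (div_le_one hn0).2 (by exact_mod_cast hjn)⟩
    have hdist : dist t (j / n) ≤ ε := by
      rw [Real.dist_eq, abs_of_nonneg (by rw [sub_nonneg, div_le_iff₀ hn0]; exact hj1)]
      refine le_trans ?_ hεn
      rw [sub_le_iff_le_add, ← add_div, le_div_iff₀ hn0]
      linarith
    refine mem_biUnion (x := j) (by simp; omega) ?_
    rw [Metric.mem_closedBall]
    have h1 := hC.dist_le_mul t ht _ hjmem
    have h2 : C * dist t (j / n) ≤ C * ε := by gcongr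
    calc dist w (γ (j / n)) ≤ dist w (γ t) + dist (γ t) (γ (j / n)) := dist_triangle _ _ _
      _ ≤ 2 * ε + C * ε := by linarith
      _ = _ := by ring
  have hpi : (NNReal.pi : ENNReal) = ENNReal.ofReal Real.pi := by
    rw [← NNReal.coe_real_pi, ENNReal.ofReal_coe_nnreal]
  calc _ ≤ ∑ j ∈ Finset.range (n + 1), volume (Metric.closedBall (γ (j / n)) ((C + 2) * ε)) :=
        (measure_mono hcover).trans (measure_biUnion_finset_le _ _)
    _ = ENNReal.ofReal ((n + 1 : ℕ) * (((C + 2) * ε) ^ 2 * Real.pi)) := by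
      simp only [Complex.volume_closedBall, Finset.sum_const, Finset.card_range, nsmul_eq_mul]
      rw [ENNReal.ofReal_mul (p := ((n + 1 : ℕ) : ℝ)) (by positivity), ENNReal.ofReal_natCast,
        ENNReal.ofReal_mul (p := ((C + 2) * ε) ^ 2) (by positivity),
        ENNReal.ofReal_pow (by positivity), hpi]
    _ ≤ _ := by
      refine ENNReal.ofReal_le_ofReal ?_
      have h3 : ((n + 1 : ℕ) : ℝ) * ε ≤ 3 := by
        push_cast
        have : (1 / ε + 1) * ε = 1 + ε := by field_simp
        nlinarith
      have h4 : 0 ≤ ((C : ℝ) + 2) ^ 2 * ε * Real.pi := by positivity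
      nlinarith

/-! ### The length of compact arcs of characteristics -/

theorem measurableSet_frequently_lt {f : ℝ → ℝ} (hf : Continuous f) :
    MeasurableSet {s | ∃ᶠ δ in 𝓝[>] (0 : ℝ), f s < f (s + δ)} := by
  have e : {s | ∃ᶠ δ in 𝓝[>] (0 : ℝ), f s < f (s + δ)} =
      ⋂ n : ℕ, ⋃ δ ∈ Ioo (0 : ℝ) (1 / (n + 1)), {s | f s < f (s + δ)} := by
    ext s
    simp only [mem_iInter, mem_iUnion, exists_prop, mem_ofPred_eq]
    rw [(nhdsGT_basis (0 : ℝ)).frequently_iff]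
    constructor
    · intro h n
      exact h _ Nat.one_div_pos_of_nat
    · intro h r hr
      obtain ⟨n, hn⟩ := exists_nat_one_div_lt hr
      obtain ⟨δ, hδ, hlt⟩ := h n
      exact ⟨δ, ⟨hδ.1, hδ.2.trans hn⟩, hlt⟩
  rw [e]
  exact MeasurableSet.iInter fun n ↦ (isOpen_biUnion fun δ _ ↦
    isOpen_lt hf (hf.comp (continuous_id.add continuous_const))).measurableSet

/-- The parameters at which the slope angle increases at arbitrarily small steps are served by the
family on one side of the curve, the other parameters by the one on the opposite side. -/
theorem mul_sub_le_volume_collar {G : Set ℂ} {θ : ℂ → ℝ} {k i : Fin 2} {K : ℝ} (hK : 1 ≤ K)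
    (hHP : IsQuasiHP G K θ) {α : ℂ → ℝ} {L : NNReal} (hα : LipschitzWith L α) {φ₁ : ℂ → ℝ → ℂ}
    (hφ₁ : IsFlow (dirField 1 α) φ₁) {R ε : ℝ} (hR : 0 < R) (hLR : L * R ≤ 1 / 8)
    (hGfin : volume G ≠ ⊤)
    (hU : ∀ κ, κ = Complex.I ∨ κ = -Complex.I → ∀ w, ε < Metric.infDist w Gᶜ →
      Metric.closedBall w R ⊆ G ∧ IsAdapted θ k i κ α (Metric.closedBall w R))
    (p : ℂ) {l : ℝ} (hdeep : ∀ s ∈ Icc 0 l, 2 * ε ≤ Metric.infDist (φ₁ p s) Gᶜ) :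
    ENNReal.ofReal ε * ENNReal.ofReal l ≤
      2 * volume {w | ε < Metric.infDist w Gᶜ ∧ Metric.infDist w Gᶜ < 2 * ε} := by
  set f : ℝ → ℝ := fun s ↦ α (φ₁ p s) with hf
  have hfc : Continuous f := hα.continuous.comp (hφ₁.continuous p)
  set S := {s | ∃ᶠ δ in 𝓝[>] (0 : ℝ), f s < f (s + δ)} with hS
  have hSm : MeasurableSet S := measurableSet_frequently_lt hfc
  have net : ∀ κ, κ = Complex.I ∨ κ = -Complex.I → ∃ φ₂, IsNet κ α L φ₁ φ₂ := by
    intro κ hκ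
    obtain ⟨φ₂, hφ₂⟩ := exists_isFlow (lipschitzWith_dirField (norm_of_eq_I_or hκ) hα)
      (fun w ↦ (norm_dirField (norm_of_eq_I_or hκ) α w).le)
    exact ⟨φ₂, hκ, hα, hφ₁, hφ₂⟩
  obtain ⟨φ₂, h₂⟩ := net _ (Or.inr rfl)
  obtain ⟨ψ₂, k₂⟩ := net _ (Or.inl rfl)
  have h1 := h₂.mul_volume_le_volume_collar hK hHP (σ := 1) (Or.inl rfl) (by simp) hR hLR hGfin
    (hU _ (Or.inr rfl)) p (S := Icc 0 l ∩ S) (measurableSet_Icc.inter hSm)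
    (fun s hs ↦ hs.2.mono fun δ hδ ↦ by rw [one_mul]; exact sub_nonneg.2 hδ.le)
    (fun s hs ↦ hdeep s hs.1)
  have h2 := k₂.mul_volume_le_volume_collar hK hHP (σ := -1) (Or.inr rfl) (by simp) hR hLR hGfin
    (hU _ (Or.inl rfl)) p (S := Icc 0 l \ S) (measurableSet_Icc.diff hSm)
    (fun s hs ↦ by
      have h3 : ∀ᶠ δ in 𝓝[>] (0 : ℝ), ¬ f s < f (s + δ) := not_frequently.1 hs.2
      refine (h3.mono fun δ hδ ↦ ?_).frequently
      rw [not_lt] at hδ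
      change 0 ≤ -1 * (f (s + δ) - f s)
      linarith)
    (fun s hs ↦ hdeep s hs.1)
  calc _ = ENNReal.ofReal ε * (volume (Icc 0 l ∩ S) + volume (Icc 0 l \ S)) := by
        rw [measure_inter_add_sdiff _ hSm, Real.volume_Icc, sub_zero]
    _ ≤ _ := by
      rw [mul_add, two_mul]
      exact add_le_add h1 h2

/-- The slope angle of the family `k` is `θ` plus `k` right angles. -/
theorem isAdapted_of_eqOn {θ ϑ : ℂ → ℝ} {U : Set ℂ} (h : EqOn θ ϑ U) (k : Fin 2) {κ : ℂ}
    (hκ : κ = Complex.I ∨ κ = -Complex.I) :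
    IsAdapted θ k (1 - k) κ (fun w ↦ ϑ w + (k : ℕ) * (Real.pi / 2)) U := by
  have e : ∀ w ∈ U, Complex.exp ((ϑ w + (k : ℕ) * (Real.pi / 2) : ℝ) * Complex.I)
      = Complex.I ^ (k : ℕ) * Complex.exp (θ w * Complex.I) := by
    intro w hw
    rw [h hw]
    push_cast
    rw [add_mul, Complex.exp_add, mul_assoc, Complex.exp_nat_mul, Complex.exp_pi_div_two_mul_I,
      mul_comm]
  refine ⟨?_, fun w hw ↦ ?_, ?_, fun w hw w' hw' ↦ ?_⟩
  · fin_cases k <;> simp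
  · rw [dirField, one_mul, e w hw, charField]
  · have key : (∀ w ∈ U, charField θ (1 - k) w = κ * (Complex.I ^ (k : ℕ) *
        Complex.exp (θ w * Complex.I))) ∨ (∀ w ∈ U, charField θ (1 - k) w =
        -(κ * (Complex.I ^ (k : ℕ) * Complex.exp (θ w * Complex.I)))) := by
      fin_cases k <;> rcases hκ with rfl | rfl <;> simp [charField, ← mul_assoc]
    refine key.imp (fun hs w hw ↦ ?_) (fun hs w hw ↦ ?_) <;> rw [hs w hw, dirField, e w hw]
  · rw [h hw, h hw']
    ring

/-- Compact arcs of characteristics have bounded length. -/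
theorem IsC2JordanDomain.exists_length_le {G : Set ℂ} (hG : IsC2JordanDomain G) :
    ∃ M : ℝ, ∀ K θ, 1 ≤ K → IsQuasiHP G K θ → ∀ (k : Fin 2) (z : ℝ → ℂ) (a b : ℝ),
      IsIntegralCurveOn z (fun _ ↦ charField θ k) (Icc a b) → MapsTo z (Icc a b) G →
        b - a ≤ M := by
  obtain ⟨c, hc0, hc⟩ := hG.exists_volume_collar_le
  refine ⟨2 * c, fun K θ hK hHP k z a b hz hzG ↦ ?_⟩
  rcases lt_or_ge b a with hab | hab
  · linarith
  have hne : G ≠ univ := fun h ↦ NormedSpace.unbounded_univ ℝ ℂ (h ▸ hG.isBounded)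
  have hpos : ∀ w, 0 < Metric.infDist w Gᶜ ↔ w ∈ G := by
    intro w
    rw [← hG.isOpen.isClosed_compl.notMem_iff_infDist_pos (nonempty_compl.2 hne), notMem_compl_iff]
  set d : ℂ → ℝ := fun w ↦ Metric.infDist w Gᶜ with hd
  have hdc : Continuous d := Metric.continuous_infDist_pt _
  have hzc : ContinuousOn z (Icc a b) := fun s hs ↦ (hz s hs).continuousWithinAt
  obtain ⟨s₀, hs₀, hmin⟩ := isCompact_Icc.exists_isMinOn (nonempty_Icc.2 hab)
    (hdc.comp_continuousOn hzc)
  have hm0 : 0 < d (z s₀) := (hpos _).2 (hzG hs₀)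
  obtain ⟨ε, hε, hε1, hε2⟩ : ∃ ε, 0 < ε ∧ ε ≤ 1 ∧ 2 * ε ≤ d (z s₀) :=
    ⟨min 1 (d (z s₀) / 2), by positivity, min_le_left _ _, by
      linarith [min_le_right 1 (d (z s₀) / 2)]⟩
  set E := {w | ε / 2 ≤ d w} with hE
  have hEG : E ⊆ G := fun w hw ↦ (hpos w).1 (lt_of_lt_of_le (by positivity) hw)
  have hEc : IsCompact E := Metric.isCompact_of_isClosed_isBounded
    (isClosed_le continuous_const hdc) (hG.isBounded.subset hEG)
  obtain ⟨L, hL⟩ := (hHP.locallyLipschitzOn.mono hEG).exists_lipschitzOnWith_of_compact hEc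
  obtain ⟨ϑ, hϑ, hϑE⟩ := hL.extend_real
  set α : ℂ → ℝ := fun w ↦ ϑ w + (k : ℕ) * (Real.pi / 2) with hα
  have hαL : LipschitzWith L α := by
    refine LipschitzWith.of_dist_le_mul fun w w' ↦ ?_
    simpa [hα] using hϑ.dist_le_mul w w'
  obtain ⟨φ₁, hφ₁⟩ := exists_isFlow (lipschitzWith_dirField norm_one hαL)
    (fun w ↦ (norm_dirField norm_one α w).le)
  have had : ∀ κ, κ = Complex.I ∨ κ = -Complex.I → IsAdapted θ k (1 - k) κ α E :=
    fun κ hκ ↦ isAdapted_of_eqOn hϑE k hκ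
  set R := min (ε / 2) (1 / (8 * (L + 1))) with hR
  have hR0 : 0 < R := by positivity
  have hLR : L * R ≤ 1 / 8 := by
    have h1 : R ≤ 1 / (8 * (L + 1)) := min_le_right _ _
    rw [le_div_iff₀ (by positivity)] at h1
    nlinarith
  have hball : ∀ w, ε < d w → Metric.closedBall w R ⊆ E := by
    intro w hw w' hw'
    have h1 : d w ≤ d w' + dist w w' := Metric.infDist_le_infDist_add_dist
    rw [Metric.mem_closedBall, dist_comm] at hw'
    have h2 : R ≤ ε / 2 := min_le_left _ _
    change ε / 2 ≤ d w'
    linarith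
  have hmem : ∀ s ∈ Icc 0 (b - a), a + s ∈ Icc a b := fun s hs ↦
    ⟨by linarith [hs.1], by linarith [hs.2]⟩
  have hdeep' : ∀ s ∈ Icc a b, 2 * ε ≤ d (z s) := fun s hs ↦ hε2.trans (hmin hs)
  have hflow : ∀ s ∈ Icc 0 (b - a), z (a + s) = φ₁ (z a) s := by
    have := hφ₁.eq_flow_of_mem_Icc (lipschitzWith_dirField norm_one hαL)
      (z := fun s ↦ z (a + s)) (T := b - a) (fun s hs ↦ by
        have h1 := hz _ (hmem s hs)
        beta_reduce at h1
        rw [(had _ (Or.inl rfl)).fst _ (show ε / 2 ≤ d _ by linarith [hdeep' _ (hmem s hs)])] at h1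
        have h2 := h1.scomp s (((hasDerivAt_id s).const_add a).hasDerivWithinAt) hmem
        simpa [Function.comp_def] using h2)
    simpa using this
  have hmain := mul_sub_le_volume_collar hK hHP hαL hφ₁ hR0 hLR hG.isBounded.measure_lt_top.ne
    (fun κ hκ w hw ↦ ⟨(hball w hw).trans hEG, (had κ hκ).mono (hball w hw)⟩) (z a) (l := b - a)
    (fun s hs ↦ by rw [← hflow s hs]; exact hdeep' _ (hmem s hs))
  have hfin := hmain.trans (mul_le_mul_right (hc ε ⟨hε, hε1⟩) 2)
  rw [← ENNReal.ofReal_mul hε.le, ← ENNReal.ofReal_ofNat 2, ← ENNReal.ofReal_mul zero_le_two,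
    ENNReal.ofReal_le_ofReal_iff (by positivity)] at hfin
  nlinarith

end QuasiHP

end

theorem proposition3p4 (G : Set ℂ) (hG : QuasiHP.IsC2JordanDomain G) (K : ℝ) (hK : 1 ≤ K) :
    ∃ M : ℝ, ∀ θ : ℂ → ℝ, QuasiHP.IsQuasiHP G K θ →
      ∀ (k : Fin 2) (C : Set ℂ), QuasiHP.IsElementaryCharacteristic G θ k C →
        MeasureTheory.Measure.hausdorffMeasure 1 C ≤ ENNReal.ofReal M := by
  obtain ⟨M, hM⟩ := hG.exists_length_le
  refine ⟨M, fun θ hHP k C hC ↦ ?_⟩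
  have : NullSingletonClass (Measure.hausdorffMeasure 1 : Measure ℂ) :=
    Measure.nullSingletonClass_hausdorff ℂ one_pos
  rcases hC with ⟨I, z, p, q, hI, -, -, -, -, rfl⟩ | ⟨p, -, rfl⟩
  · have hlip : LipschitzOnWith 1 z I := by
      refine hI.ordConnected.convex.lipschitzOnWith_of_nnnorm_hasDerivWithin_le
        (fun s hs ↦ hI.integral s hs) fun s _ ↦ ?_
      beta_reduce
      rw [← NNReal.coe_le_coe, coe_nnnorm, QuasiHP.charField, norm_mul, norm_pow, Complex.norm_I,
        one_pow, one_mul, Complex.norm_exp_ofReal_mul_I, NNReal.coe_one]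
    have hle : ∀ a ∈ I, ∀ b ∈ I, b - a ≤ M := fun a ha b hb ↦
      hM K θ hK hHP k z a b (fun s hs ↦ (hI.integral s (hI.ordConnected.out ha hb hs)).mono
        (hI.ordConnected.out ha hb)) fun s hs ↦ hI.mapsTo (hI.ordConnected.out ha hb hs)
    have hvol : volume I ≤ ENNReal.ofReal M := by
      refine (Real.volume_le_diam I).trans (Metric.ediam_le fun a ha b hb ↦ ?_)
      rw [edist_dist]
      refine ENNReal.ofReal_le_ofReal ?_
      rw [Real.dist_eq, abs_le]
      constructor <;> linarith [hle a ha b hb, hle b hb a ha]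
    rw [measure_congr (insert_ae_eq_self p _), measure_congr (insert_ae_eq_self q _)]
    refine (hlip.hausdorffMeasure_image_le zero_le_one).trans ?_
    rw [hausdorffMeasure_real]
    simpa using hvol
  · rw [measure_singleton]
    exact zero_le
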